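/- **Setting.** There are $K\ge 1$ base algorithms $\mathcal A_1,\dots,\mathcal A_K$, where $\mathcal A_i$ has a finite action set $[k_i]$, and a horizon $T\ge 2$ with $K\log^2T\le T$. In every round $t$ each action $a$ has a loss $\ell_t(a)\in[0,1]$; the losses are arbitrary (stochastic or adversarial, possibly adaptive to the past; actions of different base algorithms may coincide in loss and no gap is assumed). A base algorithm proposes actions as a (randomized) function of an environment parameter and of its own past actions and feedback since its last restart. Put $\beta=e^{1/\log^2T}$, $\rho_s=36\cdot 2^{s-1}$ for $1\le s\le n$, where $n$ is the largest index with $\rho_n\le KT$, and $S=K(\lceil\log T\rceil+1)$. For step sizes $\eta\in(0,\infty)^K$ let $\Psi_\eta(w)=-4\sum_i\frac1{\eta_i}(\sqrt{w_i}-\frac12w_i)$, with Bregman divergence $D_{\Psi_\eta}$. Let $\Delta^{K-1}$ be the probability simplex. **Algorithm (corralling with Tsallis-INF).** *Input:* initial step sizes $\eta_{1,i}>0$. *Initial phase* (the first $S$ rounds): the base algorithms are played in turn, each $\lceil\log T\rceil+1$ times, each being told its own losses; $\hat L_i$ is the sum of the losses of $\mathcal A_i$, and after every round the step sizes are decreased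 by $1/\eta_{t+1,i}^2=1/\eta_{t,i}^2+1/\eta_{1,i}^2$. The next distribution is $w=\arg\min_{w\in\Delta^{K-1}}\langle\hat L,w\rangle+\Psi_{\eta}(w)$. The initial phase is the first epoch, and each later epoch is twice as long as the preceding one. *Every later round $t$:* all base algorithms propose actions $a_{i,t}$; $i_t$ is sampled from $\bar w_t=(1-\frac1{TK})w_t+\frac1{TK}\mathrm{Unif}$; $\ell_t(a_{i_t,t})$ is observed; with $\hat\ell_{t}=\frac{\ell_t(a_{i_t,t})}{\bar w_{t,i_t}}\mathrm e_{i_t}$, each $\mathcal A_i$ receives the feedback $\hat\ell_{t,i}$. Then: (a) In the first round of an epoch, each $\mathcal A_i$ gets the current threshold index $\theta_i=\min\{s: w_{t,i}>1/\rho_s\}$ ($n+1$ if there is none), and if $\mathcal R=\{i:w_{t,i}\le1/\rho_1\}\neq\emptyset$ (with $n\ge1$), a negative-regret step with $\mathcal R$ is made. (b) Otherwise, if $\mathcal R=\{i:\theta_i\le n,\ w_{t,i}\le1/\rho_{\theta_i}\}\ne\emptyset$ and the prior step was not a negative-regret step, $\theta_i$ is increased by one for $i\in\mathcal R$ and a negative-regret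 step with $\mathcal R$ is made. (c) Otherwise $\hat L_t=\hat L_{t-1}+\hat\ell_t$, $1/\eta_{t+1,i}^2=1/\eta_{t,i}^2+1/\eta_{1,i}^2$ and $w_{t+1}=\arg\min_{w\in\Delta^{K-1}}\langle\hat L_t,w\rangle+\Psi_{\eta_{t+1}}(w)$. A negative-regret step sets $w_{t+1}=\arg\min_{w\in\Delta^{K-1}}\langle\hat\ell_t,w\rangle+D_{\Psi_{\eta_t}}(w,w_t)$; plays round $t+1$; multiplies the step sizes of $i\in\mathcal R$ by $\beta$, which gives $\eta'$; sets $w_{t+2}=\arg\min_{w\in\Delta^{K-1}}\langle\hat\ell_{t+1},w\rangle+D_{\Psi_{\eta'}}(w,w_{t+1})$ and $\hat L_{t+1}=-\nabla\Psi_{\eta'}(w_{t+1})+\hat\ell_{t+1}$; restarts $\mathcal A_i$ with environment parameter $2/w_{t,i}$ for $i\in\mathcal R$; plays round $t+2$; and sets $\hat L_{t+2}=\hat L_{t+1}+\hat\ell_{t+2}$, $w_{t+3}=\arg\min_{w\in\Delta^{K-1}}\langle\hat L_{t+2},w\rangle+\Psi_{\eta'}(w)$. If an epoch begins during these extra rounds,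 (a) is carried out in the first round after them. **Stability of $\mathcal A_{i^*}$.** Let $a^*$ be an action of $\mathcal A_{i^*}$ (in particular, the best action overall). Assume that $\mathcal A_{i^*}$ is $\frac12$-stable with regret function $R_{i^*}\ge0$: if the epochs after the initial phase that begin before $T$ have $s_\tau$ rounds before the horizon, and $\rho_\tau$ is the least element of $\{36,72,144,\dots\}$ with $\bar w_{t,i^*}>1/\rho_\tau$ for all rounds $t$ of epoch $\tau$, then $$\mathbb E\Big[\sum_{t>S}^{T}\big(\hat\ell_{t,i^*}-\ell_t(a^*)\big)\Big]\le\sum_\tau\mathbb E\big[\sqrt{\rho_\tau}\big]\,R_{i^*}(s_\tau).$$ **Theorem 5.** There is an absolute constant $C>0$ such that the following holds in this setting. Let $\bar R_{i^*}(t)\ge R_{i^*}(t)$ for $1\le t\le T$, and suppose that $\eta_{1,i^*}\le1$ and $$\eta_{1,i^*}\le\min_{1\le t\le T}\frac{\big(1-e^{-1/\log^2T}\big)\sqrt t}{50\,\bar R_{i^*}(t)}$$ (no constraint for those $t$ with $\bar R_{i^*}(t)=0$), while the other step sizes $\eta_{1,i}>0$ are arbitrary. Then the expected regret $\mathbb E[R(T)]=\mathbb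 E\big[\sum_{t=1}^T\ell_t(a_{i_t,t})-\ell_t(a^*)\big]$ of the algorithm satisfies $$\mathbb E[R(T)]\le C\Big(\max_{w\in\Delta^{K-1}}\sqrt T\sum_{i=1}^K\Big(\eta_{1,i}+\frac1{\eta_{1,i}}\Big)\sqrt{w_i}+R_{i^*}(T)\Big),$$ and, if $\eta_{1,i}\le1$ for all $i$, $$\mathbb E[R(T)]\le C\Big(\max_{w\in\Delta^{K-1}}\sqrt T\sum_{i=1}^K\frac{\sqrt{w_i}}{\eta_{1,i}}+R_{i^*}(T)\Big).$$ -/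

import Mathlib

open MeasureTheory

noncomputable section

namespace Corral

/-! ### Tsallis potential, mirror descent and follow-the-regularized-leader updates -/

/-- The potential `Ψ(w) = -4 ∑ᵢ (√wᵢ - wᵢ/2) / ηᵢ` with coordinate-wise step sizes `η`. -/
def psi {K : ℕ} (η w : Fin K → ℝ) : ℝ :=
  -4 * ∑ i, (1 / η i) * (Real.sqrt (w i) - w i / 2)

/-- The gradient of `psi η` at a point with positive coordinates. -/
def gradPsi {K : ℕ} (η w : Fin K → ℝ) : Fin K → ℝ :=
  fun i => -2 * (1 / Real.sqrt (w i) - 1) / η i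

/-- The Bregman divergence `D_Ψ(x, y)` of `psi η`. -/
def bregman {K : ℕ} (η x y : Fin K → ℝ) : ℝ :=
  psi η x - psi η y - ∑ i, gradPsi η y i * (x i - y i)

/-- A minimizer of `f` over the probability simplex (used only for strictly convex continuous
`f`, where it exists and is unique). -/
def simplexArgmin {K : ℕ} (f : (Fin K → ℝ) → ℝ) : Fin K → ℝ :=
  Classical.epsilon fun w => w ∈ stdSimplex ℝ (Fin K) ∧ IsMinOn f (stdSimplex ℝ (Fin K)) w

/-- FTRL iterate `argmin_{w ∈ Δ} ⟨L, w⟩ + Ψ(w)`, that is `∇Φ(-L)`. -/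
def ftrl {K : ℕ} (η L : Fin K → ℝ) : Fin K → ℝ :=
  simplexArgmin fun w => ∑ i, L i * w i + psi η w

/-- Mirror descent iterate `argmin_{w ∈ Δ} ⟨e, w⟩ + D_Ψ(w, y)`. -/
def omd {K : ℕ} (η y e : Fin K → ℝ) : Fin K → ℝ :=
  simplexArgmin fun w => ∑ i, e i * w i + bregman η w y

/-! ### Base algorithms and the states of the corralling algorithm -/

/-- A base algorithm with `k` actions: from its environment parameter (the announced range of the
rescaled losses), the list of its own past (action, received feedback) pairs since its last
restart (latest first), and a fresh random seed, it proposes its next action. -/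
structure BaseAlgorithm (k : ℕ) where
  propose : ℝ → List (Fin k × ℝ) → ℝ → Fin k

/-- What a base algorithm has been told since its last restart. -/
structure BaseMemory (k : ℕ) where
  env : ℝ
  hist : List (Fin k × ℝ)

/-- Where the corralling algorithm stands in its control flow. -/
inductive Mode (K : ℕ) where
  /-- An ordinary round; the flag says whether the prior step was a negative-regret step. -/
  | free (afterNRS : Bool)
  /-- First extra round of a negative-regret step: `R` is the set of coordinates whose step size
  is increased, `v` the distribution of the round in which the step was triggered. -/
  | nrsFirst (R : Finset (Fin K)) (v : Fin K → ℝ)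
  /-- Second extra round of a negative-regret step. -/
  | nrsSecond

/-- The state of the corralling algorithm at the beginning of a round. -/
structure State (K : ℕ) (k : Fin K → ℕ) where
  /-- distribution over the base algorithms -/
  w : Fin K → ℝ
  /-- cumulative loss vector -/
  L : Fin K → ℝ
  /-- current step sizes -/
  η : Fin K → ℝ
  /-- index of the current threshold of every base algorithm -/
  θ : Fin K → ℕ
  /-- the last epoch whose first-round test has been carried out -/
  epoch : ℕ
  mode : Mode K
  mem : ∀ i, BaseMemory (k i)

/-- The input of the corralling algorithm: horizon, base algorithms, initial step sizes. -/
structure Setup (K : ℕ) (k : Fin K → ℕ) where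
  T : ℕ
  base : ∀ i, BaseAlgorithm (k i)
  η : Fin K → ℝ

/-- One realization of all the randomness: losses of all actions, seeds of the base algorithms,
and indices of the selected base algorithms. Rounds are numbered from `0`. -/
structure Path (K : ℕ) (k : Fin K → ℕ) where
  loss : ℕ → ∀ i, Fin (k i) → ℝ
  seed : ℕ → Fin K → ℝ
  sel : ℕ → Fin K

variable {K : ℕ} {k : Fin K → ℕ}

/-- The multiplicative step-size increase `β = exp (1 / log² T)`. -/
def beta (T : ℕ) : ℝ := Real.exp (1 / Real.log T ^ 2)

/-- The probability thresholds are `1/ρ`, with `ρ` running through `36, 72, 144, …`; those with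
`ρ ≤ K T` are in use. -/
def threshold (s : ℕ) : ℝ := 36 * 2 ^ s

/-- Length of the initial phase: every base algorithm is run for `⌈log T⌉ + 1` rounds. -/
def Setup.initLen (A : Setup K k) : ℕ := K * (⌈Real.log A.T⌉₊ + 1)

/-- The epoch of a round. Epoch `0` is the initial phase, of size `S = A.initLen`, and every later
epoch is twice as long as the one before: epoch `j` is `[(2 ^ j - 1) S, (2 ^ (j + 1) - 1) S)`. -/
def Setup.epochOf (A : Setup K k) (t : ℕ) : ℕ := Nat.log 2 (t / A.initLen + 1)

/-- The sampling distribution: `w` mixed with the uniform distribution, with weight `1/(T K)`. -/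
def Setup.mixed (A : Setup K k) (w : Fin K → ℝ) : Fin K → ℝ :=
  fun i => (1 - 1 / ((A.T : ℝ) * K)) * w i + 1 / ((A.T : ℝ) * K) * (1 / (K : ℝ))

/-- The decrease of the step sizes: `1/η'ᵢ² = 1/ηᵢ² + 1/η₁ᵢ²`, where `η₁` is the initial step
size. -/
def Setup.decay (A : Setup K k) (η : Fin K → ℝ) : Fin K → ℝ :=
  fun i => 1 / Real.sqrt (1 / η i ^ 2 + 1 / A.η i ^ 2)

/-- The actions proposed by the base algorithms in state `st`, given their seeds. -/
def Setup.propose (A : Setup K k) (st : State K k) (seed : Fin K → ℝ) : ∀ i, Fin (k i) :=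
  fun i => (A.base i).propose (st.mem i).env (st.mem i).hist (seed i)

/-- The importance-weighted loss estimate: coordinate `s` (the selected base algorithm) is the
observed loss divided by its sampling probability, the others are `0`. -/
def Setup.estimate (A : Setup K k) (st : State K k) (loss : ∀ i, Fin (k i) → ℝ)
    (a : ∀ i, Fin (k i)) (s : Fin K) : Fin K → ℝ :=
  fun i => if i = s then loss i (a i) / A.mixed st.w i else 0

/-- The smallest index of a threshold in use that `p` has not exceeded, that is `1/ρ < p` (the
index after the last one in use if there is none). -/
def Setup.thresholdIndex (A : Setup K k) (p : ℝ) : ℕ :=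
  sInf {s : ℕ | 1 / threshold s < p ∨ (K : ℝ) * A.T < threshold s}

/-- The initial state. -/
def Setup.init (A : Setup K k) : State K k where
  w := fun _ => 1 / (K : ℝ)
  L := fun _ => 0
  η := A.η
  θ := fun _ => 0
  epoch := 0
  mode := Mode.free false
  mem := fun _ => ⟨1, []⟩

/-- A round of the initial phase, in which base algorithm `s` is played; only this algorithm acts
and is told its loss. The distribution `w` is not used before the phase is over. -/
def Setup.initStep (A : Setup K k) (loss : ∀ i, Fin (k i) → ℝ) (seed : Fin K → ℝ) (s : Fin K)
    (st : State K k) : State K k :=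
  let a := A.propose st seed
  let L' : Fin K → ℝ := fun i => if i = s then st.L i + loss i (a i) else st.L i
  { st with
    w := ftrl (A.decay st.η) L'
    L := L'
    η := A.decay st.η
    mem := fun i =>
      if i = s then ⟨(st.mem i).env, (a i, loss i (a i)) :: (st.mem i).hist⟩ else st.mem i }

open Classical in
/-- A round after the initial phase, in which base algorithm `s` has been sampled. -/
def Setup.mainStep (A : Setup K k) (t : ℕ) (loss : ∀ i, Fin (k i) → ℝ) (seed : Fin K → ℝ)
    (s : Fin K) (st : State K k) : State K k :=
  let a := A.propose st seed
  let e := A.estimate st loss a s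
  let L' : Fin K → ℝ := fun i => st.L i + e i
  -- every base algorithm receives its coordinate of the estimate as feedback
  let mem' : ∀ i, BaseMemory (k i) :=
    fun i => ⟨(st.mem i).env, (a i, e i) :: (st.mem i).hist⟩
  match st.mode with
  | Mode.free afterNRS =>
    let new : Prop := A.epochOf t ≠ st.epoch
    let θ' : Fin K → ℕ := fun i => if new then A.thresholdIndex (st.w i) else st.θ i
    let R₁ : Finset (Fin K) := Finset.univ.filter fun i =>
      threshold 0 ≤ (K : ℝ) * A.T ∧ st.w i ≤ 1 / threshold 0
    let R₂ : Finset (Fin K) := Finset.univ.filter fun i =>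
      threshold (θ' i) ≤ (K : ℝ) * A.T ∧ st.w i ≤ 1 / threshold (θ' i)
    if new ∧ R₁.Nonempty then
      -- first round of an epoch: a negative-regret step if some probability is below `1/36`
      { w := omd st.η st.w e, L := L', η := st.η, θ := θ', epoch := A.epochOf t,
        mode := Mode.nrsFirst R₁ st.w, mem := mem' }
    else if R₂.Nonempty ∧ afterNRS = false then
      -- a new threshold is exceeded: a negative-regret step
      { w := omd st.η st.w e, L := L', η := st.η,
        θ := fun i => if i ∈ R₂ then θ' i + 1 else θ' i, epoch := A.epochOf t,
        mode := Mode.nrsFirst R₂ st.w, mem := mem' }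
    else
      -- an FTRL step with decreasing step sizes
      { w := ftrl (A.decay st.η) L', L := L', η := A.decay st.η, θ := θ',
        epoch := A.epochOf t, mode := Mode.free false, mem := mem' }
  | Mode.nrsFirst R v =>
    -- the step sizes of `R` are multiplied by `β`, the second mirror descent step is made with
    -- the new step sizes, the cumulative loss is re-based so that this step is also an FTRL step,
    -- and the base algorithms of `R` are restarted
    let η' : Fin K → ℝ := fun i => if i ∈ R then beta A.T * st.η i else st.η i
    { st with
      w := omd η' st.w e
      L := fun i => -gradPsi η' st.w i + e i
      η := η'
      mode := Mode.nrsSecond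
      mem := fun i => if i ∈ R then ⟨2 / v i, []⟩ else mem' i }
  | Mode.nrsSecond =>
    -- an FTRL step with unchanged step sizes
    { st with
      w := ftrl st.η L'
      L := L'
      mode := Mode.free true
      mem := mem' }

/-- The state at the beginning of round `t` along a path. -/
def Setup.state (A : Setup K k) (x : Path K k) : ℕ → State K k
  | 0 => A.init
  | t + 1 =>
    if t < A.initLen then
      A.initStep (x.loss t) (x.seed t) (x.sel t) (Setup.state A x t)
    else
      A.mainStep t (x.loss t) (x.seed t) (x.sel t) (Setup.state A x t)

/-- The action proposed by base algorithm `i` in round `t`. -/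
def Setup.action (A : Setup K k) (x : Path K k) (t : ℕ) (i : Fin K) : Fin (k i) :=
  A.propose (A.state x t) (x.seed t) i

/-- The probability with which base algorithm `i` is sampled in round `t`. -/
def Setup.prob (A : Setup K k) (x : Path K k) (t : ℕ) (i : Fin K) : ℝ :=
  A.mixed (A.state x t).w i

/-- The rescaled loss fed back to base algorithm `i` in round `t` (after the initial phase). -/
def Setup.rescaledLoss (A : Setup K k) (x : Path K k) (t : ℕ) (i : Fin K) : ℝ :=
  A.estimate (A.state x t) (x.loss t) (A.action x t) (x.sel t) i

/-! ### The random process, regret, and stability -/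

/-- The random path `X` is a run of the corralling algorithm. `ℱ t` is the information available
just before the base algorithm of round `t` is sampled. The losses are in `[0, 1]` and otherwise
arbitrary (oblivious, stochastic or adaptive); the initial phase plays the base algorithms in
turn, and afterwards they are sampled from the mixed distribution. -/
structure IsRun (A : Setup K k) {Ω : Type*} {mΩ : MeasurableSpace Ω} (P : Measure Ω)
    (ℱ : Filtration ℕ mΩ) (X : Ω → Path K k) : Prop where
  loss_mem : ∀ ω, ∀ t < A.T, ∀ i j, (X ω).loss t i j ∈ Set.Icc (0 : ℝ) 1
  loss_adapted : ∀ t < A.T, ∀ i j, Measurable[ℱ t] fun ω => (X ω).loss t i j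
  action_adapted : ∀ t < A.T, ∀ i, Measurable[ℱ t] fun ω => A.action (X ω) t i
  sel_adapted : ∀ t < A.T, Measurable[ℱ (t + 1)] fun ω => (X ω).sel t
  sel_init : ∀ ω, ∀ t < A.T, t < A.initLen → ((X ω).sel t : ℕ) = t % K
  sel_law : ∀ t < A.T, A.initLen ≤ t → ∀ i : Fin K,
    P[{ω | (X ω).sel t = i}.indicator (fun _ => (1 : ℝ)) | ℱ t]
      =ᵐ[P] fun ω => A.prob (X ω) t i

/-- Expected regret of the corralling algorithm over all `T` rounds against action `j` of base
algorithm `i`. -/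
def Setup.expectedRegret (A : Setup K k) {Ω : Type*} {mΩ : MeasurableSpace Ω} (P : Measure Ω)
    (X : Ω → Path K k) (i : Fin K) (j : Fin (k i)) : ℝ :=
  ∫ ω, ∑ t ∈ Finset.range A.T,
    ((X ω).loss t ((X ω).sel t) (A.action (X ω) t ((X ω).sel t)) - (X ω).loss t i j) ∂P

/-- The rounds `t < T` of epoch `τ`. -/
def Setup.epochRounds (A : Setup K k) (τ : ℕ) : Finset ℕ :=
  (Finset.range A.T).filter fun t => A.epochOf t = τ

/-- The epochs after the initial phase that begin before the horizon. -/
def Setup.epochs (A : Setup K k) : Finset ℕ :=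
  (Finset.Ico A.initLen A.T).image A.epochOf

/-- The least `ρ` among `36, 72, 144, …` such that the probability of sampling `i` stays above
`1/ρ` during epoch `τ`. -/
def Setup.rho (A : Setup K k) (x : Path K k) (i : Fin K) (τ : ℕ) : ℝ :=
  threshold (sInf {s : ℕ | ∀ t ∈ A.epochRounds τ, 1 / threshold s < A.prob x t i})

/-- Stability (exponent `1/2`) of base algorithm `i` in the environment of rescaled losses, with
regret function `R`: against action `j` its expected regret under the unbiased rescaling is at
most `∑_τ E[√ρ_τ] R(s_τ)`, where `s_τ` is the number of rounds of epoch `τ`. -/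
def Setup.IsStable (A : Setup K k) {Ω : Type*} {mΩ : MeasurableSpace Ω} (P : Measure Ω)
    (X : Ω → Path K k) (i : Fin K) (j : Fin (k i)) (R : ℕ → ℝ) : Prop :=
  ∫ ω, ∑ t ∈ Finset.Ico A.initLen A.T, (A.rescaledLoss (X ω) t i - (X ω).loss t i j) ∂P
    ≤ ∑ τ ∈ A.epochs, (∫ ω, Real.sqrt (A.rho (X ω) i τ) ∂P) * R (A.epochRounds τ).card

end Corral

end

namespace Corral

variable {K : ℕ}

/-! ### The Tsallis potential on the simplex -/

/-! Fix the comparator `j` and follow the Bregman divergence `V_t` from the vertex `e_j` to the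
current distribution `w_t` (`Setup.potential`). After the initial phase every distribution is the
stationary point of the current regularized objective, re-based steps included (`Setup.isStat`).
Hence each round is a follow-the-regularized-leader step: the estimated loss of `w_t` minus that of
`j` is at most `V_t - V_{t+1}` plus stability and penalty terms of expected order `Z / √t`, where
`Z` dominates `∑ √wᵢ / ηᵢ` and `∑ ηᵢ √wᵢ` on the simplex. These terms sum to order `U = √T * Z`.
When the step size of `j` is multiplied by `β`, `V` also drops by `1 - 1/β` times the `j`-part of
the divergence (`bregman_rebase_le`); this is the negative regret, or gain.

Stability of the base algorithm costs `√ρ_τ R(s_τ)` in epoch `τ`, and the condition on the initial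
step size turns this into `(1 - 1/β) √ρ_τ √s_τ / (50 η₁)`. About a quarter of all rounds decrease
the step sizes, while the increases of one epoch have almost no effect (`mass_lower_aux`); so `√s_τ
/ η₁` is at most a constant times `1/η_t`, and the cost is at most a small multiple of `(1 - 1/β)
V_t` at some round of the epoch, up to `U` (`exists_sqrt_rho_le`).

That `V_t` is paid for by the gains of the epoch (`potential_le_budget`): if `w_j` is small, the
threshold passed before the current one triggered a negative-regret step in this epoch, at a time
when `w_j` was at most twice its present value. Beyond the last threshold no step comes to help, but
there `V` grows per round by a rescaled loss of mean at most `1`, and the length of the epoch is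
itself dominated by `V` at the crossing (`card_le_potential`). Over all epochs each gain is used at
most twice and `V_T` once per epoch. As `1 - 1/β` times the number of epochs is at most `1`, the
gains and `V_T` in the regret inequality cancel the whole stability cost (`sum_sqrt_rho_le`), and
only order `U` remains. -/

/-- `w` is a point of the open simplex at which `⟨L, ·⟩ + Ψ` is stationary. -/
def IsStat (η L w : Fin K → ℝ) : Prop :=
  (∀ i, 0 < w i) ∧ ∑ i, w i = 1 ∧ ∃ μ, ∀ i, L i + gradPsi η w i = μ

lemma IsStat.mem_stdSimplex {η L w : Fin K → ℝ} (h : IsStat η L w) : w ∈ stdSimplex ℝ (Fin K) :=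
  ⟨fun i => (h.1 i).le, h.2.1⟩

lemma le_one_of_mem_stdSimplex {w : Fin K → ℝ} (h : w ∈ stdSimplex ℝ (Fin K)) (i : Fin K) :
    w i ≤ 1 := by
  rw [← h.2]
  exact Finset.single_le_sum (f := w) (fun j _ => h.1 j) (Finset.mem_univ i)

/-- The linear part of `psi` drops out of the divergence, and with `x = r²`, `y = s²` each
coordinate becomes the perfect square `2 (r - s)² / s` over the step size. All bounds on the
potential start from this form. -/
lemma bregman_eq (η : Fin K → ℝ) {x y : Fin K → ℝ} (hx : ∀ i, 0 ≤ x i) (hy : ∀ i, 0 < y i) :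
    bregman η x y = ∑ i, 1 / η i * (2 * (√(x i) - √(y i)) ^ 2 / √(y i)) := by
  unfold bregman psi gradPsi
  rw [Finset.mul_sum, Finset.mul_sum, ← Finset.sum_sub_distrib, ← Finset.sum_sub_distrib]
  refine Finset.sum_congr rfl fun i _ => ?_
  have hs : 0 < √(y i) := Real.sqrt_pos.2 (hy i)
  obtain ⟨r, hr⟩ : ∃ r, r = √(x i) := ⟨_, rfl⟩
  obtain ⟨s, hs'⟩ : ∃ s, s = √(y i) := ⟨_, rfl⟩
  have h1 : x i = r ^ 2 := by rw [hr, Real.sq_sqrt (hx i)]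
  have h2 : y i = s ^ 2 := by rw [hs', Real.sq_sqrt (hy i).le]
  rw [← hr, ← hs', h1, h2]
  rw [← hs'] at hs
  rw [div_eq_mul_one_div (-2 * (1 / s - 1))]
  generalize 1 / η i = a
  field_simp
  ring

lemma bregman_nonneg {η x y : Fin K → ℝ} (hη : ∀ i, 0 < η i) (hx : ∀ i, 0 ≤ x i)
    (hy : ∀ i, 0 < y i) : 0 ≤ bregman η x y := by
  rw [bregman_eq η hx hy]
  refine Finset.sum_nonneg fun i _ => ?_
  have := hη i
  positivity

/-- At a stationary point `L` is minus the gradient up to a constant, which is invisible on the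
simplex. This single identity yields minimality, uniqueness and both one-step bounds. -/
lemma IsStat.value_sub {η L w u : Fin K → ℝ} (h : IsStat η L w) (hu : ∑ i, u i = 1) :
    (∑ i, L i * u i + psi η u) - (∑ i, L i * w i + psi η w) = bregman η u w := by
  obtain ⟨-, h1, μ, hμ⟩ := h
  have h2 : ∑ i, gradPsi η w i * (u i - w i) = -(∑ i, L i * u i - ∑ i, L i * w i) := by
    have : ∀ i, gradPsi η w i * (u i - w i) = μ * u i - μ * w i - (L i * u i - L i * w i) := by
      intro i
      rw [← hμ i]
      ring
    simp_rw [this, Finset.sum_sub_distrib, ← Finset.mul_sum, hu, h1]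
    ring
  unfold bregman
  rw [h2]
  ring

/-- Stationarity forces `1/√wᵢ = 1 + ηᵢ (Lᵢ - μ) / 2`, so only the multiplier `μ` is to be found.
The total mass is at least `1` at `μ = min L`, and `X` is so large that every coordinate is at most
`1/K` at `min L - X`; the intermediate value theorem does the rest. -/
lemma exists_isStat {η : Fin K → ℝ} (hη : ∀ i, 0 < η i) (L : Fin K → ℝ) (hK : 0 < K) :
    ∃ w, IsStat η L w := by
  have : Nonempty (Fin K) := ⟨⟨0, hK⟩⟩
  obtain ⟨j, -, hj⟩ := Finset.exists_min_image (Finset.univ : Finset (Fin K)) L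
    Finset.univ_nonempty
  have hK' : (1 : ℝ) ≤ K := by exact_mod_cast hK
  set X : ℝ := ∑ i, 2 * K / η i with hX
  have hXi : ∀ i, 2 * K / η i ≤ X := fun i =>
    Finset.single_le_sum (f := fun i => 2 * K / η i)
      (fun i _ => div_nonneg (by positivity) (hη i).le) (Finset.mem_univ i)
  have hX0 : 0 ≤ X := Finset.sum_nonneg fun i _ => div_nonneg (by positivity) (hη i).le
  have hbase : ∀ μ ≤ L j, ∀ i, 1 ≤ 1 + η i / 2 * (L i - μ) := by
    intro μ hμ i
    have h1 := hj i (Finset.mem_univ i)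
    have h2 := hη i
    have : 0 ≤ η i / 2 * (L i - μ) := mul_nonneg (by linarith) (by linarith)
    linarith
  let g : ℝ → ℝ := fun μ => ∑ i, ((1 + η i / 2 * (L i - μ)) ^ 2)⁻¹
  have hcont : ContinuousOn g (Set.Icc (L j - X) (L j)) := by
    refine continuousOn_finsetSum _ fun i _ => ?_
    refine ContinuousOn.inv₀ (by fun_prop) ?_
    intro μ hμ
    have := hbase μ hμ.2 i
    positivity
  have hlo : g (L j - X) ≤ 1 := by
    have : ∀ i, ((1 + η i / 2 * (L i - (L j - X))) ^ 2)⁻¹ ≤ 1 / (K : ℝ) := by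
      intro i
      have h1 := hj i (Finset.mem_univ i)
      have h2 := hη i
      have h3 : (K : ℝ) ≤ η i / 2 * (L i - (L j - X)) := by
        have h4 : (K : ℝ) = η i / 2 * (2 * K / η i) := by field_simp
        rw [h4]
        refine mul_le_mul_of_nonneg_left ?_ (by linarith)
        have := hXi i
        linarith
      rw [inv_eq_one_div]
      refine one_div_le_one_div_of_le (by linarith) ?_
      nlinarith
    calc g (L j - X) ≤ ∑ _i : Fin K, 1 / (K : ℝ) := Finset.sum_le_sum fun i _ => this i
      _ = 1 := by
        rw [Finset.sum_const, Finset.card_univ, Fintype.card_fin, nsmul_eq_mul]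
        field_simp
  have hhi : 1 ≤ g (L j) := by
    have h1 : (1 : ℝ) = ((1 + η j / 2 * (L j - L j)) ^ 2)⁻¹ := by simp
    rw [h1]
    exact Finset.single_le_sum (f := fun i => ((1 + η i / 2 * (L i - L j)) ^ 2)⁻¹)
      (fun i _ => by positivity) (Finset.mem_univ j)
  obtain ⟨μ, hμ, hgμ⟩ := intermediate_value_Icc (by linarith : L j - X ≤ L j) hcont ⟨hlo, hhi⟩
  refine ⟨fun i => ((1 + η i / 2 * (L i - μ)) ^ 2)⁻¹, fun i => ?_, hgμ, μ, fun i => ?_⟩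
  · have := hbase μ hμ.2 i
    positivity
  · have h1 := hbase μ hμ.2 i
    have h2 := (hη i).ne'
    unfold gradPsi
    rw [Real.sqrt_inv, Real.sqrt_sq (by linarith)]
    field_simp
    ring

lemma IsStat.eq_of_le {η L w v : Fin K → ℝ} (hη : ∀ i, 0 < η i) (h : IsStat η L w)
    (hv : v ∈ stdSimplex ℝ (Fin K))
    (hle : ∑ i, L i * v i + psi η v ≤ ∑ i, L i * w i + psi η w) : v = w := by
  have h1 := h.value_sub hv.2
  rw [bregman_eq η hv.1 h.1] at h1
  have h2 : ∀ i ∈ Finset.univ, 0 ≤ 1 / η i * (2 * (√(v i) - √(w i)) ^ 2 / √(w i)) := by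
    intro i _
    have := hη i
    positivity
  have h3 : ∑ i, 1 / η i * (2 * (√(v i) - √(w i)) ^ 2 / √(w i)) = 0 :=
    le_antisymm (by linarith) (Finset.sum_nonneg h2)
  rw [Finset.sum_eq_zero_iff_of_nonneg h2] at h3
  funext i
  have h4 := h3 i (Finset.mem_univ i)
  have h5 : 0 < √(w i) := Real.sqrt_pos.2 (h.1 i)
  have h6 := (hη i).ne'
  have h7 : √(v i) - √(w i) = 0 := by
    simpa [h5.ne', h6] using h4
  rw [← Real.sq_sqrt (hv.1 i), ← Real.sq_sqrt (h.1 i).le, sub_eq_zero.1 h7]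

/-- `ftrl` is an arbitrary choice of a minimizer. The stationary point is one by `value_sub`, and
there is no other, as divergence zero forces equal square roots. -/
lemma ftrl_isStat {η : Fin K → ℝ} (hη : ∀ i, 0 < η i) (L : Fin K → ℝ) (hK : 0 < K) :
    IsStat η L (ftrl η L) := by
  obtain ⟨w, hw⟩ := exists_isStat hη L hK
  have hmin : IsMinOn (fun w => ∑ i, L i * w i + psi η w) (stdSimplex ℝ (Fin K)) w := by
    intro v hv
    have h1 := hw.value_sub hv.2
    have h2 := bregman_nonneg hη hv.1 hw.1
    simp only [Set.mem_ofPred_eq]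
    linarith
  have hex : ∃ w, w ∈ stdSimplex ℝ (Fin K) ∧
      IsMinOn (fun w => ∑ i, L i * w i + psi η w) (stdSimplex ℝ (Fin K)) w :=
    ⟨w, hw.mem_stdSimplex, hmin⟩
  have hspec := Classical.epsilon_spec hex
  have : ftrl η L = w :=
    hw.eq_of_le hη hspec.1 (hspec.2 hw.mem_stdSimplex)
  rw [this]
  exact hw

lemma omd_eq_ftrl (η y e : Fin K → ℝ) : omd η y e = ftrl η fun i => e i - gradPsi η y i := by
  unfold omd ftrl simplexArgmin
  congr 1
  funext w
  have : ∀ w, ∑ i, e i * w i + bregman η w y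
      = (∑ i, (e i - gradPsi η y i) * w i + psi η w)
        + (∑ i, gradPsi η y i * y i - psi η y) := by
    intro w
    unfold bregman
    simp_rw [mul_sub, sub_mul, Finset.sum_sub_distrib]
    ring
  simp only [this, isMinOn_iff, add_le_add_iff_right]

lemma omd_isStat {η y e : Fin K → ℝ} (hη : ∀ i, 0 < η i) (hK : 0 < K) :
    IsStat η (fun i => -gradPsi η y i + e i) (omd η y e) := by
  rw [omd_eq_ftrl]
  convert ftrl_isStat hη (fun i => e i - gradPsi η y i) hK using 2
  ring

lemma IsStat.add_const {η L L' w : Fin K → ℝ} (h : IsStat η L w) (c : ℝ)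
    (hL : ∀ i, L' i = L i + c) : IsStat η L' w := by
  obtain ⟨h1, h2, μ, h3⟩ := h
  refine ⟨h1, h2, μ + c, fun i => ?_⟩
  rw [hL, ← h3 i]
  ring

lemma isStat_neg_gradPsi {η w : Fin K → ℝ} (h1 : ∀ i, 0 < w i) (h2 : ∑ i, w i = 1) :
    IsStat η (fun i => -gradPsi η w i) w :=
  ⟨h1, h2, 0, fun i => by ring⟩

/-- A mirror descent step from a stationary point is a follow-the-regularized-leader step. -/
lemma IsStat.omd {η L w e : Fin K → ℝ} (hη : ∀ i, 0 < η i) (hK : 0 < K) (h : IsStat η L w) :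
    IsStat η (fun i => L i + e i) (omd η w e) := by
  obtain ⟨h1, h2, μ, h3⟩ := h
  refine (omd_isStat (y := w) (e := e) hη hK).add_const μ fun i => ?_
  rw [← h3 i]
  ring

/-! ### One step of follow-the-regularized-leader. -/

/-- With `w = r²`, `v = s²` one has `e (r² - s²) = 2 r e (r - s) - e (r - s)²`, so for `e ≥ 0` the
loss may be linearized in `r - s`; then a square is completed. No smallness of `a * e` is required,
so large importance weights do no harm. -/
lemma coord_stability {a e w v : ℝ} (ha : 0 < a) (he : 0 ≤ e) (hw : 0 < w) (hv : 0 < v) :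
    e * (w - v) - 1 / a * (2 * (√v - √w) ^ 2 / √w) ≤ 1 / 2 * (a * e ^ 2 * (w * √w)) := by
  obtain ⟨r, hr⟩ : ∃ r, r = √w := ⟨_, rfl⟩
  obtain ⟨s, hs⟩ : ∃ s, s = √v := ⟨_, rfl⟩
  have hr0 : 0 < r := by rw [hr]; exact Real.sqrt_pos.2 hw
  have hs0 : 0 < s := by rw [hs]; exact Real.sqrt_pos.2 hv
  have h1 : w = r ^ 2 := by rw [hr, Real.sq_sqrt hw.le]
  have h2 : v = s ^ 2 := by rw [hs, Real.sq_sqrt hv.le]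
  rw [← hr, ← hs, h1, h2]
  have key : 1 / 2 * (a * e ^ 2 * (r ^ 2 * r)) - (2 * r * e * (r - s)
      - 1 / a * (2 * (s - r) ^ 2 / r)) = 1 / (2 * a * r) * (a * e * r ^ 2 - 2 * (r - s)) ^ 2 := by
    field_simp
    ring
  have hk2 : 0 ≤ 1 / (2 * a * r) * (a * e * r ^ 2 - 2 * (r - s)) ^ 2 := by positivity
  have h3 : e * (r ^ 2 - s ^ 2) ≤ 2 * r * e * (r - s) := by nlinarith [mul_nonneg he (sq_nonneg (r - s))]
  linarith

lemma psi_sub_psi (η η' w : Fin K → ℝ) :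
    psi η' w - psi η w = -∑ i, (1 / η' i - 1 / η i) * (4 * (√(w i) - w i / 2)) := by
  unfold psi
  rw [Finset.mul_sum, Finset.mul_sum, ← Finset.sum_sub_distrib, ← Finset.sum_neg_distrib]
  refine Finset.sum_congr rfl fun i _ => ?_
  ring

lemma sqrt_sub_half_nonneg {x : ℝ} (h0 : 0 ≤ x) (h1 : x ≤ 1) : 0 ≤ √x - x / 2 := by
  have h2 : √x ≤ 1 := Real.sqrt_le_one.2 h1
  have h3 := Real.sqrt_nonneg x
  nlinarith [Real.sq_sqrt h0]

lemma psi_le_psi {η η' w : Fin K → ℝ} (hηη : ∀ i, 1 / η i ≤ 1 / η' i)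
    (hw : w ∈ stdSimplex ℝ (Fin K)) : psi η' w ≤ psi η w := by
  have h := psi_sub_psi η η' w
  have : 0 ≤ ∑ i, (1 / η' i - 1 / η i) * (4 * (√(w i) - w i / 2)) := by
    refine Finset.sum_nonneg fun i _ => mul_nonneg (sub_nonneg.2 (hηη i)) ?_
    have := sqrt_sub_half_nonneg (hw.1 i) (le_one_of_mem_stdSimplex hw i)
    linarith
  linarith

/-- One step of follow-the-regularized-leader with non-increasing step sizes: upper bound. -/
lemma bregman_step_le {η η' L e w w' u : Fin K → ℝ} (hη : ∀ i, 0 < η i)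
    (hηη : ∀ i, 1 / η i ≤ 1 / η' i) (he : ∀ i, 0 ≤ e i) (hu : u ∈ stdSimplex ℝ (Fin K))
    (h : IsStat η L w) (h' : IsStat η' (fun i => L i + e i) w') :
    bregman η' u w' ≤ bregman η u w + ∑ i, e i * u i - ∑ i, e i * w i
      + 1 / 2 * ∑ i, η i * e i ^ 2 * (w i * √(w i))
      + 4 * ∑ i, (1 / η' i - 1 / η i) * √(w' i) := by
  -- Three value identities are combined: `u` against `w`, `u` against `w'`, and `w'` against `w`.
  -- The divergence in the last one pays for the stability term.
  have h1 := h.value_sub hu.2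
  have h2 := h'.value_sub hu.2
  have h3 := h.value_sub h'.2.1
  have h4 := psi_le_psi hηη hu
  have h5 := psi_sub_psi η η' w'
  have h6 : ∑ i, (1 / η' i - 1 / η i) * (4 * (√(w' i) - w' i / 2))
      ≤ 4 * ∑ i, (1 / η' i - 1 / η i) * √(w' i) := by
    rw [Finset.mul_sum]
    refine Finset.sum_le_sum fun i _ => ?_
    have h7 := h'.1 i
    have h8 := sub_nonneg.2 (hηη i)
    nlinarith [mul_nonneg h8 h7.le]
  have h7 : ∑ i, e i * w i - ∑ i, e i * w' i - bregman η w' w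
      ≤ 1 / 2 * ∑ i, η i * e i ^ 2 * (w i * √(w i)) := by
    rw [bregman_eq η (fun i => (h'.1 i).le) h.1, Finset.mul_sum, ← Finset.sum_sub_distrib,
      ← Finset.sum_sub_distrib]
    refine Finset.sum_le_sum fun i _ => ?_
    have := coord_stability (hη i) (he i) (h.1 i) (h'.1 i)
    linarith
  simp only [add_mul, Finset.sum_add_distrib] at h2
  linarith

/-- One step of follow-the-regularized-leader with non-increasing step sizes: lower bound. -/
lemma le_bregman_step {η η' L e w w' : Fin K → ℝ}
    (hηη : ∀ i, 1 / η i ≤ 1 / η' i) (j : Fin K) (he : 0 ≤ e j)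
    (hη' : ∀ i, 0 < η' i)
    (h : IsStat η L w) (h' : IsStat η' (fun i => L i + e i) w') :
    bregman η (Pi.single j 1) w - ∑ i, e i * w i - 2 * (1 / η' j - 1 / η j)
      ≤ bregman η' (Pi.single j 1) w' := by
  have hu : (Pi.single j 1 : Fin K → ℝ) ∈ stdSimplex ℝ (Fin K) := single_mem_stdSimplex ℝ j
  have h1 := h.value_sub hu.2
  have h2 := h'.value_sub hu.2
  -- `w` serves as a competitor of `w'` for the new objective.
  have h3 := h'.value_sub h.2.1
  have h4 := psi_le_psi hηη h.mem_stdSimplex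
  have h5 := psi_sub_psi η η' (Pi.single j 1)
  have h6 := bregman_nonneg (η := η') (x := w) hη' (fun i => (h.1 i).le) h'.1
  have h7 : ∑ i, (1 / η' i - 1 / η i) * (4 * (√((Pi.single j 1 : Fin K → ℝ) i)
      - (Pi.single j 1 : Fin K → ℝ) i / 2)) = 2 * (1 / η' j - 1 / η j) := by
    rw [Finset.sum_eq_single j]
    · simp
      ring
    · intro b _ hb
      simp [Pi.single_eq_of_ne hb]
    · simp
  have h8 : ∑ i, e i * (Pi.single j 1 : Fin K → ℝ) i = e j := by
    rw [Finset.sum_eq_single j]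
    · simp
    · intro b _ hb
      simp [Pi.single_eq_of_ne hb]
    · simp
  simp only [add_mul, Finset.sum_add_distrib] at h2 h3
  linarith

/-! ### The divergence from a vertex. -/

/-- The contribution of coordinate `j` to the Bregman divergence from the vertex `e_j`. -/
noncomputable def vertexGap (η w : ℝ) : ℝ := 1 / η * (2 * (1 - √w) ^ 2 / √w)

lemma vertexGap_nonneg {η w : ℝ} (hη : 0 < η) : 0 ≤ vertexGap η w := by
  unfold vertexGap
  positivity

lemma bregman_single {η w : Fin K → ℝ} (hw : ∀ i, 0 < w i) (j : Fin K) :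
    bregman η (Pi.single j 1) w
      = vertexGap (η j) (w j) + ∑ i ∈ Finset.univ.erase j, 1 / η i * (2 * √(w i)) := by
  have hu : (Pi.single j 1 : Fin K → ℝ) ∈ stdSimplex ℝ (Fin K) := single_mem_stdSimplex ℝ j
  rw [bregman_eq η hu.1 hw, ← Finset.add_sum_erase _ _ (Finset.mem_univ j)]
  congr 1
  · simp [vertexGap]
  · refine Finset.sum_congr rfl fun i hi => ?_
    rw [Pi.single_eq_of_ne (Finset.ne_of_mem_erase hi)]
    have := Real.sqrt_pos.2 (hw i)
    simp only [Real.sqrt_zero, zero_sub, neg_sq]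
    field_simp

lemma vertexGap_le_bregman {η w : Fin K → ℝ} (hη : ∀ i, 0 < η i) (hw : ∀ i, 0 < w i) (j : Fin K) :
    vertexGap (η j) (w j) ≤ bregman η (Pi.single j 1) w := by
  rw [bregman_single hw]
  have : 0 ≤ ∑ i ∈ Finset.univ.erase j, 1 / η i * (2 * √(w i)) :=
    Finset.sum_nonneg fun i _ => by have := hη i; positivity
  linarith

lemma bregman_le_vertexGap {η w : Fin K → ℝ} (hη : ∀ i, 0 < η i) (hw : ∀ i, 0 < w i) (j : Fin K) :
    bregman η (Pi.single j 1) w ≤ vertexGap (η j) (w j) + 2 * ∑ i, 1 / η i * √(w i) := by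
  rw [bregman_single hw]
  have h1 : ∑ i ∈ Finset.univ.erase j, 1 / η i * (2 * √(w i))
      ≤ ∑ i, 1 / η i * (2 * √(w i)) :=
    Finset.sum_le_sum_of_subset_of_nonneg (Finset.erase_subset _ _)
      fun i _ _ => by have := hη i; positivity
  have h2 : ∑ i, 1 / η i * (2 * √(w i)) = 2 * ∑ i, 1 / η i * √(w i) := by
    rw [Finset.mul_sum]
    exact Finset.sum_congr rfl fun i _ => by ring
  linarith

lemma le_vertexGap {η w : ℝ} (hη : 0 < η) (hw : 0 < w) :
    1 / η * (2 * (1 / √w - 2)) ≤ vertexGap η w := by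
  unfold vertexGap
  refine mul_le_mul_of_nonneg_left ?_ (by positivity)
  have := Real.sqrt_pos.2 hw
  rw [show 2 * (1 - √w) ^ 2 / √w = 2 * (1 / √w - 2) + 2 * √w by field_simp; ring]
  linarith

lemma vertexGap_le {η w : ℝ} (hη : 0 < η) (hw : 0 < w) (hw1 : w ≤ 1) :
    vertexGap η w ≤ 1 / η * (2 * (1 / √w)) := by
  unfold vertexGap
  refine mul_le_mul_of_nonneg_left ?_ (by positivity)
  have h1 := Real.sqrt_pos.2 hw
  have h2 : √w ≤ 1 := Real.sqrt_le_one.2 hw1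
  rw [show 2 * (1 - √w) ^ 2 / √w = 2 * (1 / √w) - (4 - 2 * √w) by field_simp; ring]
  linarith

/-- Increasing step sizes decreases the divergence from a vertex. -/
lemma bregman_rebase_le {η w : Fin K → ℝ} (hη : ∀ i, 0 < η i) (hw : ∀ i, 0 < w i) (j : Fin K)
    {β : ℝ} (hβ : 1 ≤ β) (R : Finset (Fin K)) :
    bregman (fun i => if i ∈ R then β * η i else η i) (Pi.single j 1) w
      ≤ bregman η (Pi.single j 1) w
        - (1 - 1 / β) * if j ∈ R then vertexGap (η j) (w j) else 0 := by
  have hβ0 : 0 < β := by linarith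
  rw [bregman_single hw, bregman_single hw]
  have h1 : ∑ i ∈ Finset.univ.erase j, 1 / (if i ∈ R then β * η i else η i) * (2 * √(w i))
      ≤ ∑ i ∈ Finset.univ.erase j, 1 / η i * (2 * √(w i)) := by
    refine Finset.sum_le_sum fun i _ => ?_
    have h3 := hη i
    refine mul_le_mul_of_nonneg_right ?_ (by positivity)
    split_ifs
    · exact one_div_le_one_div_of_le h3 (by nlinarith)
    · rfl
  have h2 : vertexGap (if j ∈ R then β * η j else η j) (w j) = vertexGap (η j) (w j)
      - (1 - 1 / β) * if j ∈ R then vertexGap (η j) (w j) else 0 := by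
    have h3 := hη j
    split_ifs
    · unfold vertexGap
      field_simp
      ring
    · ring
  linarith

/-- Each coordinate of the divergence is multiplied by `1` or by `1/β`. -/
lemma le_bregman_rebase {η w : Fin K → ℝ} (hη : ∀ i, 0 < η i) (hw : ∀ i, 0 < w i) (j : Fin K)
    {β : ℝ} (hβ : 1 ≤ β) (R : Finset (Fin K)) :
    1 / β * bregman η (Pi.single j 1) w
      ≤ bregman (fun i => if i ∈ R then β * η i else η i) (Pi.single j 1) w := by
  have hβ0 : 0 < β := by linarith
  have hu : (Pi.single j 1 : Fin K → ℝ) ∈ stdSimplex ℝ (Fin K) := single_mem_stdSimplex ℝ j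
  rw [bregman_eq η hu.1 hw, bregman_eq _ hu.1 hw, Finset.mul_sum]
  refine Finset.sum_le_sum fun i _ => ?_
  have h3 := hη i
  rw [← mul_assoc]
  refine mul_le_mul_of_nonneg_right ?_ (by positivity)
  rw [one_div_mul_one_div]
  split_ifs
  · rfl
  · exact one_div_le_one_div_of_le h3 (by nlinarith)

variable {k : Fin K → ℕ}

/-! ### The rounds of the corralling algorithm -/

/-- Round `t` is the first one in which a new epoch is noticed. -/
def Setup.IsNew (A : Setup K k) (x : Path K k) (t : ℕ) : Prop :=
  A.epochOf t ≠ (A.state x t).epoch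

open Classical in
/-- The threshold indices used in round `t`. -/
noncomputable def Setup.index (A : Setup K k) (x : Path K k) (t : ℕ) (i : Fin K) : ℕ :=
  if A.IsNew x t then A.thresholdIndex ((A.state x t).w i) else (A.state x t).θ i

/-- In round `t` the probability of `i` is at most the threshold of index `s`, which is in use. -/
def Setup.Below (A : Setup K k) (x : Path K k) (t : ℕ) (i : Fin K) (s : ℕ) : Prop :=
  threshold s ≤ (K : ℝ) * A.T ∧ (A.state x t).w i ≤ 1 / threshold s

/-- Round `t` triggers a negative-regret step with the set `R`. -/
structure Setup.Triggers (A : Setup K k) (x : Path K k) (t : ℕ) (b : Bool) (R : Finset (Fin K)) :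
    Prop where
  mode : (A.state x t).mode = Mode.free b
  mode_succ : (A.state x (t + 1)).mode = Mode.nrsFirst R (A.state x t).w
  w_succ : (A.state x (t + 1)).w = omd (A.state x t).η (A.state x t).w (A.rescaledLoss x t)
  L_succ : (A.state x (t + 1)).L = fun i => (A.state x t).L i + A.rescaledLoss x t i
  η_succ : (A.state x (t + 1)).η = (A.state x t).η
  epoch_succ : (A.state x (t + 1)).epoch = A.epochOf t
  control : (A.IsNew x t ∧ (∀ i, i ∈ R ↔ A.Below x t i 0) ∧
      ∀ i, (A.state x (t + 1)).θ i = A.index x t i) ∨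
    (b = false ∧ (∀ i, i ∈ R ↔ A.Below x t i (A.index x t i)) ∧
      (A.IsNew x t → ∀ i, ¬ A.Below x t i 0) ∧
      ∀ i, (A.state x (t + 1)).θ i = if i ∈ R then A.index x t i + 1 else A.index x t i)

/-- Round `t` is followed by a step with decreasing step sizes. -/
structure Setup.Decays (A : Setup K k) (x : Path K k) (t : ℕ) (b : Bool) : Prop where
  mode : (A.state x t).mode = Mode.free b
  mode_succ : (A.state x (t + 1)).mode = Mode.free false
  L_succ : (A.state x (t + 1)).L = fun i => (A.state x t).L i + A.rescaledLoss x t i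
  η_succ : (A.state x (t + 1)).η = A.decay (A.state x t).η
  w_succ : (A.state x (t + 1)).w = ftrl (A.state x (t + 1)).η (A.state x (t + 1)).L
  epoch_succ : (A.state x (t + 1)).epoch = A.epochOf t
  index_succ : ∀ i, (A.state x (t + 1)).θ i = A.index x t i
  not_first : A.IsNew x t → ∀ i, ¬ A.Below x t i 0
  not_below : b = false → ∀ i, ¬ A.Below x t i (A.index x t i)

/-- Round `t` is the first extra round of a negative-regret step. -/
structure Setup.Rebases (A : Setup K k) (x : Path K k) (t : ℕ) (R : Finset (Fin K)) : Prop where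
  mode : ∃ v, (A.state x t).mode = Mode.nrsFirst R v
  mode_succ : (A.state x (t + 1)).mode = Mode.nrsSecond
  η_succ : (A.state x (t + 1)).η
    = fun i => if i ∈ R then beta A.T * (A.state x t).η i else (A.state x t).η i
  w_succ : (A.state x (t + 1)).w
    = omd (A.state x (t + 1)).η (A.state x t).w (A.rescaledLoss x t)
  L_succ : (A.state x (t + 1)).L = fun i =>
    -gradPsi (A.state x (t + 1)).η (A.state x t).w i + A.rescaledLoss x t i
  epoch_succ : (A.state x (t + 1)).epoch = (A.state x t).epoch
  index_succ : (A.state x (t + 1)).θ = (A.state x t).θ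

/-- Round `t` is the second extra round of a negative-regret step. -/
structure Setup.Closes (A : Setup K k) (x : Path K k) (t : ℕ) : Prop where
  mode : (A.state x t).mode = Mode.nrsSecond
  mode_succ : (A.state x (t + 1)).mode = Mode.free true
  η_succ : (A.state x (t + 1)).η = (A.state x t).η
  L_succ : (A.state x (t + 1)).L = fun i => (A.state x t).L i + A.rescaledLoss x t i
  w_succ : (A.state x (t + 1)).w = ftrl (A.state x (t + 1)).η (A.state x (t + 1)).L
  epoch_succ : (A.state x (t + 1)).epoch = (A.state x t).epoch
  index_succ : (A.state x (t + 1)).θ = (A.state x t).θ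

lemma Setup.state_succ_main (A : Setup K k) (x : Path K k) {t : ℕ} (ht : A.initLen ≤ t) :
    A.state x (t + 1) = A.mainStep t (x.loss t) (x.seed t) (x.sel t) (A.state x t) := by
  rw [Setup.state, if_neg (not_lt.2 ht)]

lemma Setup.state_succ_init (A : Setup K k) (x : Path K k) {t : ℕ} (ht : t < A.initLen) :
    A.state x (t + 1) = A.initStep (x.loss t) (x.seed t) (x.sel t) (A.state x t) := by
  rw [Setup.state, if_pos ht]

lemma Setup.rebases_of_mode (A : Setup K k) (x : Path K k) {t : ℕ} (ht : A.initLen ≤ t)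
    {R : Finset (Fin K)} {v : Fin K → ℝ} (h : (A.state x t).mode = Mode.nrsFirst R v) :
    A.Rebases x t R := by
  have hs := A.state_succ_main x ht
  simp only [Setup.mainStep, h] at hs
  refine ⟨⟨v, h⟩, ?_, ?_, ?_, ?_, ?_, ?_⟩ <;> rw [hs] <;> rfl

lemma Setup.closes_of_mode (A : Setup K k) (x : Path K k) {t : ℕ} (ht : A.initLen ≤ t)
    (h : (A.state x t).mode = Mode.nrsSecond) : A.Closes x t := by
  have hs := A.state_succ_main x ht
  simp only [Setup.mainStep, h] at hs
  refine ⟨h, by rw [hs], by rw [hs], by rw [hs]; rfl, by rw [hs], by rw [hs], by rw [hs]⟩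

lemma Setup.triggers_or_decays (A : Setup K k) (x : Path K k) {t : ℕ} (ht : A.initLen ≤ t)
    {b : Bool} (h : (A.state x t).mode = Mode.free b) :
    (∃ R, A.Triggers x t b R) ∨ A.Decays x t b := by
  have hs := A.state_succ_main x ht
  -- The unfolded `mainStep` carries its own decidability instance; quantifying over instances lets
  -- the conditional be recognized as `index`.
  have hidx : ∀ (inst : Decidable (A.epochOf t ≠ (A.state x t).epoch)) (i : Fin K),
      @ite ℕ (A.epochOf t ≠ (A.state x t).epoch) inst
        (A.thresholdIndex ((A.state x t).w i)) ((A.state x t).θ i) = A.index x t i := by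
    intro inst i
    unfold Setup.index Setup.IsNew
    congr
  simp only [Setup.mainStep, h, hidx] at hs
  by_cases h1 : A.IsNew x t ∧ ∃ i, A.Below x t i 0
  · obtain ⟨hn, i₀, hi₀⟩ := h1
    rw [if_pos ⟨hn, i₀, by rw [Finset.mem_filter]; exact ⟨Finset.mem_univ i₀, hi₀⟩⟩] at hs
    refine Or.inl ⟨_, h, by rw [hs], by rw [hs]; rfl, by rw [hs]; rfl, by rw [hs], by rw [hs],
      Or.inl ⟨hn, fun i => ?_, fun i => by rw [hs]⟩⟩
    rw [Finset.mem_filter]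
    simp [Setup.Below]
  have h1' : A.IsNew x t → ∀ i, ¬ A.Below x t i 0 := fun hn i hi => h1 ⟨hn, i, hi⟩
  rw [if_neg (fun hc => h1 ⟨hc.1, by
    obtain ⟨i, hi⟩ := hc.2
    exact ⟨i, (Finset.mem_filter.1 hi).2⟩⟩)] at hs
  by_cases h2 : (∃ i, A.Below x t i (A.index x t i)) ∧ b = false
  · obtain ⟨⟨i₀, hi₀⟩, hb⟩ := h2
    rw [if_pos ⟨⟨i₀, by rw [Finset.mem_filter]; exact ⟨Finset.mem_univ i₀, hi₀⟩⟩, hb⟩] at hs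
    refine Or.inl ⟨_, h, by rw [hs], by rw [hs]; rfl, by rw [hs]; rfl, by rw [hs], by rw [hs],
      Or.inr ⟨hb, fun i => ?_, h1', fun i => ?_⟩⟩
    · rw [Finset.mem_filter]
      simp [Setup.Below]
    · rw [hs]
  · rw [if_neg (fun hc => h2 ⟨by
      obtain ⟨i, hi⟩ := hc.1
      exact ⟨i, (Finset.mem_filter.1 hi).2⟩, hc.2⟩)] at hs
    exact Or.inr ⟨h, by rw [hs], by rw [hs]; rfl, by rw [hs], by rw [hs], by rw [hs],
      fun i => by rw [hs], h1', fun hb i hi => h2 ⟨⟨i, hi⟩, hb⟩⟩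

/-- The four kinds of rounds after the initial phase. -/
lemma Setup.round_cases (A : Setup K k) (x : Path K k) {t : ℕ} (ht : A.initLen ≤ t) :
    (∃ b R, A.Triggers x t b R) ∨ (∃ b, A.Decays x t b) ∨ (∃ R, A.Rebases x t R) ∨
      A.Closes x t := by
  cases h : (A.state x t).mode with
  | free b =>
    rcases A.triggers_or_decays x ht h with ⟨R, hR⟩ | hD
    · exact Or.inl ⟨b, R, hR⟩
    · exact Or.inr (Or.inl ⟨b, hD⟩)
  | nrsFirst R v => exact Or.inr (Or.inr (Or.inl ⟨R, A.rebases_of_mode x ht h⟩))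
  | nrsSecond => exact Or.inr (Or.inr (Or.inr (A.closes_of_mode x ht h)))

/-! ### Step sizes are positive and the iterates are stationary -/

lemma one_le_beta (T : ℕ) : 1 ≤ beta T := Real.one_le_exp (by positivity)

lemma Setup.decay_pos (A : Setup K k) (hη : ∀ i, 0 < A.η i) {η : Fin K → ℝ} (h : ∀ i, 0 < η i)
    (i : Fin K) : 0 < A.decay η i := by
  have h1 := hη i
  have h2 := h i
  unfold Setup.decay
  positivity

lemma Setup.one_div_decay (A : Setup K k) (hη : ∀ i, 0 < A.η i) (η : Fin K → ℝ) (i : Fin K) :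
    1 / A.decay η i = √(1 / η i ^ 2 + 1 / A.η i ^ 2) := by
  have h1 := hη i
  unfold Setup.decay
  rw [one_div_one_div]

lemma Setup.one_div_le_one_div_decay (A : Setup K k) (hη : ∀ i, 0 < A.η i) {η : Fin K → ℝ}
    (h : ∀ i, 0 < η i) (i : Fin K) : 1 / η i ≤ 1 / A.decay η i := by
  have h1 := hη i
  have h2 := h i
  rw [A.one_div_decay hη]
  refine Real.le_sqrt_of_sq_le ?_
  rw [div_pow, one_pow]
  have : 0 ≤ 1 / A.η i ^ 2 := by positivity
  linarith

lemma Setup.one_div_decay_sub_le (A : Setup K k) (hη : ∀ i, 0 < A.η i) {η : Fin K → ℝ}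
    (h : ∀ i, 0 < η i) (i : Fin K) : 1 / A.decay η i - 1 / η i ≤ 1 / A.η i := by
  have h1 := hη i
  have h2 := h i
  rw [A.one_div_decay hη]
  have : √(1 / η i ^ 2 + 1 / A.η i ^ 2) ≤ 1 / η i + 1 / A.η i := by
    refine Real.sqrt_le_iff.2 ⟨by positivity, ?_⟩
    have h3 : 0 ≤ 1 / η i * (1 / A.η i) := by positivity
    have h4 : (1 / η i) ^ 2 = 1 / η i ^ 2 := by rw [div_pow, one_pow]
    have h5 : (1 / A.η i) ^ 2 = 1 / A.η i ^ 2 := by rw [div_pow, one_pow]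
    nlinarith
  linarith

/-- With `x = 1/η'` and `y = 1/η`, `(x - y) x ≤ x² - y² = 1/η₁²`. This form decays like `1/√t` and
enters the penalty; the cruder bound by `1/η₁` serves the lower bounds for the potential. -/
lemma Setup.one_div_decay_sub_le' (A : Setup K k) (hη : ∀ i, 0 < A.η i) {η : Fin K → ℝ}
    (h : ∀ i, 0 < η i) (i : Fin K) :
    1 / A.decay η i - 1 / η i ≤ A.decay η i / A.η i ^ 2 := by
  have h1 := hη i
  have h2 := h i
  have h3 := A.decay_pos hη h i
  have h4 : (1 / A.decay η i) ^ 2 = 1 / η i ^ 2 + 1 / A.η i ^ 2 := by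
    rw [A.one_div_decay hη, Real.sq_sqrt (by positivity)]
  have h5 : (1 / η i) ^ 2 = 1 / η i ^ 2 := by rw [div_pow, one_pow]
  have h6 : 0 < 1 / A.decay η i := by positivity
  have h7 : 0 < 1 / η i := by positivity
  have h8 : A.decay η i / A.η i ^ 2 = (1 / A.η i ^ 2) / (1 / A.decay η i) := by
    field_simp
  rw [h8, le_div_iff₀ h6]
  have h9 := A.one_div_le_one_div_decay hη h i
  nlinarith [mul_nonneg h7.le (sub_nonneg.2 h9)]

lemma Setup.η_pos (A : Setup K k) (x : Path K k) (hη : ∀ i, 0 < A.η i) (t : ℕ) :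
    ∀ i, 0 < (A.state x t).η i := by
  induction t with
  | zero => exact hη
  | succ t ih =>
    rcases lt_or_ge t A.initLen with ht | ht
    · rw [A.state_succ_init x ht]
      exact A.decay_pos hη ih
    · rcases A.round_cases x ht with ⟨b, R, h⟩ | ⟨b, h⟩ | ⟨R, h⟩ | h
      · rwa [h.η_succ]
      · rw [h.η_succ]; exact A.decay_pos hη ih
      · rw [h.η_succ]
        intro i
        have h1 := one_le_beta A.T
        have h2 := ih i
        dsimp only
        split_ifs
        · positivity
        · exact h2
      · rwa [h.η_succ]

lemma Setup.initLen_pos (A : Setup K k) (hK : 0 < K) : 0 < A.initLen := by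
  unfold Setup.initLen
  positivity

/-- The invariant behind the whole analysis. Re-basing the cumulative loss is designed to preserve
it when step sizes increase. -/
lemma Setup.isStat (A : Setup K k) (x : Path K k) (hη : ∀ i, 0 < A.η i) (hK : 0 < K) {t : ℕ}
    (ht : A.initLen ≤ t) :
    IsStat (A.state x t).η (A.state x t).L (A.state x t).w := by
  induction t, ht using Nat.le_induction with
  | base =>
    obtain ⟨s, hs⟩ := Nat.exists_eq_succ_of_ne_zero (A.initLen_pos hK).ne'
    have h1 : A.state x A.initLen = A.initStep (x.loss s) (x.seed s) (x.sel s) (A.state x s) := by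
      conv_lhs => rw [hs]
      exact A.state_succ_init x (by omega)
    rw [h1]
    exact ftrl_isStat (A.decay_pos hη (A.η_pos x hη s)) _ hK
  | succ t ht ih =>
    have hpos := A.η_pos x hη t
    have hpos' := A.η_pos x hη (t + 1)
    rcases A.round_cases x ht with ⟨b, R, h⟩ | ⟨b, h⟩ | ⟨R, h⟩ | h
    · rw [h.w_succ, h.η_succ, h.L_succ]
      exact ih.omd hpos hK
    · rw [h.w_succ]; exact ftrl_isStat hpos' _ hK
    · rw [h.w_succ, h.L_succ]
      exact omd_isStat hpos' hK
    · rw [h.w_succ]; exact ftrl_isStat hpos' _ hK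

/-! ### The potential -/

/-- The potential of the regret analysis against base algorithm `j`. -/
noncomputable def Setup.potential (A : Setup K k) (x : Path K k) (j : Fin K) (t : ℕ) : ℝ :=
  bregman (A.state x t).η (Pi.single j 1) (A.state x t).w

/-- The negative regret of round `t`, up to the factor `1 - 1/β`. -/
noncomputable def Setup.gain (A : Setup K k) (x : Path K k) (j : Fin K) (t : ℕ) : ℝ :=
  match (A.state x t).mode with
  | Mode.nrsFirst R _ => if j ∈ R then vertexGap ((A.state x t).η j) ((A.state x t).w j) else 0
  | _ => 0

lemma Setup.gain_nonneg (A : Setup K k) (x : Path K k) (hη : ∀ i, 0 < A.η i) (j : Fin K) (t : ℕ) :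
    0 ≤ A.gain x j t := by
  unfold Setup.gain
  split
  · split_ifs
    · exact vertexGap_nonneg (A.η_pos x hη t j)
    · rfl
  · rfl

lemma Setup.gain_eq_zero_of_free (A : Setup K k) (x : Path K k) (j : Fin K) {t : ℕ} {b : Bool}
    (h : (A.state x t).mode = Mode.free b) : A.gain x j t = 0 := by
  simp [Setup.gain, h]

lemma Setup.gain_eq_zero_of_second (A : Setup K k) (x : Path K k) (j : Fin K) {t : ℕ}
    (h : (A.state x t).mode = Mode.nrsSecond) : A.gain x j t = 0 := by
  simp [Setup.gain, h]

lemma Setup.gain_of_first (A : Setup K k) (x : Path K k) (j : Fin K) {t : ℕ}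
    {R : Finset (Fin K)} {v : Fin K → ℝ} (h : (A.state x t).mode = Mode.nrsFirst R v) :
    A.gain x j t
      = if j ∈ R then vertexGap ((A.state x t).η j) ((A.state x t).w j) else 0 := by
  simp [Setup.gain, h]

/-- The sum of the stability terms with step sizes `η`. -/
noncomputable def Setup.stability (A : Setup K k) (x : Path K k) (t : ℕ) (η : Fin K → ℝ) : ℝ :=
  1 / 2 * ∑ i, η i * A.rescaledLoss x t i ^ 2 * ((A.state x t).w i * √((A.state x t).w i))

lemma sum_mul_single (e : Fin K → ℝ) (j : Fin K) :
    ∑ i, e i * (Pi.single j 1 : Fin K → ℝ) i = e j := by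
  rw [Finset.sum_eq_single j]
  · simp
  · intro b _ hb
    simp [Pi.single_eq_of_ne hb]
  · simp

/-- Upper bound for the potential after a round. The step sizes of the stability terms are those
before or after the round. -/
lemma Setup.potential_succ_le (A : Setup K k) (x : Path K k) (hη : ∀ i, 0 < A.η i) (j : Fin K)
    {t : ℕ} (ht : A.initLen ≤ t) (he : ∀ i, 0 ≤ A.rescaledLoss x t i) :
    ∃ η, (η = (A.state x t).η ∨ η = (A.state x (t + 1)).η) ∧
      A.potential x j (t + 1) ≤ A.potential x j t - (1 - 1 / beta A.T) * A.gain x j t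
        + A.rescaledLoss x t j - ∑ i, A.rescaledLoss x t i * (A.state x t).w i
        + A.stability x t η
        + 4 * ∑ i, (A.state x (t + 1)).η i / A.η i ^ 2 * √((A.state x (t + 1)).w i) := by
  have hK : 0 < K := j.pos
  have hpos := A.η_pos x hη t
  have hpos' := A.η_pos x hη (t + 1)
  have hst := A.isStat x hη hK ht
  have hst' := A.isStat x hη hK (Nat.le_succ_of_le ht)
  have hu : (Pi.single j 1 : Fin K → ℝ) ∈ stdSimplex ℝ (Fin K) := single_mem_stdSimplex ℝ j
  have hpen : 0 ≤ 4 * ∑ i, (A.state x (t + 1)).η i / A.η i ^ 2 * √((A.state x (t + 1)).w i) := by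
    refine mul_nonneg (by norm_num) (Finset.sum_nonneg fun i _ => ?_)
    have := hpos' i
    positivity
  rcases A.round_cases x ht with ⟨b, R, h⟩ | ⟨b, h⟩ | ⟨R, h⟩ | h
  · refine ⟨_, Or.inl rfl, ?_⟩
    rw [A.gain_eq_zero_of_free x j h.mode]
    rw [h.η_succ, h.L_succ] at hst'
    have := bregman_step_le hpos (fun i => le_rfl) he hu hst hst'
    rw [sum_mul_single] at this
    simp only [sub_self, zero_mul, Finset.sum_const_zero, mul_zero, add_zero] at this
    have h1 : A.potential x j (t + 1)
        = bregman (A.state x t).η (Pi.single j 1) (A.state x (t + 1)).w := by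
      rw [Setup.potential, h.η_succ]
    unfold Setup.stability
    rw [h1]
    unfold Setup.potential
    linarith
  · refine ⟨_, Or.inl rfl, ?_⟩
    rw [A.gain_eq_zero_of_free x j h.mode]
    rw [h.L_succ] at hst'
    have hle : ∀ i, 1 / (A.state x t).η i ≤ 1 / (A.state x (t + 1)).η i := by
      rw [h.η_succ]; exact A.one_div_le_one_div_decay hη hpos
    have := bregman_step_le hpos hle he hu hst hst'
    rw [sum_mul_single] at this
    have h2 : ∑ i, (1 / (A.state x (t + 1)).η i - 1 / (A.state x t).η i)
          * √((A.state x (t + 1)).w i)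
        ≤ ∑ i, (A.state x (t + 1)).η i / A.η i ^ 2 * √((A.state x (t + 1)).w i) := by
      refine Finset.sum_le_sum fun i _ => mul_le_mul_of_nonneg_right ?_ (Real.sqrt_nonneg _)
      rw [h.η_succ]
      exact A.one_div_decay_sub_le' hη hpos i
    unfold Setup.stability Setup.potential
    linarith
  · refine ⟨_, Or.inr rfl, ?_⟩
    obtain ⟨v, hv⟩ := h.mode
    rw [A.gain_of_first x j hv]
    rw [h.L_succ] at hst'
    -- The distribution is also stationary for the new step sizes, with linear term `-∇Ψ`. The round
    -- is thus a change of step sizes, which lowers the potential, followed by a step with constant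
    -- step sizes.
    have hst0 : IsStat (A.state x (t + 1)).η
        (fun i => -gradPsi (A.state x (t + 1)).η (A.state x t).w i) (A.state x t).w :=
      isStat_neg_gradPsi hst.1 hst.2.1
    have := bregman_step_le hpos' (fun i => le_rfl) he hu hst0 hst'
    rw [sum_mul_single] at this
    simp only [sub_self, zero_mul, Finset.sum_const_zero, mul_zero, add_zero] at this
    have h3 := bregman_rebase_le hpos hst.1 j (one_le_beta A.T) R
    rw [← h.η_succ] at h3
    unfold Setup.stability Setup.potential
    linarith
  · refine ⟨_, Or.inl rfl, ?_⟩
    rw [A.gain_eq_zero_of_second x j h.mode]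
    rw [h.η_succ, h.L_succ] at hst'
    have := bregman_step_le hpos (fun i => le_rfl) he hu hst hst'
    rw [sum_mul_single] at this
    simp only [sub_self, zero_mul, Finset.sum_const_zero, mul_zero, add_zero] at this
    have h1 : A.potential x j (t + 1)
        = bregman (A.state x t).η (Pi.single j 1) (A.state x (t + 1)).w := by
      rw [Setup.potential, h.η_succ]
    unfold Setup.stability
    rw [h1]
    unfold Setup.potential
    linarith

lemma Setup.potential_nonneg (A : Setup K k) (x : Path K k) (hη : ∀ i, 0 < A.η i) (j : Fin K)
    {t : ℕ} (ht : A.initLen ≤ t) : 0 ≤ A.potential x j t :=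
  bregman_nonneg (A.η_pos x hη t) (single_mem_stdSimplex ℝ j).1 (A.isStat x hη j.pos ht).1

/-- Lower bound for the potential after a round that is not the first extra round of a
negative-regret step. -/
lemma Setup.le_potential_succ (A : Setup K k) (x : Path K k) (hη : ∀ i, 0 < A.η i) (j : Fin K)
    {t : ℕ} (ht : A.initLen ≤ t) (he : ∀ i, 0 ≤ A.rescaledLoss x t i)
    (h : ∀ R, ¬ A.Rebases x t R) :
    A.potential x j t - ∑ i, A.rescaledLoss x t i * (A.state x t).w i - 2 / A.η j
      ≤ A.potential x j (t + 1) := by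
  have hK : 0 < K := j.pos
  have hpos := A.η_pos x hη t
  have hpos' := A.η_pos x hη (t + 1)
  have hst := A.isStat x hη hK ht
  have hst' := A.isStat x hη hK (Nat.le_succ_of_le ht)
  have h0 := hη j
  have h2 : 0 ≤ 2 / A.η j := by positivity
  rcases A.round_cases x ht with ⟨b, R, h⟩ | ⟨b, h⟩ | ⟨R, h'⟩ | h
  · rw [h.L_succ] at hst'
    have := le_bregman_step (fun i => by rw [h.η_succ]) j (he j) hpos' hst hst'
    rw [h.η_succ] at this
    unfold Setup.potential
    rw [h.η_succ]
    linarith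
  · rw [h.L_succ] at hst'
    have := le_bregman_step (by rw [h.η_succ]; exact A.one_div_le_one_div_decay hη hpos)
      j (he j) hpos' hst hst'
    have h3 := A.one_div_decay_sub_le hη hpos j
    rw [← h.η_succ] at h3
    unfold Setup.potential
    have h4 : 2 / A.η j = 2 * (1 / A.η j) := by ring
    linarith
  · exact absurd h' (h R)
  · rw [h.L_succ] at hst'
    have := le_bregman_step (fun i => by rw [h.η_succ]) j (he j) hpos' hst hst'
    rw [h.η_succ] at this
    unfold Setup.potential
    rw [h.η_succ]
    linarith

/-- The increase of the step sizes can cost a constant factor of the potential, unlike the other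
rounds, where the loss is additive. -/
lemma Setup.le_potential_succ_of_rebases (A : Setup K k) (x : Path K k) (hη : ∀ i, 0 < A.η i)
    (j : Fin K) {t : ℕ} (ht : A.initLen ≤ t) (he : ∀ i, 0 ≤ A.rescaledLoss x t i)
    {R : Finset (Fin K)} (h : A.Rebases x t R) :
    1 / beta A.T * A.potential x j t - ∑ i, A.rescaledLoss x t i * (A.state x t).w i
      ≤ A.potential x j (t + 1) := by
  have hK : 0 < K := j.pos
  have hpos := A.η_pos x hη t
  have hpos' := A.η_pos x hη (t + 1)
  have hst := A.isStat x hη hK ht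
  have hst' := A.isStat x hη hK (Nat.le_succ_of_le ht)
  rw [h.L_succ] at hst'
  have hst0 : IsStat (A.state x (t + 1)).η
      (fun i => -gradPsi (A.state x (t + 1)).η (A.state x t).w i) (A.state x t).w :=
    isStat_neg_gradPsi hst.1 hst.2.1
  have := le_bregman_step (fun i => le_rfl) j (he j) hpos' hst0 hst'
  have h3 := le_bregman_rebase hpos hst.1 j (one_le_beta A.T) R
  rw [← h.η_succ] at h3
  unfold Setup.potential
  linarith

/-! ### Epochs and thresholds -/

/-- The first round of epoch `τ`. -/
noncomputable def Setup.start (A : Setup K k) (τ : ℕ) : ℕ := (2 ^ τ - 1) * A.initLen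

/-- This equivalence of Galois type replaces the logarithm in `epochOf` by linear inequalities. -/
lemma Setup.le_epochOf_iff (A : Setup K k) (hK : 0 < K) {τ t : ℕ} :
    τ ≤ A.epochOf t ↔ A.start τ ≤ t := by
  unfold Setup.epochOf Setup.start
  rw [Nat.le_log_iff_pow_le (by norm_num) (Nat.succ_ne_zero _), ← Nat.le_div_iff_mul_le (A.initLen_pos hK)]
  generalize t / A.initLen = q
  omega

lemma Setup.epochOf_eq_iff (A : Setup K k) (hK : 0 < K) {τ t : ℕ} :
    A.epochOf t = τ ↔ A.start τ ≤ t ∧ t < A.start (τ + 1) := by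
  rw [← A.le_epochOf_iff hK, ← not_le, ← A.le_epochOf_iff hK]
  omega

lemma Setup.epochOf_mono (A : Setup K k) (hK : 0 < K) {s t : ℕ} (h : s ≤ t) :
    A.epochOf s ≤ A.epochOf t :=
  (A.le_epochOf_iff hK).2 (((A.le_epochOf_iff hK).1 le_rfl).trans h)

lemma Setup.start_one (A : Setup K k) : A.start 1 = A.initLen := by
  simp [Setup.start]

lemma Setup.start_succ (A : Setup K k) (τ : ℕ) :
    A.start (τ + 1) = A.start τ + 2 ^ τ * A.initLen := by
  unfold Setup.start
  rw [← add_mul]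
  congr 1
  have := Nat.one_le_two_pow (n := τ)
  rw [pow_succ]
  omega

lemma Setup.start_add (A : Setup K k) (τ : ℕ) :
    A.start τ + A.initLen = 2 ^ τ * A.initLen := by
  unfold Setup.start
  have := Nat.one_le_two_pow (n := τ)
  rw [← Nat.succ_mul]
  congr 1
  omega

lemma Setup.start_mono (A : Setup K k) {σ τ : ℕ} (h : σ ≤ τ) : A.start σ ≤ A.start τ := by
  unfold Setup.start
  have := Nat.pow_le_pow_right (n := 2) (by norm_num) h
  exact Nat.mul_le_mul_right _ (by omega)

lemma Setup.initLen_le_start (A : Setup K k) {τ : ℕ} (h : 1 ≤ τ) : A.initLen ≤ A.start τ := by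
  rw [← A.start_one]
  exact A.start_mono h

lemma Setup.one_le_epochOf (A : Setup K k) (hK : 0 < K) {t : ℕ} (h : A.initLen ≤ t) :
    1 ≤ A.epochOf t := by
  rw [A.le_epochOf_iff hK, A.start_one]
  exact h

lemma Setup.init_phase (A : Setup K k) (x : Path K k) {t : ℕ} (ht : t ≤ A.initLen) :
    (A.state x t).epoch = 0 ∧ (A.state x t).mode = Mode.free false ∧
      ∀ i, (A.state x t).θ i = 0 := by
  induction t with
  | zero => exact ⟨rfl, rfl, fun _ => rfl⟩
  | succ t ih =>
    rw [A.state_succ_init x (by omega)]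
    exact ih (by omega)

/-- The recorded epoch changes only in ordinary rounds, so it lags behind by at least one round. In
particular it is stale in the first round of every epoch after the initial phase. -/
lemma Setup.epoch_le (A : Setup K k) (hK : 0 < K) (x : Path K k) (t : ℕ) :
    (A.state x t).epoch ≤ A.epochOf (t - 1) := by
  induction t with
  | zero => simp [Setup.state, Setup.init]
  | succ t ih =>
    have ih' : (A.state x t).epoch ≤ A.epochOf t := ih.trans (A.epochOf_mono hK (by omega))
    rw [Nat.add_sub_cancel]
    rcases lt_or_ge t A.initLen with ht | ht
    · rw [(A.init_phase x (t := t + 1) (by omega)).1]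
      omega
    · rcases A.round_cases x ht with ⟨b, R, h⟩ | ⟨b, h⟩ | ⟨R, h⟩ | h
      · rw [h.epoch_succ]
      · rw [h.epoch_succ]
      · rwa [h.epoch_succ]
      · rwa [h.epoch_succ]

lemma threshold_pos (s : ℕ) : 0 < threshold s := by
  unfold threshold
  positivity

lemma threshold_succ (s : ℕ) : threshold (s + 1) = 2 * threshold s := by
  unfold threshold
  rw [pow_succ]
  ring

lemma threshold_mono {s t : ℕ} (h : s ≤ t) : threshold s ≤ threshold t := by
  unfold threshold
  have : (2 : ℝ) ^ s ≤ 2 ^ t := pow_le_pow_right₀ (by norm_num) h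
  linarith

lemma exists_lt_threshold (y : ℝ) : ∃ s, y < threshold s := by
  obtain ⟨n, hn⟩ := pow_unbounded_of_one_lt y (by norm_num : (1 : ℝ) < 2)
  refine ⟨n, hn.trans_le ?_⟩
  unfold threshold
  have : (0 : ℝ) < 2 ^ n := by positivity
  linarith

/-- The number of thresholds in use. -/
noncomputable def Setup.top (A : Setup K k) : ℕ := sInf {s : ℕ | (K : ℝ) * A.T < threshold s}

lemma Setup.lt_threshold_top (A : Setup K k) : (K : ℝ) * A.T < threshold A.top :=
  Nat.sInf_mem (s := {s : ℕ | (K : ℝ) * A.T < threshold s}) (exists_lt_threshold _)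

lemma Setup.lt_top_iff (A : Setup K k) {s : ℕ} : s < A.top ↔ threshold s ≤ (K : ℝ) * A.T := by
  constructor
  · intro h
    exact not_lt.1 (Nat.notMem_of_lt_sInf h)
  · intro h
    by_contra! hc
    have := A.lt_threshold_top.trans_le (threshold_mono hc)
    linarith

lemma Setup.below_of_lt_thresholdIndex (A : Setup K k) {p : ℝ} {s : ℕ}
    (h : s < A.thresholdIndex p) : threshold s ≤ (K : ℝ) * A.T ∧ p ≤ 1 / threshold s := by
  have := Nat.notMem_of_lt_sInf h
  simp only [Set.mem_ofPred_eq, not_or, not_lt] at this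
  exact ⟨this.2, this.1⟩

lemma Setup.thresholdIndex_spec (A : Setup K k) (p : ℝ) :
    1 / threshold (A.thresholdIndex p) < p ∨ (K : ℝ) * A.T < threshold (A.thresholdIndex p) :=
  Nat.sInf_mem (s := {s : ℕ | 1 / threshold s < p ∨ (K : ℝ) * A.T < threshold s})
    ⟨A.top, Or.inr A.lt_threshold_top⟩

lemma Setup.thresholdIndex_le (A : Setup K k) (p : ℝ) : A.thresholdIndex p ≤ A.top :=
  Nat.sInf_le (Or.inr A.lt_threshold_top)

lemma Setup.index_le (A : Setup K k) (x : Path K k) {t : ℕ} {i : Fin K}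
    (h : (A.state x t).θ i ≤ A.top) : A.index x t i ≤ A.top := by
  unfold Setup.index
  split_ifs
  · exact A.thresholdIndex_le _
  · exact h

lemma Setup.θ_le (A : Setup K k) (x : Path K k) (t : ℕ) (i : Fin K) :
    (A.state x t).θ i ≤ A.top := by
  induction t with
  | zero => simp [Setup.state, Setup.init]
  | succ t ih =>
    rcases lt_or_ge t A.initLen with ht | ht
    · rw [(A.init_phase x (t := t + 1) (by omega)).2.2]
      omega
    · rcases A.round_cases x ht with ⟨b, R, h⟩ | ⟨b, h⟩ | ⟨R, h⟩ | h
      · rcases h.control with ⟨-, -, hθ⟩ | ⟨-, hR, -, hθ⟩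
        · rw [hθ]; exact A.index_le x ih
        · rw [hθ]
          split_ifs with hi
          · exact A.lt_top_iff.2 ((hR i).1 hi).1
          · exact A.index_le x ih
      · rw [h.index_succ]; exact A.index_le x ih
      · rwa [h.index_succ]
      · rwa [h.index_succ]

/-- A first-round step does not raise the indices. That the index it has just set is positive allows
the count of increases to charge this step to it. -/
lemma Setup.one_le_thresholdIndex (A : Setup K k) (x : Path K k) {t : ℕ} {i : Fin K}
    (h : A.Below x t i 0) : 1 ≤ A.thresholdIndex ((A.state x t).w i) := by
  by_contra! hc
  have h0 : A.thresholdIndex ((A.state x t).w i) = 0 := by omega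
  have h1 := A.thresholdIndex_spec ((A.state x t).w i)
  rw [h0] at h1
  rcases h1 with h1 | h1
  · exact absurd h.2 (not_le.2 h1)
  · exact absurd h.1 (not_le.2 h1)

/-! ### Bounds for the step sizes -/

/-- The squared ratio of the initial step size and the current one. -/
noncomputable def Setup.mass (A : Setup K k) (x : Path K k) (i : Fin K) (t : ℕ) : ℝ :=
  (A.η i / (A.state x t).η i) ^ 2

lemma Setup.mass_nonneg (A : Setup K k) (x : Path K k) (i : Fin K) (t : ℕ) :
    0 ≤ A.mass x i t := sq_nonneg _

lemma Setup.mass_decay (A : Setup K k) (hη : ∀ i, 0 < A.η i) (x : Path K k) (i : Fin K) {t : ℕ}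
    (h : (A.state x (t + 1)).η = A.decay (A.state x t).η) :
    A.mass x i (t + 1) = A.mass x i t + 1 := by
  have h1 := hη i
  have h2 := A.η_pos x hη t i
  unfold Setup.mass
  rw [h, div_eq_mul_one_div, A.one_div_decay hη, mul_pow, Real.sq_sqrt (by positivity)]
  field_simp

lemma Setup.mass_same (A : Setup K k) (x : Path K k) (i : Fin K) {t : ℕ}
    (h : (A.state x (t + 1)).η = (A.state x t).η) : A.mass x i (t + 1) = A.mass x i t := by
  unfold Setup.mass
  rw [h]

lemma Setup.Rebases.mass {A : Setup K k} {x : Path K k} {t : ℕ} {R : Finset (Fin K)}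
    (h : A.Rebases x t R) (i : Fin K) :
    A.mass x i (t + 1) = if i ∈ R then A.mass x i t / beta A.T ^ 2 else A.mass x i t := by
  have h1 := one_le_beta A.T
  unfold Setup.mass
  rw [h.η_succ]
  split_ifs with hi
  · dsimp only
    rw [if_pos hi, div_pow, div_pow, mul_pow, div_div, mul_comm]
  · dsimp only
    rw [if_neg hi]

lemma Setup.mass_succ_le (A : Setup K k) (hη : ∀ i, 0 < A.η i) (x : Path K k) (i : Fin K) (t : ℕ) :
    A.mass x i (t + 1) ≤ A.mass x i t + 1 := by
  have h0 := A.mass_nonneg x i t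
  rcases lt_or_ge t A.initLen with ht | ht
  · rw [A.mass_decay hη]
    rw [A.state_succ_init x ht]
    rfl
  · rcases A.round_cases x ht with ⟨b, R, h⟩ | ⟨b, h⟩ | ⟨R, h⟩ | h
    · rw [A.mass_same x i h.η_succ]; linarith
    · rw [A.mass_decay hη x i h.η_succ]
    · rw [h.mass]
      split_ifs
      · have := div_le_self h0 (one_le_pow₀ (n := 2) (one_le_beta A.T))
        linarith
      · linarith
    · rw [A.mass_same x i h.η_succ]; linarith

lemma Setup.mass_init (A : Setup K k) (hη : ∀ i, 0 < A.η i) (x : Path K k) (i : Fin K) {t : ℕ}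
    (ht : t ≤ A.initLen) : A.mass x i t = t + 1 := by
  induction t with
  | zero =>
    have := (hη i).ne'
    simp [Setup.mass, Setup.state, Setup.init, this]
  | succ t ih =>
    rw [A.mass_decay hη, ih (by omega)]
    · push_cast; ring
    · rw [A.state_succ_init x (by omega)]
      rfl

lemma Setup.mass_le (A : Setup K k) (hη : ∀ i, 0 < A.η i) (x : Path K k) (i : Fin K) (t : ℕ) :
    A.mass x i t ≤ t + 1 := by
  induction t with
  | zero => rw [A.mass_init hη x i (Nat.zero_le _)]
  | succ t ih =>
    have := A.mass_succ_le hη x i t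
    push_cast
    linarith

/-! ### Counting decreases and increases of the step sizes within an epoch. -/

/-- The number of rounds since the last step with decreasing step sizes, within a pattern of
negative-regret steps. -/
def Mode.credit : Mode K → ℕ
  | Mode.free false => 0
  | Mode.free true => 3
  | Mode.nrsFirst _ _ => 1
  | Mode.nrsSecond => 2

/-- Whether the step size of `i` is about to be increased. -/
def Mode.pending (i : Fin K) : Mode K → ℕ
  | Mode.nrsFirst R _ => if i ∈ R then 1 else 0
  | _ => 0

/-- An upper bound for the number of increases of the step size of `i` during epoch `τ`. -/
noncomputable def Setup.increases (A : Setup K k) (x : Path K k) (τ : ℕ) (i : Fin K) (t : ℕ) : ℕ :=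
  (if (A.state x t).epoch = τ then (A.state x t).θ i else 0) + 1

/-- A lower bound for four times the number of decreases of the step sizes during epoch `τ`. -/
noncomputable def Setup.decreases (A : Setup K k) (x : Path K k) (τ : ℕ) (t : ℕ) : ℝ :=
  (t : ℝ) - A.start τ - 3 - (if (A.state x t).epoch = τ then 3 else 0)
    - ((A.state x t).mode.credit : ℝ)

lemma credit_le (m : Mode K) : m.credit ≤ 3 := by
  unfold Mode.credit
  split <;> omega

lemma pending_le (i : Fin K) (m : Mode K) : m.pending i ≤ 1 := by
  unfold Mode.pending
  split
  · split_ifs <;> omega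
  · omega

/-- A decrease adds `1` to the mass and an increase divides it by `β²`. A negative-regret step takes
three rounds, and the ordinary round after it must be a decrease unless a new epoch is noticed; so,
up to constants, every fourth round is a decrease. An increase is charged to the threshold index
when it is triggered, and `pending` carries the factor until it is executed. The `+ 1` in
`increases` pays for a step still pending when the epoch begins. -/
lemma Setup.mass_lower_aux (A : Setup K k) (hη : ∀ i, 0 < A.η i) (x : Path K k) (i : Fin K)
    {τ : ℕ} (hτ : 1 ≤ τ) {g : ℝ} (hg : 0 ≤ g) (hg' : g ≤ A.mass x i (A.start τ)) {t : ℕ}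
    (ht : A.start τ ≤ t) (ht' : t ≤ A.start (τ + 1)) :
    (g + A.decreases x τ t / 4) * (beta A.T ^ 2) ^ ((A.state x t).mode.pending i)
      ≤ A.mass x i t * (beta A.T ^ 2) ^ A.increases x τ i t := by
  have hK : 0 < K := i.pos
  have hB : 1 ≤ beta A.T ^ 2 := one_le_pow₀ (one_le_beta A.T)
  have hinit := A.initLen_le_start hτ
  generalize hBd : beta A.T ^ 2 = B at hB
  induction t, ht using Nat.le_induction with
  | base =>
    have h1 : (A.state x (A.start τ)).epoch ≠ τ := by
      have h2 := A.epoch_le hK x (A.start τ)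
      have h3 : ¬ τ ≤ A.epochOf (A.start τ - 1) := by
        rw [A.le_epochOf_iff hK]
        have := A.initLen_pos hK
        omega
      omega
    have h4 : A.decreases x τ (A.start τ) ≤ 0 := by
      unfold Setup.decreases
      rw [if_neg h1]
      have : (0 : ℝ) ≤ ((A.state x (A.start τ)).mode.credit : ℝ) := Nat.cast_nonneg _
      linarith
    have h5 : A.increases x τ i (A.start τ) = 1 := by
      unfold Setup.increases
      rw [if_neg h1]
    rw [h5]
    have h6 : B ^ ((A.state x (A.start τ)).mode.pending i) ≤ B ^ 1 :=
      pow_le_pow_right₀ hB (pending_le i _)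
    calc _ ≤ g * B ^ ((A.state x (A.start τ)).mode.pending i) := by
          refine mul_le_mul_of_nonneg_right ?_ (by positivity)
          linarith
      _ ≤ A.mass x i (A.start τ) * B ^ 1 := mul_le_mul hg' h6 (by positivity) (hg.trans hg')
  | succ t ht ih =>
    have ih := ih (by omega)
    have hep : A.epochOf t = τ := (A.epochOf_eq_iff hK).2 ⟨ht, by omega⟩
    have hm := A.mass_nonneg x i t
    have hst : A.initLen ≤ t := hinit.trans ht
    have hcast : ((t + 1 : ℕ) : ℝ) = t + 1 := by push_cast; ring
    -- the bookkeeping of the three kinds of changes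
    have same : ∀ {d d' : ℝ} {c c' p : ℕ}, g + d ≤ A.mass x i t * B ^ c → d' ≤ d → c + p ≤ c' →
        (g + d') * B ^ p ≤ A.mass x i t * B ^ c' := by
      intro d d' c c' p h1 h2 h3
      calc (g + d') * B ^ p ≤ (A.mass x i t * B ^ c) * B ^ p :=
            mul_le_mul_of_nonneg_right (by linarith) (by positivity)
        _ = A.mass x i t * B ^ (c + p) := by rw [pow_add, mul_assoc]
        _ ≤ A.mass x i t * B ^ c' :=
            mul_le_mul_of_nonneg_left (pow_le_pow_right₀ hB h3) hm
    rcases A.round_cases x hst with ⟨b, R, h⟩ | ⟨b, h⟩ | ⟨R, h⟩ | h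
    · have ep' : (A.state x (t + 1)).epoch = τ := by rw [h.epoch_succ, hep]
      rw [h.mode] at ih
      rw [A.mass_same x i h.η_succ, h.mode_succ]
      simp only [Mode.pending, pow_zero, mul_one] at ih ⊢
      refine same ih ?_ ?_
      · unfold Setup.decreases
        rw [if_pos ep', h.mode_succ, h.mode, hcast]
        have hcr : ((Mode.nrsFirst R (A.state x t).w : Mode K).credit : ℝ) = 1 := by
          simp [Mode.credit]
        have hc3 : ((Mode.free b : Mode K).credit : ℝ) ≤ 3 := by
          exact_mod_cast credit_le (Mode.free b : Mode K)
        rw [hcr]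
        -- A step directly after another one needs a new epoch; the `3` that `decreases` subtracts
        -- once the epoch is recorded absorbs this case.
        split_ifs with he
        · rcases h.control with ⟨hn, -, -⟩ | ⟨hb, -, -, -⟩
          · exact absurd (hep.trans he.symm) hn
          · subst hb
            have : ((Mode.free false : Mode K).credit : ℝ) = 0 := by simp [Mode.credit]
            linarith
        · linarith
      · unfold Setup.increases
        rw [if_pos ep']
        rcases h.control with ⟨hn, hR, hθ⟩ | ⟨hb, hR, -, hθ⟩
        · have hne : (A.state x t).epoch ≠ τ := fun he => hn (hep.trans he.symm)
          rw [if_neg hne, hθ, Setup.index, if_pos hn]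
          split_ifs with hi
          · have := A.one_le_thresholdIndex x ((hR i).1 hi)
            omega
          · omega
        · rw [hθ]
          have : (if (A.state x t).epoch = τ then (A.state x t).θ i else 0) ≤ A.index x t i := by
            split_ifs with he
            · rw [Setup.index, if_neg]
              exact fun hn => hn (hep.trans he.symm)
            · omega
          split_ifs with hi <;> split_ifs at this <;> omega
    · have ep' : (A.state x (t + 1)).epoch = τ := by rw [h.epoch_succ, hep]
      rw [h.mode] at ih
      rw [A.mass_decay hη x i h.η_succ, h.mode_succ]
      simp only [Mode.pending, pow_zero, mul_one] at ih ⊢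
      have hd : A.decreases x τ (t + 1) ≤ A.decreases x τ t + 4 := by
        unfold Setup.decreases
        rw [if_pos ep', h.mode_succ, h.mode, hcast]
        have hcr : ((Mode.free false : Mode K).credit : ℝ) = 0 := by
          simp [Mode.credit]
        have hc3 : ((Mode.free b : Mode K).credit : ℝ) ≤ 3 := by
          exact_mod_cast credit_le (Mode.free b : Mode K)
        rw [hcr]
        split_ifs with he <;> linarith
      have hc : A.increases x τ i t ≤ A.increases x τ i (t + 1) := by
        unfold Setup.increases
        rw [if_pos ep', h.index_succ]
        split_ifs with he
        · rw [Setup.index, if_neg]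
          exact fun hn => hn (hep.trans he.symm)
        · omega
      have h1 := pow_le_pow_right₀ hB hc
      have h2 : 1 ≤ B ^ A.increases x τ i (t + 1) := one_le_pow₀ hB
      have h3 := mul_le_mul_of_nonneg_left h1 hm
      nlinarith
    · have ep' : (A.state x (t + 1)).epoch = (A.state x t).epoch := h.epoch_succ
      obtain ⟨v, hv⟩ := h.mode
      rw [hv] at ih
      have hc : A.increases x τ i (t + 1) = A.increases x τ i t := by
        unfold Setup.increases
        rw [ep', h.index_succ]
      have hd : A.decreases x τ (t + 1) = A.decreases x τ t := by
        unfold Setup.decreases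
        rw [ep', h.mode_succ, hv, hcast]
        simp only [Mode.credit]
        push_cast
        ring
      rw [h.mass, h.mode_succ, hc, hd]
      simp only [Mode.pending, pow_zero, mul_one] at ih ⊢
      rw [hBd]
      have hB0 : 0 < B := by linarith
      split_ifs at ih ⊢ with hi
      · rw [pow_one] at ih
        rw [div_mul_eq_mul_div, le_div_iff₀ hB0]
        exact ih
      · simpa using ih
    · have ep' : (A.state x (t + 1)).epoch = (A.state x t).epoch := h.epoch_succ
      rw [h.mode] at ih
      have hc : A.increases x τ i (t + 1) = A.increases x τ i t := by
        unfold Setup.increases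
        rw [ep', h.index_succ]
      have hd : A.decreases x τ (t + 1) = A.decreases x τ t := by
        unfold Setup.decreases
        rw [ep', h.mode_succ, h.mode, hcast]
        simp only [Mode.credit]
        push_cast
        ring
      rw [A.mass_same x i h.η_succ, h.mode_succ, hc, hd]
      simp only [Mode.pending, pow_zero, mul_one] at ih ⊢
      exact ih

/-! ### Long horizons -/

/-- The horizon is long, and `Z` bounds `∑ᵢ √wᵢ / ηᵢ` on the simplex. -/
structure Setup.Large (A : Setup K k) (Z : ℝ) : Prop where
  η_pos : ∀ i, 0 < A.η i
  log_ge : 1000 ≤ Real.log A.T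
  card_mul_le : (K : ℝ) * Real.log A.T ^ 2 ≤ A.T
  init_lt : A.initLen < A.T
  card_pos : 0 < K
  sum_div_le : ∀ w ∈ stdSimplex ℝ (Fin K), ∑ i, √(w i) / A.η i ≤ Z

/-- The losses up to the horizon are in `[0, 1]`. -/
def Setup.LossBounded (A : Setup K k) (x : Path K k) : Prop :=
  ∀ t < A.T, ∀ i j, x.loss t i j ∈ Set.Icc (0 : ℝ) 1

section Large

variable {A : Setup K k} {Z : ℝ}

lemma Setup.Large.horizon_ge (hA : A.Large Z) : (1000 : ℝ) ≤ A.T := by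
  have h := hA.log_ge
  have := Real.log_le_self (Nat.cast_nonneg A.T : (0 : ℝ) ≤ A.T)
  linarith

lemma Setup.Large.exp_log (hA : A.Large Z) : Real.exp (Real.log A.T) = A.T :=
  Real.exp_log (by have := hA.horizon_ge; linarith)

lemma Setup.Large.one_le_card (hA : A.Large Z) : (1 : ℝ) ≤ K := by
  exact_mod_cast hA.card_pos

lemma Setup.Large.card_le (hA : A.Large Z) : (K : ℝ) ≤ A.T := by
  have h1 := hA.log_ge
  have h2 := hA.card_mul_le
  have h3 := hA.one_le_card
  nlinarith [mul_le_mul_of_nonneg_left (show (1 : ℝ) ≤ Real.log A.T ^ 2 by nlinarith)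
    (show (0 : ℝ) ≤ K by linarith)]

lemma Setup.Large.le_initLen (hA : A.Large Z) : (1000 : ℝ) ≤ A.initLen := by
  have h1 := hA.log_ge
  have h2 := Nat.le_ceil (Real.log A.T)
  have h3 := hA.one_le_card
  unfold Setup.initLen
  push_cast
  nlinarith

/-- `2 ^ (3 log T) ≥ T² ≥ K T`, because `3 log 2 > 2`. -/
lemma Setup.Large.top_le (hA : A.Large Z) : (A.top : ℝ) ≤ 3 * Real.log A.T + 1 := by
  have h1 := hA.log_ge
  have h2 : A.top ≤ ⌈3 * Real.log A.T⌉₊ := by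
    refine Nat.sInf_le ?_
    simp only [Set.mem_ofPred_eq]
    have h3 : (K : ℝ) * A.T ≤ A.T * A.T :=
      mul_le_mul_of_nonneg_right hA.card_le (Nat.cast_nonneg _)
    have h4 : (A.T : ℝ) * A.T ≤ 2 ^ ⌈3 * Real.log A.T⌉₊ := by
      have h5 : (2 : ℝ) ^ ⌈3 * Real.log A.T⌉₊
          = Real.exp (⌈3 * Real.log A.T⌉₊ * Real.log 2) := by
        rw [Real.exp_nat_mul, Real.exp_log (by norm_num)]
      have h6 : (A.T : ℝ) * A.T = Real.exp (2 * Real.log A.T) := by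
        rw [two_mul, Real.exp_add, hA.exp_log]
      rw [h5, h6, Real.exp_le_exp]
      have h7 := Nat.le_ceil (3 * Real.log A.T)
      have h8 := Real.log_two_gt_d9
      nlinarith
    have h9 := hA.horizon_ge
    unfold threshold
    nlinarith
  have h3 : (⌈3 * Real.log A.T⌉₊ : ℝ) < 3 * Real.log A.T + 1 :=
    Nat.ceil_lt_add_one (by linarith)
  have h4 : (A.top : ℝ) ≤ ⌈3 * Real.log A.T⌉₊ := by exact_mod_cast h2
  linarith

lemma exp_le_one_div_one_sub {y : ℝ} (hy : y < 1) : Real.exp y ≤ 1 / (1 - y) := by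
  have h1 := Real.add_one_le_exp (-y)
  rw [Real.exp_neg] at h1
  rw [le_div_iff₀ (by linarith)]
  have h2 := Real.exp_pos y
  calc Real.exp y * (1 - y) ≤ Real.exp y * (Real.exp y)⁻¹ :=
        mul_le_mul_of_nonneg_left (by linarith) h2.le
    _ = 1 := mul_inv_cancel₀ h2.ne'

/-- The exponent is about `6 log T / log² T` with `log T ≥ 1000`: all increases of one epoch
together change the square of a step size by at most one percent. -/
lemma Setup.Large.beta_pow_le (hA : A.Large Z) : (beta A.T ^ 2) ^ (A.top + 1) ≤ 1.01 := by
  have h1 := hA.log_ge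
  have h2 := hA.top_le
  have h3 : (beta A.T ^ 2) ^ (A.top + 1)
      = Real.exp ((2 * (A.top + 1 : ℕ) : ℝ) * (1 / Real.log A.T ^ 2)) := by
    unfold beta
    rw [← pow_mul, ← Real.exp_nat_mul]
    push_cast
    rfl
  have h4 : (2 * (A.top + 1 : ℕ) : ℝ) * (1 / Real.log A.T ^ 2) ≤ 0.009 := by
    rw [mul_one_div, div_le_iff₀ (by positivity)]
    push_cast
    nlinarith
  rw [h3]
  refine (exp_le_one_div_one_sub (by linarith)).trans ?_
  rw [div_le_iff₀ (by linarith)]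
  linarith

lemma Setup.Large.beta_le (hA : A.Large Z) : beta A.T ≤ 1.01 := by
  have h1 := one_le_beta A.T
  have h2 := hA.beta_pow_le
  have h3 : beta A.T ^ 1 ≤ beta A.T ^ (2 * (A.top + 1)) :=
    pow_le_pow_right₀ h1 (by omega)
  rw [pow_mul, pow_one] at h3
  linarith

lemma rate_le (T : ℕ) : 1 - 1 / beta T ≤ 1 / Real.log T ^ 2 := by
  have h1 := Real.add_one_le_exp (-(1 / Real.log T ^ 2))
  rw [Real.exp_neg] at h1
  unfold beta
  rw [one_div (Real.exp _)]
  linarith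

lemma rate_nonneg (T : ℕ) : 0 ≤ 1 - 1 / beta T := by
  have h1 := one_le_beta T
  have : 1 / beta T ≤ 1 := by
    rw [div_le_one (by linarith)]
    exact h1
  linarith

/-- The length of epoch `τ`. -/
noncomputable def Setup.len (A : Setup K k) (τ : ℕ) : ℝ := 2 ^ τ * A.initLen

lemma Setup.start_succ_eq (A : Setup K k) (τ : ℕ) :
    (A.start (τ + 1) : ℝ) = A.start τ + A.len τ := by
  rw [A.start_succ]
  unfold Setup.len
  push_cast
  rfl

lemma Setup.len_eq (A : Setup K k) (τ : ℕ) : A.len τ = A.start τ + A.initLen := by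
  have h : ((A.start τ + A.initLen : ℕ) : ℝ) = ((2 ^ τ * A.initLen : ℕ) : ℝ) := by
    rw [A.start_add]
  push_cast at h
  unfold Setup.len
  linarith

lemma Setup.len_succ (A : Setup K k) (τ : ℕ) : A.len (τ + 1) = 2 * A.len τ := by
  unfold Setup.len
  rw [pow_succ]
  ring

lemma Setup.Large.len_ge (hA : A.Large Z) {τ : ℕ} (hτ : 1 ≤ τ) : 2000 ≤ A.len τ := by
  have h1 := hA.le_initLen
  have h2 : (A.initLen : ℝ) ≤ A.start τ := by exact_mod_cast A.initLen_le_start hτ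
  rw [A.len_eq]
  linarith

/-- The `9` collects the three offsets of `decreases`; `9 / 4 ≤ g` keeps the left side of
`mass_lower_aux` nonnegative, so that its pending factor can be dropped. -/
lemma Setup.Large.mass_lower_of (hA : A.Large Z) (x : Path K k) (i : Fin K) {τ : ℕ} (hτ : 1 ≤ τ)
    {g : ℝ} (hg : 9 / 4 ≤ g) (hg' : g ≤ A.mass x i (A.start τ)) {t : ℕ} (ht : A.start τ ≤ t)
    (ht' : t ≤ A.start (τ + 1)) :
    g + ((t : ℝ) - A.start τ - 9) / 4 ≤ 1.01 * A.mass x i t := by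
  have h1 := A.mass_lower_aux hA.η_pos x i hτ (by linarith) hg' ht ht'
  have hB : 1 ≤ beta A.T ^ 2 := one_le_pow₀ (one_le_beta A.T)
  have h2 : A.increases x τ i t ≤ A.top + 1 := by
    unfold Setup.increases
    have := A.θ_le x t i
    split_ifs <;> omega
  have h3 := (pow_le_pow_right₀ hB h2).trans hA.beta_pow_le
  have h4 : 1 ≤ (beta A.T ^ 2) ^ ((A.state x t).mode.pending i) := one_le_pow₀ hB
  have h5 : (t : ℝ) - A.start τ - 9 ≤ A.decreases x τ t := by
    unfold Setup.decreases
    have : ((A.state x t).mode.credit : ℝ) ≤ 3 := by exact_mod_cast credit_le _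
    split_ifs <;> linarith
  have h6 : (A.start τ : ℝ) ≤ t := by exact_mod_cast ht
  have h7 := A.mass_nonneg x i t
  have h8 : 0 ≤ g + A.decreases x τ t / 4 := by linarith
  nlinarith

/-- The constant `0.24` reproduces itself: an epoch of length `ℓ` adds nearly `ℓ/4`, and `0.49 ℓ -
9/4` still exceeds `1.01 * 0.48 ℓ`, where `2 ℓ` is the next length. -/
lemma Setup.Large.mass_start (hA : A.Large Z) (x : Path K k) (i : Fin K) {τ : ℕ} (hτ : 1 ≤ τ) :
    0.24 * A.len τ ≤ A.mass x i (A.start τ) := by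
  induction τ, hτ using Nat.le_induction with
  | base =>
    rw [A.start_one, A.mass_init hA.η_pos x i le_rfl, Setup.len]
    have := hA.le_initLen
    linarith
  | succ τ hτ ih =>
    have h1 := hA.len_ge hτ
    have h2 := hA.mass_lower_of x i hτ (by linarith) ih (A.start_mono (Nat.le_succ τ)) le_rfl
    rw [A.start_succ_eq] at h2
    rw [A.len_succ]
    linarith

/-- `0.2209 = 0.47²`, which makes `0.47` the constant in `le_inv_η`. -/
lemma Setup.Large.mass_ge (hA : A.Large Z) (x : Path K k) (i : Fin K) {τ : ℕ} (hτ : 1 ≤ τ)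
    {t : ℕ} (ht : A.start τ ≤ t) (ht' : t ≤ A.start (τ + 1)) :
    0.2209 * A.len τ ≤ A.mass x i t := by
  have h1 := hA.len_ge hτ
  have h2 := hA.mass_lower_of x i hτ (by linarith) (hA.mass_start x i hτ) ht ht'
  have h6 : (A.start τ : ℝ) ≤ t := by exact_mod_cast ht
  linarith

lemma Setup.inv_η_eq (A : Setup K k) (hη : ∀ i, 0 < A.η i) (x : Path K k) (i : Fin K) (t : ℕ) :
    1 / (A.state x t).η i = √(A.mass x i t) / A.η i := by
  have h1 := hη i
  have h2 := A.η_pos x hη t i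
  unfold Setup.mass
  rw [Real.sqrt_sq (by positivity)]
  field_simp

lemma Setup.inv_η_le (A : Setup K k) (hη : ∀ i, 0 < A.η i) (x : Path K k) (i : Fin K) (t : ℕ) :
    1 / (A.state x t).η i ≤ √(t + 1) / A.η i := by
  rw [A.inv_η_eq hη]
  have := hη i
  have := A.mass_le hη x i t
  gcongr

lemma Setup.Large.le_inv_η (hA : A.Large Z) (x : Path K k) (i : Fin K) {τ : ℕ} (hτ : 1 ≤ τ)
    {t : ℕ} (ht : A.start τ ≤ t) (ht' : t ≤ A.start (τ + 1)) :
    0.47 * √(A.len τ) / A.η i ≤ 1 / (A.state x t).η i := by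
  rw [A.inv_η_eq hA.η_pos]
  have h1 := hA.η_pos i
  have h2 := hA.mass_ge x i hτ ht ht'
  have h3 : 0.47 * √(A.len τ) ≤ √(A.mass x i t) := by
    refine Real.le_sqrt_of_sq_le ?_
    have := hA.len_ge hτ
    rw [mul_pow, Real.sq_sqrt (by linarith)]
    linarith
  gcongr

/-- `t + 1` is at most twice the length of its epoch, and `16 * 0.2209 ≥ 2`. -/
lemma Setup.Large.η_le (hA : A.Large Z) (x : Path K k) (i : Fin K) {t : ℕ} (ht : A.initLen ≤ t) :
    (A.state x t).η i ≤ 4 * A.η i / √(t + 1) := by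
  have hK := hA.card_pos
  have h0 := (A.epochOf_eq_iff hK (t := t)).1 rfl
  have hτ := A.one_le_epochOf hK ht
  have h1 := hA.mass_ge x i hτ h0.1 h0.2.le
  have h2 := A.η_pos x hA.η_pos t i
  have h3 := hA.η_pos i
  have h4 : (t : ℝ) + 1 ≤ A.start (A.epochOf t + 1) := by exact_mod_cast h0.2
  rw [A.start_succ_eq] at h4
  have h5 := A.len_eq (A.epochOf t)
  have h6 : (0 : ℝ) ≤ A.initLen := Nat.cast_nonneg _
  have h7 : √((t : ℝ) + 1) ≤ 4 * √(A.mass x i t) := by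
    refine Real.sqrt_le_iff.2 ⟨by positivity, ?_⟩
    rw [mul_pow, Real.sq_sqrt (A.mass_nonneg x i t)]
    linarith
  have h8 : √(A.mass x i t) = A.η i / (A.state x t).η i := by
    unfold Setup.mass
    rw [Real.sqrt_sq (by positivity)]
  rw [h8] at h7
  have h9 : 0 < √((t : ℝ) + 1) := Real.sqrt_pos.2 (by positivity)
  rw [le_div_iff₀ h9]
  calc (A.state x t).η i * √((t : ℝ) + 1)
      ≤ (A.state x t).η i * (4 * (A.η i / (A.state x t).η i)) :=
        mul_le_mul_of_nonneg_left h7 h2.le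
    _ = 4 * A.η i := by field_simp

lemma Setup.Large.inv_η_le_Z (hA : A.Large Z) (i : Fin K) : 1 / A.η i ≤ Z := by
  have h := hA.sum_div_le _ (single_mem_stdSimplex ℝ i)
  rw [Finset.sum_eq_single i] at h
  · simpa using h
  · intro b _ hb
    simp [Pi.single_eq_of_ne hb]
  · simp

lemma Setup.Large.Z_nonneg (hA : A.Large Z) : 0 ≤ Z := by
  have h1 := hA.inv_η_le_Z ⟨0, hA.card_pos⟩
  have h2 := hA.η_pos ⟨0, hA.card_pos⟩
  exact (by positivity : (0 : ℝ) ≤ 1 / A.η ⟨0, hA.card_pos⟩).trans h1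

lemma Setup.Large.sum_inv_η_le (hA : A.Large Z) (x : Path K k) (t : ℕ) {w : Fin K → ℝ}
    (hw : w ∈ stdSimplex ℝ (Fin K)) :
    ∑ i, 1 / (A.state x t).η i * √(w i) ≤ √(t + 1) * Z := by
  refine le_trans ?_ (mul_le_mul_of_nonneg_left (hA.sum_div_le w hw) (Real.sqrt_nonneg _))
  rw [Finset.mul_sum]
  refine Finset.sum_le_sum fun i _ => ?_
  have h1 := A.inv_η_le hA.η_pos x i t
  calc 1 / (A.state x t).η i * √(w i) ≤ √(t + 1) / A.η i * √(w i) :=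
        mul_le_mul_of_nonneg_right h1 (Real.sqrt_nonneg _)
    _ = _ := by ring

end Large

/-! ### The loss estimates -/

section Estimates

variable {A : Setup K k} {Z : ℝ} {x : Path K k}

lemma Setup.rescaledLoss_eq (A : Setup K k) (x : Path K k) (t : ℕ) (i : Fin K) :
    A.rescaledLoss x t i
      = if i = x.sel t then x.loss t i (A.action x t i) / A.prob x t i else 0 := rfl

lemma Setup.Large.mix_le (hA : A.Large Z) : 1 / ((A.T : ℝ) * K) ≤ 0.001 := by
  have h1 := hA.horizon_ge
  have h2 := hA.one_le_card
  rw [div_le_iff₀ (by nlinarith)]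
  nlinarith

lemma Setup.Large.le_prob (hA : A.Large Z) {t : ℕ} (ht : A.initLen ≤ t) (i : Fin K) :
    0.999 * (A.state x t).w i ≤ A.prob x t i := by
  have h1 := hA.mix_le
  have h2 := hA.one_le_card
  have h3 := ((A.isStat x hA.η_pos hA.card_pos ht).1 i).le
  unfold Setup.prob Setup.mixed
  have h4 : (0 : ℝ) ≤ 1 / ((A.T : ℝ) * K) * (1 / (K : ℝ)) := by positivity
  nlinarith

lemma Setup.Large.prob_pos (hA : A.Large Z) {t : ℕ} (ht : A.initLen ≤ t) (i : Fin K) :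
    0 < A.prob x t i := by
  have h1 := hA.le_prob (x := x) ht i
  have h2 := (A.isStat x hA.η_pos hA.card_pos ht).1 i
  linarith

lemma Setup.Large.min_le_prob (hA : A.Large Z) {t : ℕ} (ht : A.initLen ≤ t) (i : Fin K) :
    1 / ((A.T : ℝ) * K) * (1 / (K : ℝ)) ≤ A.prob x t i := by
  have h1 := hA.mix_le
  have h3 := ((A.isStat x hA.η_pos hA.card_pos ht).1 i).le
  unfold Setup.prob Setup.mixed
  nlinarith

lemma Setup.Large.prob_mem (hA : A.Large Z) {t : ℕ} (ht : A.initLen ≤ t) :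
    A.prob x t ∈ stdSimplex ℝ (Fin K) := by
  refine ⟨fun i => (hA.prob_pos ht i).le, ?_⟩
  have h2 : (K : ℝ) ≠ 0 := by have := hA.one_le_card; positivity
  unfold Setup.prob Setup.mixed
  rw [Finset.sum_add_distrib, ← Finset.mul_sum, (A.isStat x hA.η_pos hA.card_pos ht).2.1,
    Finset.sum_const, Finset.card_univ, Fintype.card_fin, nsmul_eq_mul]
  field_simp
  ring

lemma Setup.Large.rescaledLoss_nonneg (hA : A.Large Z) (hx : A.LossBounded x) {t : ℕ}
    (ht : A.initLen ≤ t) (htT : t < A.T) (i : Fin K) : 0 ≤ A.rescaledLoss x t i := by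
  rw [A.rescaledLoss_eq]
  split_ifs
  · exact div_nonneg (hx t htT _ _).1 (hA.prob_pos ht i).le
  · rfl

lemma Setup.Large.rescaledLoss_le (hA : A.Large Z) (hx : A.LossBounded x) {t : ℕ}
    (ht : A.initLen ≤ t) (htT : t < A.T) (i : Fin K) :
    A.rescaledLoss x t i ≤ if x.sel t = i then 1 / A.prob x t i else 0 := by
  rw [A.rescaledLoss_eq]
  by_cases h : i = x.sel t
  · rw [if_pos h, if_pos h.symm]
    exact div_le_div_of_nonneg_right (hx t htT _ _).2 (hA.prob_pos ht i).le
  · rw [if_neg h, if_neg (fun h' => h h'.symm)]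

lemma Setup.Large.sum_rescaledLoss_mul_prob (hA : A.Large Z) {t : ℕ}
    (ht : A.initLen ≤ t) :
    ∑ i, A.rescaledLoss x t i * A.prob x t i
      = x.loss t (x.sel t) (A.action x t (x.sel t)) := by
  rw [Finset.sum_eq_single (x.sel t)]
  · rw [A.rescaledLoss_eq, if_pos rfl, div_mul_cancel₀ _ (hA.prob_pos ht _).ne']
  · intro b _ hb
    rw [A.rescaledLoss_eq, if_neg hb, zero_mul]
  · simp

lemma Setup.Large.inner_nonneg (hA : A.Large Z) (hx : A.LossBounded x) {t : ℕ}
    (ht : A.initLen ≤ t) (htT : t < A.T) :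
    0 ≤ ∑ i, A.rescaledLoss x t i * (A.state x t).w i :=
  Finset.sum_nonneg fun i _ => mul_nonneg (hA.rescaledLoss_nonneg hx ht htT i)
    ((A.isStat x hA.η_pos hA.card_pos ht).1 i).le

lemma Setup.Large.inner_le (hA : A.Large Z) (hx : A.LossBounded x) {t : ℕ}
    (ht : A.initLen ≤ t) (htT : t < A.T) :
    ∑ i, A.rescaledLoss x t i * (A.state x t).w i ≤ 2 := by
  have h1 : ∑ i, A.rescaledLoss x t i * (A.state x t).w i
      ≤ 2 * ∑ i, A.rescaledLoss x t i * A.prob x t i := by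
    rw [Finset.mul_sum]
    refine Finset.sum_le_sum fun i _ => ?_
    have h2 := hA.rescaledLoss_nonneg hx ht htT i
    have h3 := hA.le_prob (x := x) ht i
    have h4 := (A.isStat x hA.η_pos hA.card_pos ht).1 i
    nlinarith
  rw [hA.sum_rescaledLoss_mul_prob ht] at h1
  have := (hx t htT (x.sel t) (A.action x t (x.sel t))).2
  linarith

/-- The incurred loss is exactly the estimate paired with the mixed distribution; replacing that
distribution by `w` costs its uniform part. -/
lemma Setup.Large.loss_le (hA : A.Large Z) (hx : A.LossBounded x) {t : ℕ}
    (ht : A.initLen ≤ t) (htT : t < A.T) :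
    x.loss t (x.sel t) (A.action x t (x.sel t))
      ≤ ∑ i, A.rescaledLoss x t i * (A.state x t).w i
        + 1 / ((A.T : ℝ) * K) * (1 / (K : ℝ))
          * ∑ i, if x.sel t = i then 1 / A.prob x t i else 0 := by
  rw [← hA.sum_rescaledLoss_mul_prob ht, Finset.mul_sum, ← Finset.sum_add_distrib]
  refine Finset.sum_le_sum fun i _ => ?_
  have h2 := hA.rescaledLoss_nonneg hx ht htT i
  have h3 := hA.rescaledLoss_le hx ht htT i
  have h4 := (A.isStat x hA.η_pos hA.card_pos ht).1 i
  have h5 : (0 : ℝ) ≤ 1 / ((A.T : ℝ) * K) * (1 / (K : ℝ)) := by positivity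
  have h6 : A.prob x t i ≤ (A.state x t).w i + 1 / ((A.T : ℝ) * K) * (1 / (K : ℝ)) := by
    unfold Setup.prob Setup.mixed
    have : (0 : ℝ) ≤ 1 / ((A.T : ℝ) * K) := by positivity
    nlinarith
  calc A.rescaledLoss x t i * A.prob x t i
      ≤ A.rescaledLoss x t i * ((A.state x t).w i + 1 / ((A.T : ℝ) * K) * (1 / (K : ℝ))) :=
        mul_le_mul_of_nonneg_left h6 h2
    _ = A.rescaledLoss x t i * (A.state x t).w i
        + 1 / ((A.T : ℝ) * K) * (1 / (K : ℝ)) * A.rescaledLoss x t i := by ring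
    _ ≤ _ := by gcongr

/-- The sum of the stability and penalty terms of round `t`. -/
noncomputable def Setup.noise (A : Setup K k) (x : Path K k) (Z : ℝ) (t : ℕ) : ℝ :=
  (6 * (∑ i, A.η i * if x.sel t = i then 1 / √(A.prob x t i) else 0) + 16 * Z) / √(t + 1)

lemma Setup.Large.noise_nonneg (hA : A.Large Z) (x : Path K k) (t : ℕ) : 0 ≤ A.noise x Z t := by
  unfold Setup.noise
  have := hA.Z_nonneg
  have h : 0 ≤ ∑ i, A.η i * if x.sel t = i then 1 / √(A.prob x t i) else 0 :=
    Finset.sum_nonneg fun i _ => mul_nonneg (hA.η_pos i).le (by split_ifs <;> positivity)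
  positivity

lemma Setup.Large.stability_le (hA : A.Large Z) (hx : A.LossBounded x) {t : ℕ}
    (ht : A.initLen ≤ t) (htT : t < A.T) {η : Fin K → ℝ}
    (hη : ∀ i, η i ≤ 4 * A.η i / √(t + 1)) :
    A.stability x t η
      ≤ 6 * (∑ i, A.η i * if x.sel t = i then 1 / √(A.prob x t i) else 0) / √(t + 1) := by
  unfold Setup.stability
  rw [Finset.mul_sum, mul_div_assoc, Finset.sum_div, Finset.mul_sum]
  refine Finset.sum_le_sum fun i _ => ?_
  have hp := hA.prob_pos (x := x) ht i
  have hw := (A.isStat x hA.η_pos hA.card_pos ht).1 i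
  have hwp := hA.le_prob (x := x) ht i
  have he := hA.rescaledLoss_le hx ht htT i
  have he0 := hA.rescaledLoss_nonneg hx ht htT i
  have hs : 0 < √((t : ℝ) + 1) := Real.sqrt_pos.2 (by positivity)
  have hηi := hη i
  have hη1 := hA.η_pos i
  by_cases h : x.sel t = i
  · rw [if_pos h] at he ⊢
    -- `w √w ≤ 3 p √p` for the sampling probability `p`. Against the squared importance weight
    -- `1/p²` this leaves `1/√p`, whose contribution after sampling is `√p`.
    have h1 : (A.state x t).w i * √((A.state x t).w i) ≤ 3 * (A.prob x t i * √(A.prob x t i)) := by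
      have h2 : √((A.state x t).w i) ≤ 1.5 * √(A.prob x t i) := by
        refine Real.sqrt_le_iff.2 ⟨by positivity, ?_⟩
        rw [mul_pow, Real.sq_sqrt hp.le]
        linarith
      calc (A.state x t).w i * √((A.state x t).w i)
          ≤ (2 * A.prob x t i) * (1.5 * √(A.prob x t i)) :=
            mul_le_mul (by linarith) h2 (Real.sqrt_nonneg _) (by positivity)
        _ = _ := by ring
    have h3 : A.rescaledLoss x t i ^ 2 ≤ (1 / A.prob x t i) ^ 2 := pow_le_pow_left₀ he0 he 2
    have h4 : A.rescaledLoss x t i ^ 2 * ((A.state x t).w i * √((A.state x t).w i))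
        ≤ 3 * (1 / √(A.prob x t i)) := by
      calc _ ≤ (1 / A.prob x t i) ^ 2 * (3 * (A.prob x t i * √(A.prob x t i))) :=
            mul_le_mul h3 h1 (by positivity) (by positivity)
        _ = 3 * (1 / √(A.prob x t i)) := by
          have h5 : 0 < √(A.prob x t i) := Real.sqrt_pos.2 hp
          have h6 : A.prob x t i = √(A.prob x t i) ^ 2 := (Real.sq_sqrt hp.le).symm
          generalize √(A.prob x t i) = r at h5 h6
          rw [h6]
          field_simp
    calc 1 / 2 * (η i * A.rescaledLoss x t i ^ 2 * ((A.state x t).w i * √((A.state x t).w i)))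
        = 1 / 2 * (η i * (A.rescaledLoss x t i ^ 2
            * ((A.state x t).w i * √((A.state x t).w i)))) := by ring
      _ ≤ 1 / 2 * (4 * A.η i / √(t + 1) * (3 * (1 / √(A.prob x t i)))) := by
          refine mul_le_mul_of_nonneg_left ?_ (by norm_num)
          exact mul_le_mul hηi h4 (by positivity) (by positivity)
      _ = _ := by ring
  · rw [if_neg h] at he ⊢
    have : A.rescaledLoss x t i = 0 := le_antisymm he he0
    rw [this]
    simp

/-- The regret inequality of a single round. -/
lemma Setup.Large.potential_succ_le (hA : A.Large Z) (hx : A.LossBounded x) (j : Fin K) {t : ℕ}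
    (ht : A.initLen ≤ t) (htT : t < A.T) :
    A.potential x j (t + 1) ≤ A.potential x j t - (1 - 1 / beta A.T) * A.gain x j t
      + A.rescaledLoss x t j - ∑ i, A.rescaledLoss x t i * (A.state x t).w i
      + A.noise x Z t := by
  obtain ⟨η, hη, h⟩ := A.potential_succ_le x hA.η_pos j ht (hA.rescaledLoss_nonneg hx ht htT)
  have hs : 0 < √((t : ℝ) + 1) := Real.sqrt_pos.2 (by positivity)
  have hss : √((t : ℝ) + 1) ≤ √(((t + 1 : ℕ) : ℝ) + 1) := by
    refine Real.sqrt_le_sqrt ?_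
    push_cast
    linarith
  have hη' : ∀ i, (A.state x (t + 1)).η i ≤ 4 * A.η i / √(t + 1) := by
    intro i
    refine (hA.η_le x i (t := t + 1) (by omega)).trans ?_
    have := hA.η_pos i
    exact div_le_div_of_nonneg_left (by positivity) hs hss
  have h1 : A.stability x t η
      ≤ 6 * (∑ i, A.η i * if x.sel t = i then 1 / √(A.prob x t i) else 0) / √(t + 1) := by
    refine hA.stability_le hx ht htT ?_
    rcases hη with rfl | rfl
    · exact fun i => hA.η_le x i ht
    · exact hη'
  have h2 : 4 * ∑ i, (A.state x (t + 1)).η i / A.η i ^ 2 * √((A.state x (t + 1)).w i)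
      ≤ 16 * Z / √(t + 1) := by
    have h3 := hA.sum_div_le _
      (A.isStat x hA.η_pos hA.card_pos (t := t + 1) (by omega)).mem_stdSimplex
    have h4 : ∑ i, (A.state x (t + 1)).η i / A.η i ^ 2 * √((A.state x (t + 1)).w i)
        ≤ 4 / √(t + 1) * ∑ i, √((A.state x (t + 1)).w i) / A.η i := by
      rw [Finset.mul_sum]
      refine Finset.sum_le_sum fun i _ => ?_
      have h5 := hA.η_pos i
      calc (A.state x (t + 1)).η i / A.η i ^ 2 * √((A.state x (t + 1)).w i)
          ≤ (4 * A.η i / √(t + 1)) / A.η i ^ 2 * √((A.state x (t + 1)).w i) := by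
            have := hη' i
            gcongr
        _ = _ := by field_simp
    have h6 : 4 / √((t : ℝ) + 1) * ∑ i, √((A.state x (t + 1)).w i) / A.η i
        ≤ 4 / √((t : ℝ) + 1) * Z := mul_le_mul_of_nonneg_left h3 (by positivity)
    calc _ ≤ 4 * (4 / √((t : ℝ) + 1) * Z) := by linarith
      _ = _ := by ring
  unfold Setup.noise
  rw [add_div]
  linarith

end Estimates

/-! ### Control of the potential by the negative regret of an epoch -/

/-- When the threshold index is positive, the preceding threshold has caused a negative-regret step
of the current epoch. -/
lemma Setup.exists_trigger (A : Setup K k) (x : Path K k) (j : Fin K) {t : ℕ}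
    (ht : A.initLen ≤ t) (hθ : 1 ≤ (A.state x t).θ j) :
    ∃ m b R, m < t ∧ A.initLen ≤ m ∧ A.epochOf m = (A.state x t).epoch ∧ A.Triggers x m b R ∧
      j ∈ R ∧ (A.state x m).w j ≤ 1 / threshold ((A.state x t).θ j - 1) := by
  induction t, ht using Nat.le_induction with
  | base =>
    rw [(A.init_phase x le_rfl).2.2] at hθ
    omega
  | succ t ht ih =>
    have old : ∀ (_ : (A.state x (t + 1)).θ j = (A.state x t).θ j)
        (_ : (A.state x (t + 1)).epoch = (A.state x t).epoch), ∃ m b R, m < t + 1 ∧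
        A.initLen ≤ m ∧ A.epochOf m = (A.state x (t + 1)).epoch ∧ A.Triggers x m b R ∧
        j ∈ R ∧ (A.state x m).w j ≤ 1 / threshold ((A.state x (t + 1)).θ j - 1) := by
      intro h1 h2
      rw [h1] at hθ
      obtain ⟨m, b, R, hm, hm'⟩ := ih hθ
      rw [h1, h2]
      exact ⟨m, b, R, by omega, hm'⟩
    have first : A.IsNew x t → 1 ≤ A.index x t j → A.Below x t j 0 ∧
        (A.state x t).w j ≤ 1 / threshold (A.index x t j - 1) := by
      intro hn h1
      rw [Setup.index, if_pos hn] at h1 ⊢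
      exact ⟨A.below_of_lt_thresholdIndex (by omega),
        (A.below_of_lt_thresholdIndex (s := A.thresholdIndex ((A.state x t).w j) - 1)
          (by omega)).2⟩
    rcases A.round_cases x ht with ⟨b, R, h⟩ | ⟨b, h⟩ | ⟨R, h⟩ | h
    · rcases h.control with ⟨hn, hR, hθ'⟩ | ⟨hb, hR, hf, hθ'⟩
      · rw [hθ'] at hθ ⊢
        obtain ⟨h1, h2⟩ := first hn hθ
        exact ⟨t, b, R, by omega, ht, h.epoch_succ.symm, h, (hR j).2 h1, h2⟩
      · by_cases hj : j ∈ R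
        · have h1 : (A.state x (t + 1)).θ j = A.index x t j + 1 := by rw [hθ', if_pos hj]
          rw [h1, Nat.add_sub_cancel]
          exact ⟨t, b, R, by omega, ht, h.epoch_succ.symm, h, hj, ((hR j).1 hj).2⟩
        · have h1 : (A.state x (t + 1)).θ j = A.index x t j := by rw [hθ', if_neg hj]
          by_cases hn : A.IsNew x t
          · rw [h1] at hθ
            exact absurd (first hn hθ).1 (hf hn j)
          · refine old ?_ ?_
            · rw [h1, Setup.index, if_neg hn]
            · rw [h.epoch_succ]
              exact not_not.1 hn
    · by_cases hn : A.IsNew x t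
      · rw [h.index_succ] at hθ
        exact absurd (first hn hθ).1 (h.not_first hn j)
      · refine old ?_ ?_
        · rw [h.index_succ, Setup.index, if_neg hn]
        · rw [h.epoch_succ]
          exact not_not.1 hn
    · exact old (by rw [h.index_succ]) h.epoch_succ
    · exact old (by rw [h.index_succ]) h.epoch_succ

section Control

variable {A : Setup K k} {Z : ℝ} {x : Path K k}

lemma Setup.Large.one_le_sqrt_horizon (hA : A.Large Z) : 1 ≤ √(A.T : ℝ) := by
  have := hA.horizon_ge
  exact Real.one_le_sqrt.2 (by linarith)

lemma Setup.Large.Z_le (hA : A.Large Z) : Z ≤ √(A.T : ℝ) * Z :=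
  le_mul_of_one_le_left hA.Z_nonneg hA.one_le_sqrt_horizon

lemma Setup.Large.sqrt_succ_le (hA : A.Large Z) {t : ℕ} (ht : t ≤ A.T) :
    √((t : ℝ) + 1) ≤ 1.5 * √(A.T : ℝ) := by
  have h1 := hA.horizon_ge
  have h2 : (t : ℝ) ≤ A.T := by exact_mod_cast ht
  refine Real.sqrt_le_iff.2 ⟨by positivity, ?_⟩
  rw [mul_pow, Real.sq_sqrt (by linarith)]
  linarith

lemma Setup.Large.inv_η_le_U (hA : A.Large Z) (j : Fin K) {t : ℕ} (ht : t ≤ A.T) :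
    1 / (A.state x t).η j ≤ 1.5 * (√(A.T : ℝ) * Z) := by
  refine (A.inv_η_le hA.η_pos x j t).trans ?_
  rw [div_eq_mul_one_div, ← mul_assoc]
  have h1 := hA.η_pos j
  exact mul_le_mul (hA.sqrt_succ_le ht) (hA.inv_η_le_Z j) (by positivity) (by positivity)

lemma Setup.Large.potential_le (hA : A.Large Z) (j : Fin K) {t : ℕ}
    (ht : A.initLen ≤ t) (htT : t ≤ A.T) :
    A.potential x j t
      ≤ vertexGap ((A.state x t).η j) ((A.state x t).w j) + 3 * (√(A.T : ℝ) * Z) := by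
  have hst := A.isStat x hA.η_pos hA.card_pos ht
  have h1 := bregman_le_vertexGap (A.η_pos x hA.η_pos t) hst.1 j
  have h2 := hA.sum_inv_η_le x t hst.mem_stdSimplex
  have h3 := mul_le_mul_of_nonneg_right (hA.sqrt_succ_le htT) hA.Z_nonneg
  unfold Setup.potential
  linarith

lemma Setup.Large.potential_le' (hA : A.Large Z) (j : Fin K) {t : ℕ}
    (ht : A.initLen ≤ t) (htT : t ≤ A.T) :
    A.potential x j t ≤ 1 / (A.state x t).η j * (2 * (1 / √((A.state x t).w j)))
      + 3 * (√(A.T : ℝ) * Z) := by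
  have hst := A.isStat x hA.η_pos hA.card_pos ht
  have h1 := vertexGap_le (A.η_pos x hA.η_pos t j) (hst.1 j)
    (le_one_of_mem_stdSimplex hst.mem_stdSimplex j)
  have h2 := hA.potential_le (x := x) j ht htT
  linarith

lemma Setup.Large.le_potential (hA : A.Large Z) (j : Fin K) {t : ℕ}
    (ht : A.initLen ≤ t) (htT : t ≤ A.T) :
    1 / (A.state x t).η j * (1 / √((A.state x t).w j))
      ≤ A.potential x j t / 2 + 3 * (√(A.T : ℝ) * Z) := by
  have hst := A.isStat x hA.η_pos hA.card_pos ht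
  have hpos := A.η_pos x hA.η_pos t
  have h1 := le_vertexGap (hpos j) (hst.1 j)
  have h2 := vertexGap_le_bregman hpos hst.1 j
  have h3 := hA.inv_η_le_U (x := x) j htT
  unfold Setup.potential
  linarith

lemma Setup.Large.le_potential_succ (hA : A.Large Z) (hx : A.LossBounded x) {j : Fin K}
    (hj : A.η j ≤ 1) {t : ℕ} (ht : A.initLen ≤ t) (htT : t < A.T)
    (h : ∀ R, ¬ A.Rebases x t R) :
    A.potential x j t - 4 * (√(A.T : ℝ) * Z) ≤ A.potential x j (t + 1) := by
  have h1 := A.le_potential_succ x hA.η_pos j ht (hA.rescaledLoss_nonneg hx ht htT) h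
  have h2 := hA.inner_le hx ht htT
  have h3 := hA.inv_η_le_Z j
  have h4 := hA.Z_le
  have h5 : 1 ≤ 1 / A.η j := by
    rw [le_div_iff₀ (hA.η_pos j)]
    linarith
  have h6 : 2 / A.η j = 2 * (1 / A.η j) := by ring
  linarith

lemma Setup.Large.le_potential_succ_of_rebases (hA : A.Large Z) (hx : A.LossBounded x) {j : Fin K}
    (hj : A.η j ≤ 1) {t : ℕ} (ht : A.initLen ≤ t) (htT : t < A.T) {R : Finset (Fin K)}
    (h : A.Rebases x t R) :
    0.99 * A.potential x j t - 4 * (√(A.T : ℝ) * Z) ≤ A.potential x j (t + 1) := by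
  have h1 := A.le_potential_succ_of_rebases x hA.η_pos j ht (hA.rescaledLoss_nonneg hx ht htT) h
  have h2 := hA.inner_le hx ht htT
  have h3 := hA.inv_η_le_Z j
  have h4 := hA.Z_le
  have h5 : 1 ≤ 1 / A.η j := by
    rw [le_div_iff₀ (hA.η_pos j)]
    linarith
  have h6 : (0.99 : ℝ) ≤ 1 / beta A.T := by
    have := one_le_beta A.T
    rw [le_div_iff₀ (by linarith)]
    have := hA.beta_le
    linarith
  have h7 := mul_le_mul_of_nonneg_right h6 (A.potential_nonneg x hA.η_pos j ht)
  linarith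

/-- Round `m` is the first one from `t` on, before the horizon, in which a negative-regret step may
be triggered; up to then the potential has not dropped much. -/
structure Setup.NextDecision (A : Setup K k) (x : Path K k) (Z : ℝ) (j : Fin K) (c : ℝ)
    (n t m : ℕ) : Prop where
  le : t ≤ m
  le_add : m ≤ t + n
  le_horizon : m ≤ A.T
  no_trigger : ∀ r, t ≤ r → r < m → ∀ b R, ¬ A.Triggers x r b R
  decision : m = A.T ∨ ∃ b, (A.state x m).mode = Mode.free b ∧ (A.IsNew x m ∨ b = false)
  epoch : (A.state x m).epoch = (A.state x t).epoch
  potential : c * A.potential x j t - 4 * n * (√(A.T : ℝ) * Z) ≤ A.potential x j m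

/-- An ordinary round is barred from triggering only if it follows a negative-regret step and
notices no new epoch. It then decreases the step sizes, and the next round is free to trigger. -/
lemma Setup.Large.nextDecision_free (hA : A.Large Z) (hx : A.LossBounded x) {j : Fin K}
    (hj : A.η j ≤ 1) {t : ℕ} (ht : A.initLen ≤ t) (htT : t ≤ A.T) {b : Bool}
    (h : (A.state x t).mode = Mode.free b) : ∃ m, A.NextDecision x Z j 1 1 t m := by
  have hU : 0 ≤ √(A.T : ℝ) * Z := mul_nonneg (Real.sqrt_nonneg _) hA.Z_nonneg
  by_cases hd : t = A.T ∨ (A.IsNew x t ∨ b = false)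
  · refine ⟨t, le_rfl, by omega, htT, fun r h1 h2 => by omega, ?_, rfl, ?_⟩
    · rcases hd with hd | hd
      · exact Or.inl hd
      · exact Or.inr ⟨b, h, hd⟩
    · push_cast
      linarith
  · push Not at hd
    obtain ⟨h1, h2, h3⟩ := hd
    have hnt : ∀ b' R, ¬ A.Triggers x t b' R := by
      intro b' R hT
      have hb : b' = b := by
        have := hT.mode.symm.trans h
        injection this
      rcases hT.control with hc | hc
      · exact h2 hc.1
      · exact h3 (hb ▸ hc.1)
    rcases A.triggers_or_decays x ht h with ⟨R, hT⟩ | hD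
    · exact absurd hT (hnt b R)
    · refine ⟨t + 1, by omega, by omega, by omega, fun r h4 h5 => ?_, Or.inr ⟨false, hD.mode_succ,
        Or.inr rfl⟩, ?_, ?_⟩
      · have : r = t := by omega
        subst this
        exact hnt
      · rw [hD.epoch_succ]
        exact not_not.1 h2
      · have := hA.le_potential_succ hx hj ht (by omega) (fun R hR => by
          obtain ⟨v, hv⟩ := hR.mode
          rw [hv] at h
          cases h)
        push_cast
        linarith

lemma Setup.Large.nextDecision_second (hA : A.Large Z) (hx : A.LossBounded x) {j : Fin K}
    (hj : A.η j ≤ 1) {t : ℕ} (ht : A.initLen ≤ t) (htT : t ≤ A.T)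
    (h : (A.state x t).mode = Mode.nrsSecond) : ∃ m, A.NextDecision x Z j 1 2 t m := by
  have hU : 0 ≤ √(A.T : ℝ) * Z := mul_nonneg (Real.sqrt_nonneg _) hA.Z_nonneg
  rcases htT.eq_or_lt with heq | hlt
  · refine ⟨t, le_rfl, by omega, htT, fun r h1 h2 => by omega, Or.inl heq, rfl, ?_⟩
    push_cast
    linarith
  · have hC := A.closes_of_mode x ht h
    obtain ⟨m, hm⟩ := hA.nextDecision_free hx hj (t := t + 1) (by omega) (by omega) hC.mode_succ
    have h1 := hm.le
    have h2 := hm.le_add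
    refine ⟨m, by omega, by omega, hm.le_horizon, fun r h3 h4 b R hT => ?_, hm.decision,
      hm.epoch.trans hC.epoch_succ, ?_⟩
    · rcases h3.eq_or_lt with rfl | h3
      · have := hT.mode
        rw [h] at this
        cases this
      · exact hm.no_trigger r h3 h4 b R hT
    · have := hA.le_potential_succ hx hj ht hlt (fun R hR => by
        obtain ⟨v, hv⟩ := hR.mode
        rw [hv] at h
        cases h)
      have h5 := hm.potential
      push_cast at h5 ⊢
      linarith

/-- At worst two extra rounds and one barred ordinary round precede the decision. Each costs at most
`4 U`, and the increase of the step sizes costs the factor `0.99 ≤ 1/β`. -/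
lemma Setup.Large.exists_nextDecision (hA : A.Large Z) (hx : A.LossBounded x) {j : Fin K}
    (hj : A.η j ≤ 1) {t : ℕ} (ht : A.initLen ≤ t) (htT : t ≤ A.T) :
    ∃ m, A.NextDecision x Z j 0.99 3 t m := by
  have hU : 0 ≤ √(A.T : ℝ) * Z := mul_nonneg (Real.sqrt_nonneg _) hA.Z_nonneg
  have hV := A.potential_nonneg x hA.η_pos j ht
  rcases htT.eq_or_lt with heq | hlt
  · refine ⟨t, le_rfl, by omega, htT, fun r h1 h2 => by omega, Or.inl heq, rfl, ?_⟩
    push_cast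
    linarith
  cases h : (A.state x t).mode with
  | free b =>
    obtain ⟨m, hm⟩ := hA.nextDecision_free hx hj ht htT h
    have h1 := hm.le_add
    have h5 := hm.potential
    refine ⟨m, hm.le, by omega, hm.le_horizon, hm.no_trigger, hm.decision, hm.epoch, ?_⟩
    push_cast at h5 ⊢
    linarith
  | nrsFirst R v =>
    have hR := A.rebases_of_mode x ht h
    obtain ⟨m, hm⟩ := hA.nextDecision_second hx hj (t := t + 1) (by omega) (by omega)
      hR.mode_succ
    have h1 := hm.le
    have h2 := hm.le_add
    refine ⟨m, by omega, by omega, hm.le_horizon, fun r h3 h4 b R hT => ?_, hm.decision,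
      hm.epoch.trans hR.epoch_succ, ?_⟩
    · rcases h3.eq_or_lt with rfl | h3
      · have := hT.mode
        rw [h] at this
        cases this
      · exact hm.no_trigger r h3 h4 b R hT
    · have := hA.le_potential_succ_of_rebases hx hj ht hlt hR
      have h5 := hm.potential
      push_cast at h5 ⊢
      linarith
  | nrsSecond =>
    obtain ⟨m, hm⟩ := hA.nextDecision_second hx hj ht htT h
    have h1 := hm.le_add
    have h5 := hm.potential
    refine ⟨m, hm.le, by omega, hm.le_horizon, hm.no_trigger, hm.decision, hm.epoch, ?_⟩
    push_cast at h5 ⊢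
    linarith

/-! ### Negative regret collected in an epoch. -/

/-- The negative regret available to epoch `τ`, up to the factor `1 - 1/β`. -/
noncomputable def Setup.budget (A : Setup K k) (x : Path K k) (j : Fin K) (τ : ℕ) : ℝ :=
  ∑ r ∈ Finset.Ico (A.start τ) (min A.T (A.start (τ + 1) + 4)), A.gain x j r
    + A.potential x j A.T

lemma Setup.Large.potential_horizon_le_budget (hA : A.Large Z) (j : Fin K) (τ : ℕ) :
    A.potential x j A.T ≤ A.budget x j τ := by
  unfold Setup.budget
  have : 0 ≤ ∑ r ∈ Finset.Ico (A.start τ) (min A.T (A.start (τ + 1) + 4)), A.gain x j r :=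
    Finset.sum_nonneg fun r _ => A.gain_nonneg x hA.η_pos j r
  linarith

lemma Setup.Large.budget_nonneg (hA : A.Large Z) (j : Fin K) (τ : ℕ) :
    0 ≤ A.budget x j τ :=
  (A.potential_nonneg x hA.η_pos j hA.init_lt.le).trans (hA.potential_horizon_le_budget j τ)

/-- A step with `j ∈ R` yields its gain one round later, and this gain is the `j`-part of the
divergence, hence the whole potential up to `U`. The step may be triggered up to three rounds beyond
the epoch, whence the `4` in `budget`; if the horizon cuts it off, the potential at the horizon
replaces the gain. -/
lemma Setup.Large.potential_le_of_triggers (hA : A.Large Z) (hx : A.LossBounded x) {j : Fin K}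
    (hj : A.η j ≤ 1) {m τ : ℕ} (hmS : A.initLen ≤ m) (hmT : m < A.T) {b : Bool}
    {R : Finset (Fin K)} (h : A.Triggers x m b R) (hjR : j ∈ R) (hτ : A.start τ ≤ m)
    (hτ' : m < A.start (τ + 1) + 3) :
    A.potential x j m ≤ A.budget x j τ + 7 * (√(A.T : ℝ) * Z) := by
  have hU : 0 ≤ √(A.T : ℝ) * Z := mul_nonneg (Real.sqrt_nonneg _) hA.Z_nonneg
  have h1 := hA.le_potential_succ hx hj hmS hmT (fun R hR => by
    obtain ⟨v, hv⟩ := hR.mode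
    have := h.mode
    rw [hv] at this
    cases this)
  rcases (Nat.succ_le_of_lt hmT).eq_or_lt with heq | hlt
  · have h2 := hA.potential_horizon_le_budget (x := x) j τ
    rw [← heq] at h2
    simp only [Nat.succ_eq_add_one] at h2
    linarith
  · have h2 := hA.potential_le (x := x) j (t := m + 1) (by omega) (by omega)
    have h3 : A.gain x j (m + 1)
        = vertexGap ((A.state x (m + 1)).η j) ((A.state x (m + 1)).w j) := by
      rw [A.gain_of_first x j h.mode_succ, if_pos hjR]
    have h4 : A.gain x j (m + 1)
        ≤ ∑ r ∈ Finset.Ico (A.start τ) (min A.T (A.start (τ + 1) + 4)), A.gain x j r := by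
      refine Finset.single_le_sum (f := fun r => A.gain x j r)
        (fun r _ => A.gain_nonneg x hA.η_pos j r) ?_
      rw [Finset.mem_Ico]
      exact ⟨by omega, lt_min hlt (by omega)⟩
    have h5 := A.potential_nonneg x hA.η_pos j hA.init_lt.le
    unfold Setup.budget
    linarith

lemma Setup.Large.top_pos (hA : A.Large Z) : 0 < A.top := by
  rw [A.lt_top_iff]
  have h1 := hA.horizon_ge
  have h2 := hA.one_le_card
  unfold threshold
  nlinarith

/-- Above the first threshold `1/√w ≤ 6`, and `21 = 2 * 6 * 1.5 + 3`. -/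
lemma Setup.Large.potential_le_of_not_below_zero (hA : A.Large Z) {j : Fin K} {m : ℕ}
    (hmS : A.initLen ≤ m) (hmT : m ≤ A.T) (h : ¬ A.Below x m j 0) :
    A.potential x j m ≤ 21 * (√(A.T : ℝ) * Z) := by
  have h1 : 1 / threshold 0 < (A.state x m).w j := by
    by_contra! hc
    exact h ⟨A.lt_top_iff.1 hA.top_pos, hc⟩
  have h2 : 1 / √((A.state x m).w j) ≤ 6 := by
    have h3 : (1 / 6 : ℝ) ≤ √((A.state x m).w j) := by
      refine Real.le_sqrt_of_sq_le ?_
      unfold threshold at h1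
      norm_num at h1 ⊢
      linarith
    rw [div_le_iff₀ (by linarith)]
    linarith
  have h4 := hA.potential_le' (x := x) j hmS hmT
  have h5 := hA.inv_η_le_U (x := x) j hmT
  have h6 : 0 < 1 / (A.state x m).η j := by
    have := A.η_pos x hA.η_pos m j
    positivity
  nlinarith

/-- The potential of a round in which the last threshold has been passed is at most a constant
multiple of that of the preceding threshold. -/
lemma Setup.Large.potential_le_of_half (hA : A.Large Z) (j : Fin K) {τ m m' : ℕ} (hτ : 1 ≤ τ)
    (hm : A.epochOf m = τ) (hm' : A.epochOf m' = τ) (hmT : m ≤ A.T) (hmT' : m' ≤ A.T)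
    (hw : (A.state x m').w j ≤ 2 * (A.state x m).w j) :
    A.potential x j m ≤ 4.26 * A.potential x j m' + 30 * (√(A.T : ℝ) * Z) := by
  have hK := hA.card_pos
  have hU : 0 ≤ √(A.T : ℝ) * Z := mul_nonneg (Real.sqrt_nonneg _) hA.Z_nonneg
  rw [A.epochOf_eq_iff hK] at hm hm'
  have hS := A.initLen_le_start hτ
  have hS1 : A.initLen ≤ m := hS.trans hm.1
  have hS2 : A.initLen ≤ m' := hS.trans hm'.1
  have hw1 := (A.isStat x hA.η_pos hK hS1).1 j
  have hw2 := (A.isStat x hA.η_pos hK hS2).1 j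
  have h1 := hA.potential_le' (x := x) j hS1 hmT
  have h2 := hA.le_potential (x := x) j hS2 hmT'
  have h3 := hA.le_inv_η x j hτ hm'.1 hm'.2.le
  have h4 := A.inv_η_le hA.η_pos x j m
  have hη := hA.η_pos j
  have h5 : √((m : ℝ) + 1) ≤ √2 * √(A.len τ) := by
    rw [← Real.sqrt_mul (by norm_num)]
    refine Real.sqrt_le_sqrt ?_
    have h6 : (m : ℝ) + 1 ≤ A.start (τ + 1) := by exact_mod_cast hm.2
    rw [A.start_succ_eq] at h6
    have h7 := A.len_eq τ
    have h8 := hA.le_initLen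
    linarith
  have h6 : 1 / √((A.state x m).w j) ≤ √2 * (1 / √((A.state x m').w j)) := by
    have h7 : √((A.state x m').w j) ≤ √2 * √((A.state x m).w j) := by
      rw [← Real.sqrt_mul (by norm_num)]
      exact Real.sqrt_le_sqrt hw
    have h8 := Real.sqrt_pos.2 hw1
    have h9 := Real.sqrt_pos.2 hw2
    rw [mul_one_div, div_le_div_iff₀ h8 h9]
    linarith
  have h7 : 1 / (A.state x m).η j ≤ √2 * √(A.len τ) / A.η j :=
    h4.trans (div_le_div_of_nonneg_right h5 hη.le)
  have h8 : 1 / (A.state x m).η j * (1 / √((A.state x m).w j))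
      ≤ (√2 * √(A.len τ) / A.η j) * (√2 * (1 / √((A.state x m').w j))) :=
    mul_le_mul h7 h6 (by positivity) (by positivity)
  -- One `√2` comes from the elapsed time, at most twice the epoch length, the other from the ratio
  -- of the probabilities. The final `4.26` bounds `2 / 0.47`.
  have h9 : (√2 * √(A.len τ) / A.η j) * (√2 * (1 / √((A.state x m').w j)))
      = 2 * (√(A.len τ) / A.η j * (1 / √((A.state x m').w j))) := by
    have : √2 * √2 = (2 : ℝ) := Real.mul_self_sqrt (by norm_num)
    calc _ = (√2 * √2) * (√(A.len τ) / A.η j * (1 / √((A.state x m').w j))) := by ring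
      _ = _ := by rw [this]
  have h10 : 0.47 * (√(A.len τ) / A.η j * (1 / √((A.state x m').w j)))
      ≤ 1 / (A.state x m').η j * (1 / √((A.state x m').w j)) := by
    have := mul_le_mul_of_nonneg_right h3 (by positivity : 0 ≤ 1 / √((A.state x m').w j))
    calc _ = 0.47 * √(A.len τ) / A.η j * (1 / √((A.state x m').w j)) := by ring
      _ ≤ _ := this
  have h11 := A.potential_nonneg x hA.η_pos j hS2
  linarith

/-- As long as the last threshold has not been passed before, the potential is controlled by the
negative regret of the epoch. -/
lemma Setup.Large.potential_le_budget (hA : A.Large Z) (hx : A.LossBounded x) {j : Fin K}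
    (hj : A.η j ≤ 1) {t τ : ℕ} (hτ : 1 ≤ τ) (ht : A.epochOf t = τ) (htT : t < A.T)
    (hr : ∀ r, A.start τ ≤ r → r < t → 1 / threshold (A.top - 1) < (A.state x r).w j) :
    A.potential x j t ≤ 6 * A.budget x j τ + 100 * (√(A.T : ℝ) * Z) := by
  have hK := hA.card_pos
  have hU : 0 ≤ √(A.T : ℝ) * Z := mul_nonneg (Real.sqrt_nonneg _) hA.Z_nonneg
  have ht' := (A.epochOf_eq_iff hK).1 ht
  have htS : A.initLen ≤ t := (A.initLen_le_start hτ).trans ht'.1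
  have hY := hA.budget_nonneg (x := x) j τ
  obtain ⟨m, hm⟩ := hA.exists_nextDecision hx hj htS htT.le
  have hpot := hm.potential
  have hle := hm.le
  have hle' := hm.le_add
  push_cast at hpot
  -- Passing from `t` to the decision round `m` costs the factor `0.99` and `12 U`.
  suffices hV : A.potential x j m ≤ 4.26 * A.budget x j τ + 60 * (√(A.T : ℝ) * Z) by linarith
  have hmS : A.initLen ≤ m := htS.trans hle
  rcases hm.le_horizon.eq_or_lt with heq | hmT
  · have := hA.potential_horizon_le_budget (x := x) j τ
    rw [heq]
    linarith
  have hsmall : ¬ A.Below x m j 0 →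
      A.potential x j m ≤ 4.26 * A.budget x j τ + 60 * (√(A.T : ℝ) * Z) := by
    intro h
    have := hA.potential_le_of_not_below_zero hmS hmT.le h
    linarith
  -- Here no threshold is violated at `m`. If the index is positive, the preceding threshold
  -- triggered a step at some `m'` of this epoch, where `w_j` was at most twice its value at `m`;
  -- the gain of that step controls the potential at `m`.
  have hcov : ¬ A.IsNew x m → ¬ A.Below x m j (A.index x m j) →
      A.potential x j m ≤ 4.26 * A.budget x j τ + 60 * (√(A.T : ℝ) * Z) := by
    intro hn hb
    rw [Setup.index, if_neg hn] at hb
    have hep : A.epochOf m = (A.state x m).epoch := not_not.1 hn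
    -- The recorded epoch is the same at `m` and at `t`, hence at most `τ`; since `m` is not new, it
    -- still lies in epoch `τ`.
    have hτm : A.epochOf m = τ := by
      have h1 := A.epoch_le hK x t
      have h2 : A.epochOf (t - 1) ≤ A.epochOf t := A.epochOf_mono hK (by omega)
      have h3 := A.epochOf_mono hK hle
      have h4 := hm.epoch
      omega
    rcases Nat.eq_zero_or_pos ((A.state x m).θ j) with h0 | h0
    · rw [h0] at hb
      exact hsmall hb
    · obtain ⟨m', b, R, h1, h2, h3, h4, h5, h6⟩ := A.exists_trigger x j hmS h0
      have hτm' : A.epochOf m' = τ := by omega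
      have hst' := (A.epochOf_eq_iff hK).1 hτm'
      have htop := A.θ_le x m j
      -- If all thresholds are used up, the last one was passed at `m'`. No step is triggered
      -- between `t` and `m`, so `m' < t`, against the hypothesis.
      rcases htop.eq_or_lt with heq | hlt
      · exfalso
        have h7 : m' < t := by
          by_contra! hc
          exact hm.no_trigger m' hc h1 b R h4
        have h8 := hr m' hst'.1 h7
        rw [heq] at h6
        linarith
      · have h7 : 1 / threshold ((A.state x m).θ j) < (A.state x m).w j := by
          by_contra! hc
          exact hb ⟨A.lt_top_iff.1 hlt, hc⟩
        have h8 : 1 / threshold ((A.state x m).θ j - 1)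
            = 2 * (1 / threshold ((A.state x m).θ j)) := by
          have h9 : (A.state x m).θ j = ((A.state x m).θ j - 1) + 1 := by omega
          have h10 := threshold_succ ((A.state x m).θ j - 1)
          rw [← h9] at h10
          have := threshold_pos ((A.state x m).θ j - 1)
          rw [h10]
          field_simp
        have h11 := hA.potential_le_of_half (x := x) j hτ hτm hτm' hmT.le (by omega) (by linarith)
        have h12 := hA.potential_le_of_triggers hx hj h2 (by omega) h4 h5 hst'.1 (by omega)
        linarith
  rcases hm.decision with heq | ⟨b, hmode, hdec⟩
  · omega
  rcases A.triggers_or_decays x hmS hmode with ⟨R, hT⟩ | hD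
  · by_cases hjR : j ∈ R
    · have := hA.potential_le_of_triggers hx hj (τ := τ) hmS hmT hT hjR (by omega) (by omega)
      linarith
    · rcases hT.control with ⟨-, hR, -⟩ | ⟨-, hR, hf, -⟩
      · exact hsmall fun h => hjR ((hR j).2 h)
      · by_cases hn : A.IsNew x m
        · exact hsmall (hf hn j)
        · exact hcov hn fun h => hjR ((hR j).2 h)
  · by_cases hn : A.IsNew x m
    · exact hsmall (hD.not_first hn j)
    · exact hcov hn (hD.not_below (hdec.resolve_left hn) j)

end Control

/-! ### The pathwise regret bound -/

/-- In the epoch of round `t`, up to this round, the last threshold has been passed. -/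
def Setup.Crossed (A : Setup K k) (x : Path K k) (j : Fin K) (t : ℕ) : Prop :=
  ∃ r, A.start (A.epochOf t) ≤ r ∧ r ≤ t ∧ (A.state x r).w j ≤ 1 / threshold (A.top - 1)

open Classical in
/-- The excess of the rescaled loss over `1` after the last threshold has been passed. -/
noncomputable def Setup.excess (A : Setup K k) (x : Path K k) (j : Fin K) (t : ℕ) : ℝ :=
  if A.Crossed x j t then A.rescaledLoss x t j - 1 else 0

section Pathwise

variable {A : Setup K k} {Z : ℝ} {x : Path K k}

lemma Setup.mem_epochRounds (A : Setup K k) {τ t : ℕ} :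
    t ∈ A.epochRounds τ ↔ t < A.T ∧ A.epochOf t = τ := by
  rw [Setup.epochRounds, Finset.mem_filter, Finset.mem_range]

lemma Setup.Large.card_epochRounds_le (hA : A.Large Z) (τ : ℕ) :
    ((A.epochRounds τ).card : ℝ) ≤ A.len τ := by
  have h1 : A.epochRounds τ ⊆ Finset.Ico (A.start τ) (A.start (τ + 1)) := by
    intro t ht
    rw [A.mem_epochRounds, A.epochOf_eq_iff hA.card_pos] at ht
    exact Finset.mem_Ico.2 ht.2
  have h2 := Finset.card_le_card h1
  rw [Nat.card_Ico] at h2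
  have h3 : ((A.start (τ + 1) - A.start τ : ℕ) : ℝ) = A.len τ := by
    rw [Nat.cast_sub (A.start_mono (Nat.le_succ τ)), A.start_succ_eq]
    ring
  rw [← h3]
  exact_mod_cast h2

lemma Setup.card_epochRounds_le_horizon (A : Setup K k) (τ : ℕ) :
    (A.epochRounds τ).card ≤ A.T := by
  have := Finset.card_filter_le (Finset.range A.T) (fun t => A.epochOf t = τ)
  rwa [Finset.card_range] at this

/-- When the last threshold is passed, the potential dominates the length of the epoch. -/
lemma Setup.Large.card_le_potential (hA : A.Large Z) {j : Fin K} (hj : A.η j ≤ 1) {σ τ : ℕ}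
    (hτ : 1 ≤ τ) (hσ : A.epochOf σ = τ) (hσT : σ < A.T)
    (hw : (A.state x σ).w j ≤ 1 / threshold (A.top - 1)) :
    ((A.epochRounds τ).card : ℝ) ≤ 1.53 * A.potential x j σ + 10 * (√(A.T : ℝ) * Z) := by
  have hK := hA.card_pos
  have hσ' := (A.epochOf_eq_iff hK).1 hσ
  have hσS : A.initLen ≤ σ := (A.initLen_le_start hτ).trans hσ'.1
  have hU : 0 ≤ √(A.T : ℝ) * Z := mul_nonneg (Real.sqrt_nonneg _) hA.Z_nonneg
  have hw0 := (A.isStat x hA.η_pos hK hσS).1 j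
  have h1 := hA.le_potential (x := x) j hσS hσT.le
  have h2 := hA.le_inv_η x j hτ hσ'.1 hσ'.2.le
  have hT := hA.horizon_ge
  have h3 : 0.7 * √(A.T : ℝ) ≤ 1 / √((A.state x σ).w j) := by
    -- The threshold after the last one in use exceeds `K T`, so having passed the last one means
    -- `w_j ≤ 2 / T`.
    have h4 : (A.T : ℝ) ≤ 2 * threshold (A.top - 1) := by
      have h5 := A.lt_threshold_top
      have h6 : A.top = (A.top - 1) + 1 := by have := hA.top_pos; omega
      rw [h6, threshold_succ] at h5
      have := hA.one_le_card
      nlinarith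
    have h7 := threshold_pos (A.top - 1)
    rw [le_div_iff₀ (Real.sqrt_pos.2 hw0), mul_assoc, ← Real.sqrt_mul (by linarith)]
    have h8 : (A.T : ℝ) * (A.state x σ).w j ≤ 2 := by
      calc (A.T : ℝ) * (A.state x σ).w j
          ≤ (2 * threshold (A.top - 1)) * (1 / threshold (A.top - 1)) :=
            mul_le_mul h4 hw hw0.le (by positivity)
        _ = 2 := by field_simp
    have h9 : √((A.T : ℝ) * (A.state x σ).w j) ≤ 1.42 := by
      refine Real.sqrt_le_iff.2 ⟨by norm_num, h8.trans (by norm_num)⟩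
    linarith
  have h4 : 1 ≤ 1 / A.η j := by
    rw [le_div_iff₀ (hA.η_pos j)]
    linarith
  have h5 : 0.47 * √(A.len τ) ≤ 1 / (A.state x σ).η j := by
    refine le_trans ?_ h2
    rw [div_eq_mul_one_div]
    exact le_mul_of_one_le_right (by positivity) h4
  have h6 : (0.47 * √(A.len τ)) * (0.7 * √(A.T : ℝ))
      ≤ 1 / (A.state x σ).η j * (1 / √((A.state x σ).w j)) :=
    mul_le_mul h5 h3 (by positivity) ((by positivity : 0 ≤ 0.47 * √(A.len τ)).trans h5)
  -- The number of rounds is at most both the epoch length and `T`, hence at most their geometric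
  -- mean. The factor `1.53` bounds `1 / (2 * 0.47 * 0.7)`.
  have h7 : ((A.epochRounds τ).card : ℝ) ≤ √(A.len τ) * √(A.T : ℝ) := by
    have h8 := hA.card_epochRounds_le τ
    have h9 : ((A.epochRounds τ).card : ℝ) ≤ A.T := by
      exact_mod_cast A.card_epochRounds_le_horizon τ
    calc ((A.epochRounds τ).card : ℝ)
        = √((A.epochRounds τ).card : ℝ) * √((A.epochRounds τ).card : ℝ) :=
          (Real.mul_self_sqrt (Nat.cast_nonneg _)).symm
      _ ≤ _ := mul_le_mul (Real.sqrt_le_sqrt h8) (Real.sqrt_le_sqrt h9) (Real.sqrt_nonneg _)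
          (Real.sqrt_nonneg _)
  have h8 := A.potential_nonneg x hA.η_pos j hσS
  linarith

lemma Setup.Large.potential_le_add (hA : A.Large Z) (hx : A.LossBounded x) (j : Fin K) {s t : ℕ}
    (hs : A.initLen ≤ s) (hst : s ≤ t) (htT : t ≤ A.T) :
    A.potential x j t ≤ A.potential x j s
      + ∑ r ∈ Finset.Ico s t, (A.rescaledLoss x r j + A.noise x Z r) := by
  induction t, hst using Nat.le_induction with
  | base => simp
  | succ t hst ih =>
    have h1 := ih (by omega)
    have h2 := hA.potential_succ_le hx j (t := t) (by omega) (by omega)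
    have h3 := hA.inner_nonneg hx (t := t) (by omega) (by omega)
    have h4 := mul_nonneg (rate_nonneg A.T) (A.gain_nonneg x hA.η_pos j t)
    rw [Finset.sum_Ico_succ_top hst]
    linarith

/-- Up to the first crossing `σ` of the last threshold, `potential_le_budget` applies. Afterwards
the potential grows by at most the rescaled losses of `j` and the noise; these losses are the excess
plus at most the number of rounds, which `card_le_potential` bounds by the potential at `σ`. The
total factor `0.0303 * (6 + 1.53 * 6)` is below `1/2`. -/
lemma Setup.Large.potential_le_budget_add (hA : A.Large Z) (hx : A.LossBounded x) {j : Fin K}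
    (hj : A.η j ≤ 1) {t τ : ℕ} (hτ : 1 ≤ τ) (ht : t ∈ A.epochRounds τ) :
    0.0303 * A.potential x j t ≤ 1 / 2 * A.budget x j τ
      + 0.0303 * ∑ r ∈ A.epochRounds τ, A.excess x j r + 10 * (√(A.T : ℝ) * Z)
      + ∑ r ∈ Finset.Ico A.initLen A.T, A.noise x Z r := by
  classical
  have hK := hA.card_pos
  have hU : 0 ≤ √(A.T : ℝ) * Z := mul_nonneg (Real.sqrt_nonneg _) hA.Z_nonneg
  have hY := hA.budget_nonneg (x := x) j τ
  have hN : 0 ≤ ∑ r ∈ Finset.Ico A.initLen A.T, A.noise x Z r :=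
    Finset.sum_nonneg fun r _ => hA.noise_nonneg x r
  obtain ⟨htT, hte⟩ := A.mem_epochRounds.1 ht
  have hte' := (A.epochOf_eq_iff hK).1 hte
  have hinit := A.initLen_le_start hτ
  by_cases hex : ∃ r, r ∈ A.epochRounds τ ∧ (A.state x r).w j ≤ 1 / threshold (A.top - 1)
  · obtain ⟨hσ, hσw⟩ := Nat.find_spec hex
    have hmin : ∀ r < Nat.find hex, ¬ (r ∈ A.epochRounds τ ∧
        (A.state x r).w j ≤ 1 / threshold (A.top - 1)) := fun r hr => Nat.find_min hex hr
    generalize Nat.find hex = σ at hσ hσw hmin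
    obtain ⟨hσT, hσe⟩ := A.mem_epochRounds.1 hσ
    have hσe' := (A.epochOf_eq_iff hK).1 hσe
    have hbefore : ∀ r, A.start τ ≤ r → r < σ →
        1 / threshold (A.top - 1) < (A.state x r).w j := by
      intro r h1 h2
      by_contra! hc
      exact hmin r h2 ⟨A.mem_epochRounds.2 ⟨by omega,
        (A.epochOf_eq_iff hK).2 ⟨h1, by omega⟩⟩, hc⟩
    have hVσ := hA.potential_le_budget hx hj hτ hσe hσT hbefore
    have hs := hA.card_le_potential hj hτ hσe hσT hσw
    have hnn : ∀ r ∈ A.epochRounds τ, 0 ≤ if A.Crossed x j r then A.rescaledLoss x r j else 0 := by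
      intro r hr
      obtain ⟨h1, h2⟩ := A.mem_epochRounds.1 hr
      have h3 := (A.epochOf_eq_iff hK).1 h2
      split_ifs
      · exact hA.rescaledLoss_nonneg hx (by omega) h1 j
      · rfl
    have hexc : ∑ r ∈ A.epochRounds τ, (if A.Crossed x j r then A.rescaledLoss x r j else 0)
        - (A.epochRounds τ).card ≤ ∑ r ∈ A.epochRounds τ, A.excess x j r := by
      rw [← nsmul_one, ← Finset.sum_const, ← Finset.sum_sub_distrib]
      refine Finset.sum_le_sum fun r _ => ?_
      unfold Setup.excess
      split_ifs
      · rfl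
      · linarith
    have hV : A.potential x j t ≤ 6 * A.budget x j τ + 100 * (√(A.T : ℝ) * Z)
        + ∑ r ∈ A.epochRounds τ, (if A.Crossed x j r then A.rescaledLoss x r j else 0)
        + ∑ r ∈ Finset.Ico A.initLen A.T, A.noise x Z r := by
      have hE := Finset.sum_nonneg hnn
      rcases le_or_gt t σ with hle | hlt
      · have := hA.potential_le_budget hx hj hτ hte htT
          (fun r h1 h2 => hbefore r h1 (by omega))
        linarith
      · have h1 := hA.potential_le_add hx j (s := σ) (t := t) (by omega) hlt.le htT.le
        rw [Finset.sum_add_distrib] at h1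
        have h2 : ∑ r ∈ Finset.Ico σ t, A.rescaledLoss x r j
            ≤ ∑ r ∈ A.epochRounds τ, (if A.Crossed x j r then A.rescaledLoss x r j else 0) := by
          calc ∑ r ∈ Finset.Ico σ t, A.rescaledLoss x r j
              = ∑ r ∈ Finset.Ico σ t,
                  (if A.Crossed x j r then A.rescaledLoss x r j else 0) := by
                refine Finset.sum_congr rfl fun r hr => ?_
                rw [Finset.mem_Ico] at hr
                have hre : A.epochOf r = τ := (A.epochOf_eq_iff hK).2 ⟨by omega, by omega⟩
                rw [if_pos]
                exact ⟨σ, by rw [hre]; exact hσe'.1, hr.1, hσw⟩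
            _ ≤ _ := by
                refine Finset.sum_le_sum_of_subset_of_nonneg ?_ fun r hr _ => hnn r hr
                intro r hr
                rw [Finset.mem_Ico] at hr
                exact A.mem_epochRounds.2 ⟨by omega,
                  (A.epochOf_eq_iff hK).2 ⟨by omega, by omega⟩⟩
        have h3 : ∑ r ∈ Finset.Ico σ t, A.noise x Z r
            ≤ ∑ r ∈ Finset.Ico A.initLen A.T, A.noise x Z r := by
          refine Finset.sum_le_sum_of_subset_of_nonneg ?_ fun r _ _ => hA.noise_nonneg x r
          exact Finset.Ico_subset_Ico (by omega) htT.le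
        linarith
    linarith
  · have hno : ∀ r ∈ A.epochRounds τ, 1 / threshold (A.top - 1) < (A.state x r).w j := by
      intro r hr
      by_contra! hc
      exact hex ⟨r, hr, hc⟩
    have h1 := hA.potential_le_budget hx hj hτ hte htT (fun r h1 h2 => hno r
      (A.mem_epochRounds.2 ⟨by omega, (A.epochOf_eq_iff hK).2 ⟨h1, by omega⟩⟩))
    have h2 : ∑ r ∈ A.epochRounds τ, A.excess x j r = 0 := by
      refine Finset.sum_eq_zero fun r hr => ?_
      unfold Setup.excess
      rw [if_neg]
      rintro ⟨s, hs1, hs2, hs3⟩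
      obtain ⟨h3, h4⟩ := A.mem_epochRounds.1 hr
      rw [h4] at hs1
      have h5 := (A.epochOf_eq_iff hK).1 h4
      have := hno s (A.mem_epochRounds.2 ⟨by omega, (A.epochOf_eq_iff hK).2 ⟨hs1, by omega⟩⟩)
      linarith
    rw [h2]
    linarith

/-- By minimality of `ρ`, its half already fails at some round `t`, so `√ρ ≤ 1.42 / √w_t`; here
`1.42 > √2` also absorbs the mixing. By `le_inv_η` the left side is at most `1.42 / (50 * 0.47)`
times `1 / (η_t √w_t)`, which is at most half the potential up to `3 U`; this gives `0.0303`. -/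
lemma Setup.Large.exists_sqrt_rho_le (hA : A.Large Z) {j : Fin K} {τ : ℕ} (hτ : 1 ≤ τ)
    (hne : (A.epochRounds τ).Nonempty) :
    ∃ t ∈ A.epochRounds τ, √(A.rho x j τ) * (√((A.epochRounds τ).card : ℝ) / (50 * A.η j))
      ≤ 0.0303 * A.potential x j t + √(A.T : ℝ) * Z := by
  have hK := hA.card_pos
  have hU : 0 ≤ √(A.T : ℝ) * Z := mul_nonneg (Real.sqrt_nonneg _) hA.Z_nonneg
  have hη := hA.η_pos j
  have hin : ∀ t ∈ A.epochRounds τ, A.initLen ≤ t := by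
    intro t ht
    exact (A.initLen_le_start hτ).trans ((A.epochOf_eq_iff hK).1 (A.mem_epochRounds.1 ht).2).1
  have hcard : √((A.epochRounds τ).card : ℝ) ≤ √(A.T : ℝ) :=
    Real.sqrt_le_sqrt (by exact_mod_cast A.card_epochRounds_le_horizon τ)
  have hcard' : √((A.epochRounds τ).card : ℝ) ≤ √(A.len τ) :=
    Real.sqrt_le_sqrt (hA.card_epochRounds_le τ)
  unfold Setup.rho
  rcases Nat.eq_zero_or_pos (sInf {s : ℕ | ∀ t ∈ A.epochRounds τ, 1 / threshold s < A.prob x t j})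
    with h0 | h0
  · obtain ⟨t, ht⟩ := hne
    refine ⟨t, ht, ?_⟩
    rw [h0]
    have h1 : √(threshold 0) = 6 := by
      unfold threshold
      rw [show (36 : ℝ) * 2 ^ 0 = 6 ^ 2 by norm_num, Real.sqrt_sq (by norm_num)]
    rw [h1]
    have h2 := A.potential_nonneg x hA.η_pos j (hin t ht)
    have h3 : √((A.epochRounds τ).card : ℝ) * (1 / A.η j) ≤ √(A.T : ℝ) * Z :=
      mul_le_mul hcard (hA.inv_η_le_Z j) (by positivity) (by positivity)
    have h4 : 6 * (√((A.epochRounds τ).card : ℝ) / (50 * A.η j))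
        = 6 / 50 * (√((A.epochRounds τ).card : ℝ) * (1 / A.η j)) := by
      field_simp
    rw [h4]
    linarith
  · have h1 := Nat.notMem_of_lt_sInf (Nat.sub_lt h0 one_pos)
    set s₀ := sInf {s : ℕ | ∀ t ∈ A.epochRounds τ, 1 / threshold s < A.prob x t j} with hs₀
    simp only [Set.mem_ofPred_eq] at h1
    push Not at h1
    obtain ⟨t, ht, hp⟩ := h1
    refine ⟨t, ht, ?_⟩
    have htS := hin t ht
    obtain ⟨htT, hte⟩ := A.mem_epochRounds.1 ht
    have hte' := (A.epochOf_eq_iff hK).1 hte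
    have hw := (A.isStat x hA.η_pos hK htS).1 j
    have h2 := hA.le_prob (x := x) htS j
    have h3 : threshold s₀ = 2 * threshold (s₀ - 1) := by
      rw [← threshold_succ]
      congr 1
      omega
    have h4 := threshold_pos (s₀ - 1)
    have h5 : √(threshold s₀) ≤ 1.42 * (1 / √((A.state x t).w j)) := by
      refine Real.sqrt_le_iff.2 ⟨by positivity, ?_⟩
      rw [mul_pow, div_pow, one_pow, Real.sq_sqrt hw.le, mul_one_div, le_div_iff₀ hw, h3]
      have h6 : threshold (s₀ - 1) * A.prob x t j ≤ 1 := by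
        rw [le_div_iff₀ h4] at hp
        linarith
      nlinarith
    have h6 := hA.le_potential (x := x) j htS htT.le
    have h7 := hA.le_inv_η x j hτ hte'.1 hte'.2.le
    have h8 : √(threshold s₀) * (√((A.epochRounds τ).card : ℝ) / (50 * A.η j))
        ≤ 1.42 * (1 / √((A.state x t).w j)) * (√(A.len τ) / (50 * A.η j)) :=
      mul_le_mul h5 (by gcongr) (by positivity) (by positivity)
    have h9 : 1.42 * (1 / √((A.state x t).w j)) * (√(A.len τ) / (50 * A.η j))
        = 1.42 / (50 * 0.47) * ((0.47 * √(A.len τ) / A.η j) * (1 / √((A.state x t).w j))) := by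
      field_simp
    have h10 : (0.47 * √(A.len τ) / A.η j) * (1 / √((A.state x t).w j))
        ≤ 1 / (A.state x t).η j * (1 / √((A.state x t).w j)) :=
      mul_le_mul_of_nonneg_right h7 (by positivity)
    have h11 := A.potential_nonneg x hA.η_pos j htS
    rw [h9] at h8
    refine h8.trans ?_
    have h12 := h10.trans h6
    have h13 := mul_le_mul_of_nonneg_left h12 (by norm_num : (0 : ℝ) ≤ 1.42 / (50 * 0.47))
    refine h13.trans ?_
    norm_num
    linarith

lemma Setup.Large.one_le_of_mem_epochs (hA : A.Large Z) {τ : ℕ} (hτ : τ ∈ A.epochs) : 1 ≤ τ := by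
  obtain ⟨t, ht, rfl⟩ := Finset.mem_image.1 hτ
  exact A.one_le_epochOf hA.card_pos (Finset.mem_Ico.1 ht).1

lemma Setup.epochRounds_nonempty (A : Setup K k) {τ : ℕ} (hτ : τ ∈ A.epochs) :
    (A.epochRounds τ).Nonempty := by
  obtain ⟨t, ht, rfl⟩ := Finset.mem_image.1 hτ
  exact ⟨t, A.mem_epochRounds.2 ⟨(Finset.mem_Ico.1 ht).2, rfl⟩⟩

/-- At most `2 log T` epochs meet a rate of at most `1 / log² T`. -/
lemma Setup.Large.rate_mul_card_epochs_le (hA : A.Large Z) :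
    (1 - 1 / beta A.T) * A.epochs.card ≤ 1 := by
  have hl := hA.log_ge
  have hT := hA.horizon_ge
  have hT' : 0 < A.T := by
    by_contra! h
    have : A.T = 0 := by omega
    rw [this] at hT
    norm_num at hT
  have h1 : A.epochs ⊆ Finset.Icc 1 (Nat.log 2 A.T) := by
    intro τ hτ
    rw [Finset.mem_Icc]
    refine ⟨hA.one_le_of_mem_epochs hτ, ?_⟩
    obtain ⟨t, ht, rfl⟩ := Finset.mem_image.1 hτ
    unfold Setup.epochOf
    refine Nat.log_mono_right ?_
    have := Nat.div_le_self t A.initLen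
    have := (Finset.mem_Ico.1 ht).2
    omega
  have h2 := Finset.card_le_card h1
  rw [Nat.card_Icc, Nat.add_sub_cancel] at h2
  have h3 : (A.epochs.card : ℝ) ≤ 2 * Real.log A.T := by
    have h4 : (A.epochs.card : ℝ) ≤ Nat.log 2 A.T := by exact_mod_cast h2
    have h5 : (Nat.log 2 A.T : ℝ) * Real.log 2 ≤ Real.log A.T := by
      rw [← Real.log_pow]
      refine Real.log_le_log (by positivity) ?_
      exact_mod_cast Nat.pow_log_le_self 2 hT'.ne'
    have h6 := Real.log_two_gt_d9
    have h7 : (0 : ℝ) ≤ Nat.log 2 A.T := Nat.cast_nonneg _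
    nlinarith
  have h4 := rate_le A.T
  calc (1 - 1 / beta A.T) * A.epochs.card
      ≤ (1 / Real.log A.T ^ 2) * (2 * Real.log A.T) :=
        mul_le_mul h4 h3 (Nat.cast_nonneg _) (by positivity)
    _ = 2 / Real.log A.T := by field_simp
    _ ≤ 1 := by
        rw [div_le_one (by linarith)]
        linarith

/-- Epochs are much longer than four rounds, so a round belongs to its own epoch and to the
extension of at most the preceding one; no gain is counted more than twice. -/
lemma Setup.Large.sum_budget_le (hA : A.Large Z) (j : Fin K) :
    ∑ τ ∈ A.epochs, A.budget x j τ
      ≤ 2 * ∑ t ∈ Finset.Ico A.initLen A.T, A.gain x j t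
        + A.epochs.card * A.potential x j A.T := by
  have hK := hA.card_pos
  unfold Setup.budget
  rw [Finset.sum_add_distrib, Finset.sum_const, nsmul_eq_mul]
  refine add_le_add_left ?_ _
  have h1 : ∀ τ ∈ A.epochs,
      ∑ r ∈ Finset.Ico (A.start τ) (min A.T (A.start (τ + 1) + 4)), A.gain x j r
        = ∑ r ∈ Finset.Ico A.initLen A.T,
          if A.start τ ≤ r ∧ r < A.start (τ + 1) + 4 then A.gain x j r else 0 := by
    intro τ hτ
    rw [← Finset.sum_filter]
    congr 1
    ext r
    have := A.initLen_le_start (hA.one_le_of_mem_epochs hτ)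
    simp only [Finset.mem_Ico, Finset.mem_filter, lt_min_iff]
    omega
  rw [Finset.sum_congr rfl h1, Finset.sum_comm, Finset.mul_sum]
  refine Finset.sum_le_sum fun r _ => ?_
  rw [← Finset.sum_filter, Finset.sum_const, nsmul_eq_mul]
  refine mul_le_mul_of_nonneg_right ?_ (A.gain_nonneg x hA.η_pos j r)
  have h2 : (A.epochs.filter fun τ => A.start τ ≤ r ∧ r < A.start (τ + 1) + 4)
      ⊆ {A.epochOf r, A.epochOf r - 1} := by
    intro τ hτ
    obtain ⟨hτ1, hτ2, hτ3⟩ := Finset.mem_filter.1 hτ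
    have h3 : τ ≤ A.epochOf r := (A.le_epochOf_iff hK).2 hτ2
    have h4 : ¬ τ + 2 ≤ A.epochOf r := by
      rw [A.le_epochOf_iff hK]
      have h5 := A.start_succ (τ + 1)
      have h6 : (1000 : ℝ) ≤ A.initLen := hA.le_initLen
      have h7 : 1000 ≤ A.initLen := by exact_mod_cast h6
      have h8 : A.initLen ≤ 2 ^ (τ + 1) * A.initLen :=
        Nat.le_mul_of_pos_left _ (by positivity)
      have h9 : τ + 1 + 1 = τ + 2 := rfl
      rw [h9] at h5
      omega
    simp only [Finset.mem_insert, Finset.mem_singleton]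
    omega
  have h3 := (Finset.card_le_card h2).trans Finset.card_le_two
  exact_mod_cast h3

lemma Setup.Large.sum_epochs (hA : A.Large Z) (f : ℕ → ℝ) :
    ∑ τ ∈ A.epochs, ∑ t ∈ A.epochRounds τ, f t = ∑ t ∈ Finset.Ico A.initLen A.T, f t := by
  have hK := hA.card_pos
  rw [← Finset.sum_fiberwise_of_maps_to (g := A.epochOf) (t := A.epochs)
    (fun t ht => Finset.mem_image_of_mem _ ht)]
  refine Finset.sum_congr rfl fun τ hτ => ?_
  congr 1
  ext t
  rw [A.mem_epochRounds, Finset.mem_filter, Finset.mem_Ico]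
  constructor
  · rintro ⟨h1, h2⟩
    have h3 := (A.epochOf_eq_iff hK).1 h2
    have := A.initLen_le_start (hA.one_le_of_mem_epochs hτ)
    exact ⟨⟨by omega, h1⟩, h2⟩
  · rintro ⟨⟨-, h1⟩, h2⟩
    exact ⟨h1, h2⟩

/-- The stability overhead is paid for by the negative regret. -/
lemma Setup.Large.sum_sqrt_rho_le (hA : A.Large Z) (hx : A.LossBounded x) {j : Fin K}
    (hj : A.η j ≤ 1) {R : ℕ → ℝ}
    (hR : ∀ s ∈ Finset.Icc 1 A.T, R s ≤ (1 - 1 / beta A.T) * (√(s : ℝ) / (50 * A.η j))) :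
    ∑ τ ∈ A.epochs, √(A.rho x j τ) * R (A.epochRounds τ).card
      ≤ (1 - 1 / beta A.T) * ∑ t ∈ Finset.Ico A.initLen A.T, A.gain x j t + A.potential x j A.T
        + 0.0303 * (1 - 1 / beta A.T) * ∑ t ∈ Finset.Ico A.initLen A.T, A.excess x j t
        + 11 * (√(A.T : ℝ) * Z) + ∑ t ∈ Finset.Ico A.initLen A.T, A.noise x Z t := by
  have hU : 0 ≤ √(A.T : ℝ) * Z := mul_nonneg (Real.sqrt_nonneg _) hA.Z_nonneg
  have hN : 0 ≤ ∑ r ∈ Finset.Ico A.initLen A.T, A.noise x Z r :=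
    Finset.sum_nonneg fun r _ => hA.noise_nonneg x r
  have hrate := rate_nonneg A.T
  have hcard := hA.rate_mul_card_epochs_le
  have hbud := hA.sum_budget_le (x := x) j
  have hV := A.potential_nonneg x hA.η_pos j hA.init_lt.le
  set c := 1 - 1 / beta A.T with hc
  set N := ∑ r ∈ Finset.Ico A.initLen A.T, A.noise x Z r with hNdef
  have h1 : ∀ τ ∈ A.epochs, √(A.rho x j τ) * R (A.epochRounds τ).card
      ≤ c * (1 / 2 * A.budget x j τ + 0.0303 * ∑ r ∈ A.epochRounds τ, A.excess x j r
        + 11 * (√(A.T : ℝ) * Z) + N) := by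
    intro τ hτ
    have hne := A.epochRounds_nonempty hτ
    have h1τ := hA.one_le_of_mem_epochs hτ
    have h2 := hR _ (Finset.mem_Icc.2 ⟨Finset.card_pos.2 hne, A.card_epochRounds_le_horizon τ⟩)
    obtain ⟨t, ht, h3⟩ := hA.exists_sqrt_rho_le (x := x) (j := j) h1τ hne
    have h4 := hA.potential_le_budget_add hx hj h1τ ht
    calc √(A.rho x j τ) * R (A.epochRounds τ).card
        ≤ √(A.rho x j τ) * (c * (√((A.epochRounds τ).card : ℝ) / (50 * A.η j))) :=
          mul_le_mul_of_nonneg_left h2 (Real.sqrt_nonneg _)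
      _ = c * (√(A.rho x j τ) * (√((A.epochRounds τ).card : ℝ) / (50 * A.η j))) := by ring
      _ ≤ _ := mul_le_mul_of_nonneg_left (by linarith) hrate
  refine (Finset.sum_le_sum h1).trans ?_
  rw [← Finset.mul_sum, Finset.sum_add_distrib, Finset.sum_add_distrib, Finset.sum_add_distrib,
    ← Finset.mul_sum, ← Finset.mul_sum, hA.sum_epochs, Finset.sum_const, Finset.sum_const,
    nsmul_eq_mul, nsmul_eq_mul]
  -- The factor `1/2` in front of the budgets undoes the double counting. What results is no more
  -- than the gain and the final potential subtracted in `sum_inner_le`.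
  have h2 := mul_le_mul_of_nonneg_left hbud hrate
  have h3 := mul_le_mul_of_nonneg_right hcard hV
  have h4 := mul_le_mul_of_nonneg_right hcard hU
  have h5 := mul_le_mul_of_nonneg_right hcard hN
  linarith

lemma Setup.Large.L_mem (hA : A.Large Z) (hx : A.LossBounded x) {t : ℕ} (ht : t ≤ A.initLen)
    (i : Fin K) : 0 ≤ (A.state x t).L i ∧ (A.state x t).L i ≤ t := by
  induction t with
  | zero => simp [Setup.state, Setup.init]
  | succ t ih =>
    have h1 := ih (by omega)
    have h2 : (A.state x (t + 1)).L i = if i = x.sel t then (A.state x t).L i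
        + x.loss t i (A.action x t i) else (A.state x t).L i := by
      rw [A.state_succ_init x (by omega)]
      rfl
    rw [h2]
    have h3 := hx t (by have := hA.init_lt; omega) i (A.action x t i)
    push_cast
    split_ifs
    · exact ⟨by linarith [h3.1], by linarith [h3.2]⟩
    · exact ⟨h1.1, by linarith⟩

/-- `K log T = √(K * K log² T) ≤ √(K T)` by the assumption on the horizon. -/
lemma Setup.Large.initLen_le (hA : A.Large Z) (hZ : √(K : ℝ) ≤ Z) :
    (A.initLen : ℝ) ≤ 2 * (√(A.T : ℝ) * Z) := by
  have hl := hA.log_ge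
  have h1 := hA.one_le_card
  have h2 : (⌈Real.log A.T⌉₊ : ℝ) < Real.log A.T + 1 := Nat.ceil_lt_add_one (by linarith)
  have h3 : (A.initLen : ℝ) ≤ 2 * (K * Real.log A.T) := by
    unfold Setup.initLen
    push_cast
    nlinarith
  have h4 : (K : ℝ) * Real.log A.T ≤ √(A.T : ℝ) * √(K : ℝ) := by
    rw [← Real.sqrt_mul (Nat.cast_nonneg _)]
    refine Real.le_sqrt_of_sq_le ?_
    have := mul_le_mul_of_nonneg_left hA.card_mul_le (by linarith : (0 : ℝ) ≤ K)
    nlinarith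
  have h5 := mul_le_mul_of_nonneg_left hZ (Real.sqrt_nonneg (A.T : ℝ))
  linarith

/-- The potential is a difference of objective values. The cumulative loss of `j` is at most
`initLen ≤ 2 U`, `psi` is nonpositive at a vertex, and `-psi ≤ 4 ∑ √w / η ≤ 6 U`. -/
lemma Setup.Large.potential_init_le (hA : A.Large Z) (hx : A.LossBounded x) (j : Fin K)
    (hZ : √(K : ℝ) ≤ Z) : A.potential x j A.initLen ≤ 8 * (√(A.T : ℝ) * Z) := by
  have hst := A.isStat x hA.η_pos hA.card_pos (le_refl A.initLen)
  have hpos := A.η_pos x hA.η_pos A.initLen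
  have h1 := hst.value_sub (single_mem_stdSimplex ℝ j).2
  rw [sum_mul_single] at h1
  have h2 := hA.L_mem hx le_rfl j
  have h3 := hA.initLen_le hZ
  have h4 : 0 ≤ ∑ i, (A.state x A.initLen).L i * (A.state x A.initLen).w i :=
    Finset.sum_nonneg fun i _ => mul_nonneg (hA.L_mem hx le_rfl i).1 (hst.1 i).le
  have h5 : psi (A.state x A.initLen).η (Pi.single j 1) ≤ 0 := by
    unfold psi
    have : 0 ≤ ∑ i, 1 / (A.state x A.initLen).η i * (√((Pi.single j 1 : Fin K → ℝ) i)
        - (Pi.single j 1 : Fin K → ℝ) i / 2) := by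
      refine Finset.sum_nonneg fun i _ => mul_nonneg ?_ ?_
      · have := hpos i
        positivity
      · have hu := single_mem_stdSimplex ℝ j
        exact sqrt_sub_half_nonneg (hu.1 i) (le_one_of_mem_stdSimplex hu i)
    linarith
  have h6 : -(4 * ∑ i, 1 / (A.state x A.initLen).η i * √((A.state x A.initLen).w i))
      ≤ psi (A.state x A.initLen).η (A.state x A.initLen).w := by
    unfold psi
    have : ∑ i, 1 / (A.state x A.initLen).η i * (√((A.state x A.initLen).w i)
          - (A.state x A.initLen).w i / 2)
        ≤ ∑ i, 1 / (A.state x A.initLen).η i * √((A.state x A.initLen).w i) := by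
      refine Finset.sum_le_sum fun i _ => mul_le_mul_of_nonneg_left ?_ ?_
      · have := hst.1 i
        linarith
      · have := hpos i
        positivity
    linarith
  have h7 := hA.sum_inv_η_le x A.initLen hst.mem_stdSimplex
  have h8 := mul_le_mul_of_nonneg_right (hA.sqrt_succ_le hA.init_lt.le) hA.Z_nonneg
  unfold Setup.potential
  linarith [h2.2]

/-- The regret inequality summed over all rounds after the initial phase. -/
lemma Setup.Large.sum_inner_le (hA : A.Large Z) (hx : A.LossBounded x) (j : Fin K) :
    ∑ t ∈ Finset.Ico A.initLen A.T,
        (∑ i, A.rescaledLoss x t i * (A.state x t).w i - A.rescaledLoss x t j)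
      ≤ A.potential x j A.initLen - A.potential x j A.T
        - (1 - 1 / beta A.T) * ∑ t ∈ Finset.Ico A.initLen A.T, A.gain x j t
        + ∑ t ∈ Finset.Ico A.initLen A.T, A.noise x Z t := by
  have h1 : ∑ t ∈ Finset.Ico A.initLen A.T, (A.potential x j (t + 1) - A.potential x j t)
      = A.potential x j A.T - A.potential x j A.initLen := by
    exact Finset.sum_Ico_sub _ hA.init_lt.le
  have h2 : ∑ t ∈ Finset.Ico A.initLen A.T,
        (∑ i, A.rescaledLoss x t i * (A.state x t).w i - A.rescaledLoss x t j)
      ≤ ∑ t ∈ Finset.Ico A.initLen A.T, (-(A.potential x j (t + 1) - A.potential x j t)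
        - (1 - 1 / beta A.T) * A.gain x j t + A.noise x Z t) := by
    refine Finset.sum_le_sum fun t ht => ?_
    rw [Finset.mem_Ico] at ht
    have := hA.potential_succ_le hx j ht.1 ht.2
    linarith
  have h3 : ∑ t ∈ Finset.Ico A.initLen A.T, (-(A.potential x j (t + 1) - A.potential x j t)
        - (1 - 1 / beta A.T) * A.gain x j t + A.noise x Z t)
      = -(A.potential x j A.T - A.potential x j A.initLen)
        - (1 - 1 / beta A.T) * ∑ t ∈ Finset.Ico A.initLen A.T, A.gain x j t
        + ∑ t ∈ Finset.Ico A.initLen A.T, A.noise x Z t := by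
    rw [Finset.sum_add_distrib, Finset.sum_sub_distrib, Finset.sum_neg_distrib, h1,
      ← Finset.mul_sum]
  linarith

/-- The cost of mixing with the uniform distribution. -/
noncomputable def Setup.mixCost (A : Setup K k) (x : Path K k) (t : ℕ) : ℝ :=
  1 / ((A.T : ℝ) * K) * (1 / (K : ℝ)) * ∑ i, if x.sel t = i then 1 / A.prob x t i else 0

/-- The pathwise regret bound. -/
theorem Setup.Large.pathwise_regret_le (hA : A.Large Z) (hx : A.LossBounded x) {j : Fin K}
    (hj : A.η j ≤ 1) (hZ : √(K : ℝ) ≤ Z) {R : ℕ → ℝ}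
    (hR : ∀ s ∈ Finset.Icc 1 A.T, R s ≤ (1 - 1 / beta A.T) * (√(s : ℝ) / (50 * A.η j))) :
    ∑ t ∈ Finset.Ico A.initLen A.T,
        (x.loss t (x.sel t) (A.action x t (x.sel t)) - A.rescaledLoss x t j)
      + ∑ τ ∈ A.epochs, √(A.rho x j τ) * R (A.epochRounds τ).card
      ≤ 19 * (√(A.T : ℝ) * Z)
        + ∑ t ∈ Finset.Ico A.initLen A.T, (2 * A.noise x Z t + A.mixCost x t
          + 0.0303 * (1 - 1 / beta A.T) * A.excess x j t) := by
  have h1 := hA.sum_inner_le hx j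
  have h2 := hA.sum_sqrt_rho_le hx hj hR
  have h3 := hA.potential_init_le hx j hZ
  have h4 : ∑ t ∈ Finset.Ico A.initLen A.T,
        (x.loss t (x.sel t) (A.action x t (x.sel t)) - A.rescaledLoss x t j)
      ≤ ∑ t ∈ Finset.Ico A.initLen A.T,
        ((∑ i, A.rescaledLoss x t i * (A.state x t).w i - A.rescaledLoss x t j)
          + A.mixCost x t) := by
    refine Finset.sum_le_sum fun t ht => ?_
    rw [Finset.mem_Ico] at ht
    have := hA.loss_le hx ht.1 ht.2
    unfold Setup.mixCost
    linarith
  rw [Finset.sum_add_distrib] at h4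
  rw [Finset.sum_add_distrib, Finset.sum_add_distrib, ← Finset.mul_sum, ← Finset.mul_sum]
  linarith

end Pathwise

/-! ### Expectations -/

section Expectation

variable {A : Setup K k} {Z : ℝ} {Ω : Type*} {mΩ : MeasurableSpace Ω} {P : Measure Ω}
  {ℱ : Filtration ℕ mΩ} {X : Ω → Path K k}

lemma aestronglyMeasurable_comp {m : MeasurableSpace Ω} {G : Ω → ℝ} {φ : ℝ → ℝ}
    (hφ : Measurable φ) (hG : AEStronglyMeasurable[m] G P) :
    AEStronglyMeasurable[m] (fun ω => φ (G ω)) P := by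
  obtain ⟨g, hg, hgG⟩ := hG
  exact ⟨fun ω => φ (g ω), (hφ.comp hg.measurable).stronglyMeasurable, hgG.fun_comp φ⟩

lemma IsRun.lossBounded (h : IsRun A P ℱ X) (ω : Ω) : A.LossBounded (X ω) := h.loss_mem ω

/-- Measurability of the state is never assumed. It is the sampling law that identifies the
probabilities almost everywhere with a conditional expectation. -/
lemma IsRun.aestronglyMeasurable_prob (h : IsRun A P ℱ X) {t : ℕ} (ht : A.initLen ≤ t)
    (htT : t < A.T) (i : Fin K) :
    AEStronglyMeasurable[ℱ t] (fun ω => A.prob (X ω) t i) P :=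
  ⟨_, stronglyMeasurable_condExp, (h.sel_law t htT ht i).symm⟩

lemma IsRun.stronglyMeasurable_loss_action (h : IsRun A P ℱ X) {t : ℕ} (htT : t < A.T)
    (i : Fin K) :
    StronglyMeasurable[ℱ t] fun ω => (X ω).loss t i (A.action (X ω) t i) := by
  have h1 : (fun ω => (X ω).loss t i (A.action (X ω) t i))
      = fun ω => ∑ a, if A.action (X ω) t i = a then (X ω).loss t i a else 0 := by
    funext ω
    simp
  rw [h1]
  refine Measurable.stronglyMeasurable (Finset.measurable_sum _ fun a _ => ?_)
  refine Measurable.ite ?_ (h.loss_adapted t htT i a) measurable_const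
  exact h.action_adapted t htT i (measurableSet_singleton a)

lemma IsRun.measurableSet_sel (h : IsRun A P ℱ X) {t : ℕ} (htT : t < A.T) (i : Fin K) :
    MeasurableSet {ω | (X ω).sel t = i} :=
  ℱ.le (t + 1) _ (h.sel_adapted t htT (measurableSet_singleton i))

lemma IsRun.aestronglyMeasurable_inv_prob (h : IsRun A P ℱ X) {t : ℕ} (ht : A.initLen ≤ t)
    (htT : t < A.T) (i : Fin K) :
    AEStronglyMeasurable[ℱ t] (fun ω => 1 / A.prob (X ω) t i) P :=
  aestronglyMeasurable_comp (φ := fun y => 1 / y) (measurable_const.div measurable_id)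
    (h.aestronglyMeasurable_prob ht htT i)

lemma IsRun.aestronglyMeasurable_estimate (h : IsRun A P ℱ X) {t : ℕ} (ht : A.initLen ≤ t)
    (htT : t < A.T) (i : Fin K) :
    AEStronglyMeasurable[ℱ t]
      (fun ω => (X ω).loss t i (A.action (X ω) t i) * (1 / A.prob (X ω) t i)) P :=
  (h.stronglyMeasurable_loss_action htT i).aestronglyMeasurable.mul
    (h.aestronglyMeasurable_inv_prob ht htT i)

lemma Setup.LossBounded.abs_loss_le {x : Path K k} (hx : A.LossBounded x) {t : ℕ} (ht : t < A.T)
    (i : Fin K) (a : Fin (k i)) : |x.loss t i a| ≤ 1 := by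
  have := hx t ht i a
  rw [abs_le]
  exact ⟨by linarith [this.1], this.2⟩

/-- The uniform part of the mixture bounds the importance weights; this serves integrability only.
-/
lemma Setup.Large.abs_inv_prob_le (hA : A.Large Z) {t : ℕ} (ht : A.initLen ≤ t) (i : Fin K)
    (x : Path K k) : |1 / A.prob x t i| ≤ (A.T : ℝ) * K * K := by
  have h1 := hA.min_le_prob (x := x) ht i
  have h2 := hA.horizon_ge
  have h3 := hA.one_le_card
  have h4 := hA.prob_pos (x := x) ht i
  rw [abs_of_pos (by positivity), div_le_iff₀ h4]
  have h5 := mul_le_mul_of_nonneg_left h1 (show (0 : ℝ) ≤ A.T * K * K by positivity)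
  have h6 : (A.T : ℝ) * K * K * (1 / (A.T * K) * (1 / K)) = 1 := by
    field_simp
  linarith

lemma Setup.Large.abs_estimate_le (hA : A.Large Z) (h : IsRun A P ℱ X) {t : ℕ}
    (ht : A.initLen ≤ t) (htT : t < A.T) (i : Fin K) (ω : Ω) :
    |(X ω).loss t i (A.action (X ω) t i) * (1 / A.prob (X ω) t i)| ≤ (A.T : ℝ) * K * K := by
  rw [abs_mul]
  have h1 := (h.lossBounded ω).abs_loss_le htT i (A.action (X ω) t i)
  have h2 := hA.abs_inv_prob_le ht i (X ω)
  calc _ ≤ 1 * |1 / A.prob (X ω) t i| := mul_le_mul_of_nonneg_right h1 (abs_nonneg _)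
    _ ≤ _ := by rw [one_mul]; exact h2

lemma IsRun.stronglyMeasurable_loss (h : IsRun A P ℱ X) {t : ℕ} (htT : t < A.T) (i : Fin K)
    (a : Fin (k i)) : StronglyMeasurable fun ω => (X ω).loss t i a :=
  ((h.loss_adapted t htT i a).mono (ℱ.le t) le_rfl).stronglyMeasurable

/-- Mixing is a strictly increasing affine map, so crossing is an event about the sampling
probabilities up to round `t`, which are measurable up to null sets. -/
lemma IsRun.aestronglyMeasurable_crossed (hA : A.Large Z) (h : IsRun A P ℱ X) (j : Fin K) {t : ℕ}
    (ht : A.initLen ≤ t) (htT : t < A.T) :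
    AEStronglyMeasurable[ℱ t] ({ω | A.Crossed (X ω) j t}.indicator fun _ => (1 : ℝ)) P := by
  set c : ℝ := 1 / threshold (A.top - 1)
  set b : ℝ := (1 - 1 / ((A.T : ℝ) * K)) * c + 1 / ((A.T : ℝ) * K) * (1 / (K : ℝ))
  have hs : A.initLen ≤ A.start (A.epochOf t) :=
    A.initLen_le_start (A.one_le_epochOf hA.card_pos ht)
  have hw : ∀ (x : Path K k) (r : ℕ), (A.state x r).w j ≤ c ↔ A.prob x r j ≤ b := by
    intro x r
    have h1 := hA.mix_le
    unfold Setup.prob Setup.mixed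
    rw [add_le_add_iff_right, mul_le_mul_iff_right₀ (by linarith)]
  choose! g hg hgp using fun (r : ℕ) (hr : A.initLen ≤ r ∧ r < A.T) =>
    h.aestronglyMeasurable_prob hr.1 hr.2 j
  set S := Finset.Icc (A.start (A.epochOf t)) t
  have hS : ∀ r ∈ S, A.initLen ≤ r ∧ r < A.T := fun r hr => by
    rw [Finset.mem_Icc] at hr
    omega
  have hall : ∀ᵐ ω ∂P, ∀ r ∈ S, A.prob (X ω) r j = g r ω :=
    (Filter.eventually_all_finset S).2 fun r hr => hgp r (hS r hr)
  refine ⟨(⋃ r ∈ S, {ω | g r ω ≤ b}).indicator fun _ => 1, ?_, ?_⟩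
  · refine stronglyMeasurable_const.indicator (Finset.measurableSet_biUnion _ fun r hr => ?_)
    have h1 : MeasurableSet[ℱ r] {ω | g r ω ≤ b} :=
      measurableSet_le (hg r (hS r hr)).measurable measurable_const
    exact ℱ.mono (Finset.mem_Icc.1 hr).2 _ h1
  · filter_upwards [hall] with ω hω
    have h1 : ω ∈ {ω | A.Crossed (X ω) j t} ↔ ω ∈ ⋃ r ∈ S, {ω | g r ω ≤ b} := by
      simp only [Set.mem_ofPred_eq, Set.mem_iUnion, Setup.Crossed]
      constructor
      · rintro ⟨r, hr1, hr2, hr3⟩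
        have hr := Finset.mem_Icc.2 ⟨hr1, hr2⟩
        exact ⟨r, hr, by rw [← hω r hr]; exact (hw _ _).1 hr3⟩
      · rintro ⟨r, hr, hr3⟩
        have hr' := Finset.mem_Icc.1 hr
        exact ⟨r, hr'.1, hr'.2, (hw _ _).2 (by rw [hω r hr]; exact hr3)⟩
    by_cases h2 : ω ∈ {ω | A.Crossed (X ω) j t}
    · rw [Set.indicator_of_mem h2, Set.indicator_of_mem (h1.1 h2)]
    · rw [Set.indicator_of_notMem h2, Set.indicator_of_notMem fun h3 => h2 (h1.2 h3)]

variable [IsProbabilityMeasure P]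

lemma integrable_of_abs_le {G : Ω → ℝ} (hG : AEStronglyMeasurable G P) {B : ℝ}
    (hB : ∀ ω, |G ω| ≤ B) : Integrable G P :=
  Integrable.of_bound hG B (ae_of_all _ hB)

lemma IsRun.integrable_ite_sel (h : IsRun A P ℱ X) {t : ℕ} (htT : t < A.T) (i : Fin K)
    {G : Ω → ℝ} (hG : AEStronglyMeasurable[ℱ t] G P) {B : ℝ} (hB : ∀ ω, |G ω| ≤ B) :
    Integrable (fun ω => if (X ω).sel t = i then G ω else 0) P := by
  have h1 := (integrable_of_abs_le (hG.mono (ℱ.le t)) hB).indicator (h.measurableSet_sel htT i)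
  refine h1.congr (ae_of_all _ fun ω => ?_)
  simp [Set.indicator_apply]

/-- Sampling: the indicator of the selected base algorithm may be replaced by its probability. -/
lemma IsRun.integral_ite_sel (h : IsRun A P ℱ X) {t : ℕ} (ht : A.initLen ≤ t) (htT : t < A.T)
    (i : Fin K) {G : Ω → ℝ} (hG : AEStronglyMeasurable[ℱ t] G P) {B : ℝ}
    (hB : ∀ ω, |G ω| ≤ B) :
    ∫ ω, (if (X ω).sel t = i then G ω else 0) ∂P = ∫ ω, G ω * A.prob (X ω) t i ∂P := by
  set I : Ω → ℝ := {ω | (X ω).sel t = i}.indicator fun _ => (1 : ℝ) with hI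
  have h1 : (fun ω => if (X ω).sel t = i then G ω else 0) = G * I := by
    funext ω
    simp [hI, Set.indicator_apply]
  have h2 := h.integrable_ite_sel htT i hG hB
  rw [h1] at h2 ⊢
  have h3 : Integrable I P :=
    (integrable_const (1 : ℝ)).indicator (h.measurableSet_sel htT i)
  have h4 := condExp_mul_of_aestronglyMeasurable_left hG h2 h3
  rw [← integral_condExp (ℱ.le t)]
  refine integral_congr_ae ?_
  filter_upwards [h4, h.sel_law t htT ht i] with ω h5 h6
  rw [h5, Pi.mul_apply, h6]

lemma Setup.rescaledLoss_eq_ite (A : Setup K k) (x : Path K k) (t : ℕ) (i : Fin K) :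
    A.rescaledLoss x t i
      = if x.sel t = i then x.loss t i (A.action x t i) * (1 / A.prob x t i) else 0 := by
  rw [A.rescaledLoss_eq, mul_one_div]
  simp only [eq_comm]

lemma Setup.Large.integrable_rescaledLoss (hA : A.Large Z) (h : IsRun A P ℱ X) {t : ℕ}
    (ht : A.initLen ≤ t) (htT : t < A.T) (i : Fin K) :
    Integrable (fun ω => A.rescaledLoss (X ω) t i) P := by
  simp_rw [Setup.rescaledLoss_eq_ite]
  exact h.integrable_ite_sel htT i (h.aestronglyMeasurable_estimate ht htT i)
    (hA.abs_estimate_le h ht htT i)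

lemma IsRun.integrable_loss (h : IsRun A P ℱ X) {t : ℕ} (htT : t < A.T) (i : Fin K)
    (a : Fin (k i)) : Integrable (fun ω => (X ω).loss t i a) P :=
  integrable_of_abs_le (h.stronglyMeasurable_loss htT i a).aestronglyMeasurable
    fun ω => (h.lossBounded ω).abs_loss_le htT i a

/-! #### The excess after the last threshold -/

lemma Setup.excess_eq (A : Setup K k) (x : Ω → Path K k) (j : Fin K) (t : ℕ) (ω : Ω) :
    A.excess (x ω) j t
      = (if (x ω).sel t = j then {ω | A.Crossed (x ω) j t}.indicator (fun _ => (1 : ℝ)) ω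
          * ((x ω).loss t j (A.action (x ω) t j) * (1 / A.prob (x ω) t j)) else 0)
        - {ω | A.Crossed (x ω) j t}.indicator (fun _ => (1 : ℝ)) ω := by
  unfold Setup.excess
  rw [A.rescaledLoss_eq_ite]
  by_cases h1 : A.Crossed (x ω) j t
  · rw [if_pos h1, Set.indicator_of_mem (show ω ∈ {ω | A.Crossed (x ω) j t} from h1), one_mul]
  · rw [if_neg h1, Set.indicator_of_notMem (show ω ∉ {ω | A.Crossed (x ω) j t} from h1), zero_mul,
      ite_self, sub_zero]

lemma Setup.abs_crossed_le (A : Setup K k) (X : Ω → Path K k) (j : Fin K) (t : ℕ) (ω : Ω) :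
    |{ω | A.Crossed (X ω) j t}.indicator (fun _ => (1 : ℝ)) ω| ≤ 1 := by
  by_cases h : ω ∈ {ω | A.Crossed (X ω) j t}
  · rw [Set.indicator_of_mem h, abs_one]
  · rw [Set.indicator_of_notMem h, abs_zero]
    exact zero_le_one

/-- Whether the threshold has been crossed is known before sampling, and the conditional mean of the
rescaled loss is a loss, at most `1`. -/
lemma Setup.Large.integrable_excess (hA : A.Large Z) (h : IsRun A P ℱ X) (j : Fin K) {t : ℕ}
    (ht : A.initLen ≤ t) (htT : t < A.T) :
    Integrable (fun ω => A.excess (X ω) j t) P ∧ ∫ ω, A.excess (X ω) j t ∂P ≤ 0 := by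
  have hc := h.aestronglyMeasurable_crossed hA j ht htT
  have h1 := A.abs_crossed_le X j t
  have he := h.aestronglyMeasurable_estimate ht htT j
  have hB : ∀ ω, |{ω | A.Crossed (X ω) j t}.indicator (fun _ => (1 : ℝ)) ω
      * ((X ω).loss t j (A.action (X ω) t j) * (1 / A.prob (X ω) t j))| ≤ 1 * (A.T * K * K) := by
    intro ω
    rw [abs_mul]
    exact mul_le_mul (h1 ω) (hA.abs_estimate_le h ht htT j ω) (abs_nonneg _) zero_le_one
  have h2 := integrable_of_abs_le (hc.mono (ℱ.le t)) h1
  have h3 := h.integrable_ite_sel htT j (hc.mul he) hB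
  simp only [Pi.mul_apply] at h3
  simp_rw [A.excess_eq X]
  refine ⟨h3.sub h2, ?_⟩
  rw [integral_sub h3 h2]
  have h4 := h.integral_ite_sel ht htT j (hc.mul he) hB
  simp only [Pi.mul_apply] at h4
  rw [h4, sub_nonpos]
  have h5 : ∀ ω, {ω | A.Crossed (X ω) j t}.indicator (fun _ => (1 : ℝ)) ω
        * ((X ω).loss t j (A.action (X ω) t j) * (1 / A.prob (X ω) t j)) * A.prob (X ω) t j
      = {ω | A.Crossed (X ω) j t}.indicator (fun _ => (1 : ℝ)) ω
        * (X ω).loss t j (A.action (X ω) t j) := by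
    intro ω
    have := (hA.prob_pos (x := X ω) ht j).ne'
    field_simp
  simp_rw [h5]
  refine integral_mono_of_nonneg (ae_of_all _ fun ω => ?_) h2 (ae_of_all _ fun ω => ?_)
  · exact mul_nonneg (Set.indicator_nonneg (fun _ _ => zero_le_one) _)
      (h.lossBounded ω t htT _ _).1
  · exact mul_le_of_le_one_right (Set.indicator_nonneg (fun _ _ => zero_le_one) _)
      (h.lossBounded ω t htT _ _).2

/-! #### The cost of mixing and the noise -/

/-- Each importance-weighted indicator has mean `1`, so the sum of `K` of them with weight `1/(T
K²)` has mean `1/(T K)`. -/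
lemma Setup.Large.integral_mixCost (hA : A.Large Z) (h : IsRun A P ℱ X) {t : ℕ}
    (ht : A.initLen ≤ t) (htT : t < A.T) :
    Integrable (fun ω => A.mixCost (X ω) t) P ∧ ∫ ω, A.mixCost (X ω) t ∂P ≤ 1 / A.T := by
  have h1 := fun i => h.integrable_ite_sel htT i (h.aestronglyMeasurable_inv_prob ht htT i)
    (fun ω => hA.abs_inv_prob_le ht i (X ω))
  have h2 : ∀ i, ∫ ω, (if (X ω).sel t = i then 1 / A.prob (X ω) t i else 0) ∂P = 1 := by
    intro i
    rw [h.integral_ite_sel ht htT i (h.aestronglyMeasurable_inv_prob ht htT i)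
      (fun ω => hA.abs_inv_prob_le ht i (X ω))]
    have h3 : ∀ ω, 1 / A.prob (X ω) t i * A.prob (X ω) t i = 1 := fun ω =>
      one_div_mul_cancel (hA.prob_pos ht i).ne'
    rw [integral_congr_ae (ae_of_all _ h3)]
    simp
  unfold Setup.mixCost
  refine ⟨(integrable_finsetSum _ fun i _ => h1 i).const_mul _, ?_⟩
  rw [integral_const_mul, integral_finsetSum _ fun i _ => h1 i]
  simp_rw [h2]
  have h4 := hA.one_le_card
  have h5 := hA.horizon_ge
  rw [Finset.sum_const, Finset.card_univ, Fintype.card_fin, nsmul_eq_mul, mul_one]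
  have h6 : 1 / ((A.T : ℝ) * K) * (1 / K) * K = 1 / A.T * (1 / K) := by field_simp
  rw [h6]
  refine mul_le_of_le_one_right (by positivity) ?_
  rw [div_le_one (by linarith)]
  exact h4

/-- Sampling turns the weight `1/√p` into `√p`, and `p` lies in the simplex; hence `6 Z + 16 Z`. -/
lemma Setup.Large.integral_noise (hA : A.Large Z)
    (hZ : ∀ w ∈ stdSimplex ℝ (Fin K), ∑ i, A.η i * √(w i) ≤ Z) (h : IsRun A P ℱ X) {t : ℕ}
    (ht : A.initLen ≤ t) (htT : t < A.T) :
    Integrable (fun ω => A.noise (X ω) Z t) P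
      ∧ ∫ ω, A.noise (X ω) Z t ∂P ≤ 22 * Z * (1 / √((t : ℝ) + 1)) := by
  have hp := fun i => h.aestronglyMeasurable_prob ht htT i
  have hm : ∀ i, AEStronglyMeasurable[ℱ t] (fun ω => 1 / √(A.prob (X ω) t i)) P := fun i =>
    aestronglyMeasurable_comp (φ := fun y => 1 / √y)
      (measurable_const.div Real.continuous_sqrt.measurable) (hp i)
  have hle1 : ∀ i ω, A.prob (X ω) t i ≤ 1 := fun i ω => by
    have := hA.prob_mem (x := X ω) ht
    rw [← this.2]
    exact Finset.single_le_sum (fun i _ => this.1 i) (Finset.mem_univ i)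
  have hB : ∀ i ω, |1 / √(A.prob (X ω) t i)| ≤ (A.T : ℝ) * K * K := by
    intro i ω
    have h1 := hA.prob_pos (x := X ω) ht i
    have h2 := hA.abs_inv_prob_le ht i (X ω)
    rw [abs_of_nonneg (by positivity)] at h2 ⊢
    refine le_trans (one_div_le_one_div_of_le h1 ?_) h2
    exact Real.le_sqrt_of_sq_le (by nlinarith [hle1 i ω])
  have h1 := fun i => (h.integrable_ite_sel htT i (hm i) (hB i)).const_mul (A.η i)
  have h2 : ∀ i, ∫ ω, (if (X ω).sel t = i then 1 / √(A.prob (X ω) t i) else 0) ∂P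
      = ∫ ω, √(A.prob (X ω) t i) ∂P := by
    intro i
    rw [h.integral_ite_sel ht htT i (hm i) (hB i)]
    refine integral_congr_ae (ae_of_all _ fun ω => ?_)
    have h3 := hA.prob_pos (x := X ω) ht i
    have h4 : 0 < √(A.prob (X ω) t i) := Real.sqrt_pos.2 h3
    change 1 / √(A.prob (X ω) t i) * A.prob (X ω) t i = √(A.prob (X ω) t i)
    rw [one_div_mul_eq_div, Real.div_sqrt]
  have h3 : ∀ i, Integrable (fun ω => A.η i * √(A.prob (X ω) t i)) P := fun i => by
    refine (integrable_of_abs_le (B := 1) ((aestronglyMeasurable_comp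
      Real.continuous_sqrt.measurable (hp i)).mono (ℱ.le t)) fun ω => ?_).const_mul _
    rw [abs_of_nonneg (Real.sqrt_nonneg _)]
    exact Real.sqrt_le_one.2 (hle1 i ω)
  have h4 : ∫ ω, ∑ i, A.η i * (if (X ω).sel t = i then 1 / √(A.prob (X ω) t i) else 0) ∂P
      ≤ Z := by
    rw [integral_finsetSum _ fun i _ => h1 i]
    simp_rw [integral_const_mul, h2, ← integral_const_mul]
    rw [← integral_finsetSum _ fun i _ => h3 i]
    calc _ ≤ ∫ _, Z ∂P := integral_mono (integrable_finsetSum _ fun i _ => h3 i)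
          (integrable_const _) fun ω => hZ _ (hA.prob_mem ht)
      _ = Z := by simp
  have h5 := (integrable_finsetSum Finset.univ fun i _ => h1 i).const_mul 6
  unfold Setup.noise
  refine ⟨(h5.add (integrable_const _)).div_const _, ?_⟩
  rw [integral_div, integral_add h5 (integrable_const _), integral_const_mul]
  have h6 : ∫ _ : Ω, 16 * Z ∂P = 16 * Z := by simp
  rw [h6, div_eq_mul_one_div]
  exact mul_le_mul_of_nonneg_right (by linarith) (by positivity)

lemma sum_one_div_sqrt_succ_le (n : ℕ) :
    ∑ t ∈ Finset.range n, 1 / √((t : ℝ) + 1) ≤ 2 * √(n : ℝ) := by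
  induction n with
  | zero => simp
  | succ n ih =>
    rw [Finset.sum_range_succ]
    push_cast
    have h1 : √(n : ℝ) ^ 2 = n := Real.sq_sqrt (Nat.cast_nonneg n)
    have h2 : √((n : ℝ) + 1) ^ 2 = n + 1 := Real.sq_sqrt (by positivity)
    have h3 : 0 < √((n : ℝ) + 1) := Real.sqrt_pos.2 (by positivity)
    have h4 : 1 / √((n : ℝ) + 1) ≤ 2 * √((n : ℝ) + 1) - 2 * √(n : ℝ) := by
      rw [div_le_iff₀ h3]
      nlinarith [sq_nonneg (√((n : ℝ) + 1) - √(n : ℝ))]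
    linarith

/-! #### The expected regret -/

/-- The expected regret over the rounds after the initial phase. -/
lemma Setup.Large.expectedRegret_le (hA : A.Large Z)
    (hη : ∀ w ∈ stdSimplex ℝ (Fin K), ∑ i, A.η i * √(w i) ≤ Z) (hZ : √(K : ℝ) ≤ Z)
    (h : IsRun A P ℱ X) {j : Fin K} (hj : A.η j ≤ 1) (a : Fin (k j)) {R : ℕ → ℝ}
    (hR0 : ∀ s, 0 ≤ R s) (hstab : A.IsStable P X j a R)
    (hR : ∀ s ∈ Finset.Icc 1 A.T, R s ≤ (1 - 1 / beta A.T) * (√(s : ℝ) / (50 * A.η j))) :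
    A.expectedRegret P X j a ≤ 110 * (√(A.T : ℝ) * Z) := by
  classical
  have hU : 1 ≤ √(A.T : ℝ) * Z := by
    have h1 := hA.one_le_sqrt_horizon
    have h2 : (1 : ℝ) ≤ √(K : ℝ) := Real.one_le_sqrt.2 hA.one_le_card
    nlinarith
  -- A regret that is not integrable has Bochner integral `0`, below the bound.
  by_cases hint : Integrable (fun ω => ∑ t ∈ Finset.range A.T,
    ((X ω).loss t ((X ω).sel t) (A.action (X ω) t ((X ω).sel t)) - (X ω).loss t j a)) P
  swap
  · unfold Setup.expectedRegret
    rw [integral_undef hint]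
    linarith
  -- If `√ρ` is not integrable, its integral in the stability assumption is `0`. Replacing it by `0`
  -- in this case keeps that integral and, as `R ≥ 0`, only weakens the pathwise inequality.
  set r : ℕ → Ω → ℝ := fun τ ω =>
    if Integrable (fun ω => √(A.rho (X ω) j τ)) P then √(A.rho (X ω) j τ) else 0 with hr
  have hr_int : ∀ τ, Integrable (r τ) P := fun τ => by
    by_cases hi : Integrable (fun ω => √(A.rho (X ω) j τ)) P
    · simpa only [hr, if_pos hi] using hi
    · simp only [hr, if_neg hi]
      exact integrable_const _
  have hr_eq : ∀ τ, ∫ ω, r τ ω ∂P = ∫ ω, √(A.rho (X ω) j τ) ∂P := fun τ => by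
    by_cases hi : Integrable (fun ω => √(A.rho (X ω) j τ)) P
    · simp only [hr, if_pos hi]
    · simp only [hr, if_neg hi]
      rw [integral_undef hi, integral_zero]
  have hr_le : ∀ τ ω, r τ ω ≤ √(A.rho (X ω) j τ) := fun τ ω => by
    simp only [hr]
    split_ifs
    · exact le_rfl
    · exact Real.sqrt_nonneg _
  set M := Finset.Ico A.initLen A.T with hM
  set D : Ω → ℝ := fun ω => ∑ t ∈ M, (A.rescaledLoss (X ω) t j - (X ω).loss t j a) with hD
  have hD_int : Integrable D P := integrable_finsetSum _ fun t ht => by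
    rw [hM, Finset.mem_Ico] at ht
    exact (hA.integrable_rescaledLoss h ht.1 ht.2 j).sub (h.integrable_loss ht.2 j a)
  set E : ℕ → Ω → ℝ := fun t ω => 2 * A.noise (X ω) Z t + A.mixCost (X ω) t
    + 0.0303 * (1 - 1 / beta A.T) * A.excess (X ω) j t with hE
  have hE_int : ∀ t ∈ M, Integrable (E t) P
      ∧ ∫ ω, E t ω ∂P ≤ 44 * Z * (1 / √((t : ℝ) + 1)) + 1 / A.T := by
    intro t ht
    rw [hM, Finset.mem_Ico] at ht
    have h1 := hA.integral_noise hη h ht.1 ht.2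
    have h2 := hA.integral_mixCost h ht.1 ht.2
    have h3 := hA.integrable_excess h j ht.1 ht.2
    have h4 := rate_nonneg A.T
    have h5 := (h1.1.const_mul 2).add h2.1
    have h6 := h3.1.const_mul (0.0303 * (1 - 1 / beta A.T))
    refine ⟨h5.add h6, ?_⟩
    have h7 : ∫ ω, E t ω ∂P = 2 * ∫ ω, A.noise (X ω) Z t ∂P + ∫ ω, A.mixCost (X ω) t ∂P
        + 0.0303 * (1 - 1 / beta A.T) * ∫ ω, A.excess (X ω) j t ∂P := by
      rw [← integral_const_mul, ← integral_const_mul, ← integral_add (h1.1.const_mul 2) h2.1]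
      exact integral_add h5 h6
    have h8 : 0.0303 * (1 - 1 / beta A.T) * ∫ ω, A.excess (X ω) j t ∂P ≤ 0 :=
      mul_nonpos_of_nonneg_of_nonpos (by positivity) h3.2
    rw [h7]
    linarith [h1.2, h2.2]
  have hEs_int : Integrable (fun ω => ∑ t ∈ M, E t ω) P :=
    integrable_finsetSum _ fun t ht => (hE_int t ht).1
  have hrs_int : Integrable (fun ω => ∑ τ ∈ A.epochs, r τ ω * R (A.epochRounds τ).card) P :=
    integrable_finsetSum _ fun τ _ => (hr_int τ).mul_const _
  -- `21 = 19 + 2`, where `2 U` bounds the initial phase. Stability will show that `D` is outweighed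
  -- in expectation by the subtracted sum.
  have hpath : ∀ ω, ∑ t ∈ Finset.range A.T,
      ((X ω).loss t ((X ω).sel t) (A.action (X ω) t ((X ω).sel t)) - (X ω).loss t j a)
      ≤ 21 * (√(A.T : ℝ) * Z) + ∑ t ∈ M, E t ω + D ω
        - ∑ τ ∈ A.epochs, r τ ω * R (A.epochRounds τ).card := by
    intro ω
    have hx := h.lossBounded ω
    rw [Finset.range_eq_Ico, ← Finset.sum_Ico_consecutive _ (Nat.zero_le A.initLen) hA.init_lt.le]
    have h1 : ∑ t ∈ Finset.Ico 0 A.initLen,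
        ((X ω).loss t ((X ω).sel t) (A.action (X ω) t ((X ω).sel t)) - (X ω).loss t j a)
        ≤ A.initLen := by
      refine (Finset.sum_le_card_nsmul _ _ 1 fun t ht => ?_).trans (by simp)
      rw [Finset.mem_Ico] at ht
      have htT := ht.2.trans hA.init_lt
      linarith [(hx t htT ((X ω).sel t) (A.action (X ω) t ((X ω).sel t))).2, (hx t htT j a).1]
    have h2 := hA.initLen_le hZ
    have h3 : ∑ t ∈ M, ((X ω).loss t ((X ω).sel t) (A.action (X ω) t ((X ω).sel t))
          - A.rescaledLoss (X ω) t j)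
        + ∑ τ ∈ A.epochs, √(A.rho (X ω) j τ) * R (A.epochRounds τ).card
        ≤ 19 * (√(A.T : ℝ) * Z) + ∑ t ∈ M, E t ω := hA.pathwise_regret_le hx hj hZ hR
    have h4 : ∑ τ ∈ A.epochs, r τ ω * R (A.epochRounds τ).card
        ≤ ∑ τ ∈ A.epochs, √(A.rho (X ω) j τ) * R (A.epochRounds τ).card :=
      Finset.sum_le_sum fun τ _ => mul_le_mul_of_nonneg_right (hr_le τ ω) (hR0 _)
    have h5 : ∑ t ∈ M,
        ((X ω).loss t ((X ω).sel t) (A.action (X ω) t ((X ω).sel t)) - (X ω).loss t j a)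
        = ∑ t ∈ M, ((X ω).loss t ((X ω).sel t) (A.action (X ω) t ((X ω).sel t))
          - A.rescaledLoss (X ω) t j) + D ω := by
      rw [hD, ← Finset.sum_add_distrib]
      exact Finset.sum_congr rfl fun t _ => by ring
    rw [h5]
    linarith
  have hmono := integral_mono hint
    ((((integrable_const _).add hEs_int).add hD_int).sub hrs_int) hpath
  have heq : ∫ ω, (21 * (√(A.T : ℝ) * Z) + ∑ t ∈ M, E t ω + D ω
        - ∑ τ ∈ A.epochs, r τ ω * R (A.epochRounds τ).card) ∂P
      = 21 * (√(A.T : ℝ) * Z) + ∑ t ∈ M, ∫ ω, E t ω ∂P + ∫ ω, D ω ∂P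
        - ∑ τ ∈ A.epochs, (∫ ω, √(A.rho (X ω) j τ) ∂P) * R (A.epochRounds τ).card := by
    have hc : Integrable (fun _ : Ω => 21 * (√(A.T : ℝ) * Z)) P := integrable_const _
    have hc1 : Integrable (fun ω => 21 * (√(A.T : ℝ) * Z) + ∑ t ∈ M, E t ω) P := hc.add hEs_int
    have hc2 : Integrable (fun ω => 21 * (√(A.T : ℝ) * Z) + ∑ t ∈ M, E t ω + D ω) P :=
      hc1.add hD_int
    rw [integral_sub hc2 hrs_int, integral_add hc1 hD_int, integral_add hc hEs_int,
      integral_finsetSum _ fun t ht => (hE_int t ht).1,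
      integral_finsetSum _ fun τ _ => (hr_int τ).mul_const _]
    simp only [integral_mul_const, hr_eq]
    simp
  have hEsum : ∑ t ∈ M, ∫ ω, E t ω ∂P ≤ 88 * (√(A.T : ℝ) * Z) + 1 := by
    have hTpos := hA.horizon_ge
    have hZ0 := hA.Z_nonneg
    calc ∑ t ∈ M, ∫ ω, E t ω ∂P
        ≤ ∑ t ∈ M, (44 * Z * (1 / √((t : ℝ) + 1)) + 1 / A.T) :=
          Finset.sum_le_sum fun t ht => (hE_int t ht).2
      _ ≤ ∑ t ∈ Finset.range A.T, (44 * Z * (1 / √((t : ℝ) + 1)) + 1 / A.T) := by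
          refine Finset.sum_le_sum_of_subset_of_nonneg (fun t ht => ?_) fun t _ _ => by positivity
          exact Finset.mem_range.2 (Finset.mem_Ico.1 ht).2
      _ = 44 * Z * ∑ t ∈ Finset.range A.T, 1 / √((t : ℝ) + 1) + 1 := by
          rw [Finset.sum_add_distrib, ← Finset.mul_sum, Finset.sum_const, Finset.card_range,
            nsmul_eq_mul, mul_one_div_cancel (by linarith)]
      _ ≤ 44 * Z * (2 * √(A.T : ℝ)) + 1 := by
          have := mul_le_mul_of_nonneg_left (sum_one_div_sqrt_succ_le A.T)
            (show 0 ≤ 44 * Z by linarith)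
          linarith
      _ = _ := by ring
  unfold Setup.IsStable at hstab
  unfold Setup.expectedRegret
  have hD_le : ∫ ω, D ω ∂P
      ≤ ∑ τ ∈ A.epochs, (∫ ω, √(A.rho (X ω) j τ) ∂P) * R (A.epochRounds τ).card := hstab
  -- The total is `21 U + 88 U + 1 ≤ 110 U`.
  have hle := hmono.trans_eq heq
  linarith

lemma IsRun.expectedRegret_le_horizon (h : IsRun A P ℱ X) (j : Fin K) (a : Fin (k j)) :
    A.expectedRegret P X j a ≤ A.T := by
  unfold Setup.expectedRegret
  by_cases hint : Integrable (fun ω => ∑ t ∈ Finset.range A.T,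
    ((X ω).loss t ((X ω).sel t) (A.action (X ω) t ((X ω).sel t)) - (X ω).loss t j a)) P
  · refine (integral_mono hint (integrable_const (A.T : ℝ)) fun ω => ?_).trans (by simp)
    have hx := h.lossBounded ω
    refine (Finset.sum_le_card_nsmul _ _ 1 fun t ht => ?_).trans (by simp)
    have htT := Finset.mem_range.1 ht
    linarith [(hx t htT ((X ω).sel t) (A.action (X ω) t ((X ω).sel t))).2, (hx t htT j a).1]
  · rw [integral_undef hint]
    positivity

/-- The regret bound in terms of any `Z` that dominates `∑ᵢ √wᵢ / ηᵢ` and `∑ᵢ ηᵢ √wᵢ` on the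
simplex. -/
theorem IsRun.expectedRegret_le (h : IsRun A P ℱ X) (hT : 2 ≤ A.T)
    (hKT : (K : ℝ) * Real.log A.T ^ 2 ≤ A.T) (hη_pos : ∀ i, 0 < A.η i)
    (hdiv : ∀ w ∈ stdSimplex ℝ (Fin K), ∑ i, √(w i) / A.η i ≤ Z)
    (hη : ∀ w ∈ stdSimplex ℝ (Fin K), ∑ i, A.η i * √(w i) ≤ Z) (hZ : √(K : ℝ) ≤ Z)
    {j : Fin K} (hj : A.η j ≤ 1) (a : Fin (k j)) {R : ℕ → ℝ}
    (hR0 : ∀ s, 0 ≤ R s) (hstab : A.IsStable P X j a R)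
    (hR : ∀ s ∈ Finset.Icc 1 A.T, R s ≤ (1 - 1 / beta A.T) * (√(s : ℝ) / (50 * A.η j))) :
    A.expectedRegret P X j a ≤ Real.exp 1000 * (√(A.T : ℝ) * Z) := by
  have hK : 0 < K := j.pos
  have hK1 : (1 : ℝ) ≤ K := by exact_mod_cast hK
  have hT2 : (2 : ℝ) ≤ A.T := by exact_mod_cast hT
  have hsK : (1 : ℝ) ≤ √(K : ℝ) := Real.one_le_sqrt.2 hK1
  have hsT : (1 : ℝ) ≤ √(A.T : ℝ) := Real.one_le_sqrt.2 (by linarith)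
  have hU : √(A.T : ℝ) ≤ √(A.T : ℝ) * Z := le_mul_of_one_le_right (by linarith) (hsK.trans hZ)
  have hC : (1001 : ℝ) ≤ Real.exp 1000 := by
    have := Real.add_one_le_exp (1000 : ℝ)
    linarith
  have hsq : √(A.T : ℝ) * √(A.T : ℝ) = A.T := Real.mul_self_sqrt (by linarith)
  have htriv := h.expectedRegret_le_horizon j a
  -- For short horizons `T = √T * √T ≤ exp 1000 * √T`; this alone fixes the size of the constant.
  rcases lt_or_ge (Real.log A.T) 1000 with hlog | hlog
  · have h1 : (A.T : ℝ) ≤ Real.exp 1000 := by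
      rw [← Real.log_le_iff_le_exp (by linarith)]
      exact hlog.le
    have h2 : √(A.T : ℝ) ≤ Real.exp 1000 := by nlinarith
    calc _ ≤ (A.T : ℝ) := htriv
      _ = √(A.T : ℝ) * √(A.T : ℝ) := hsq.symm
      _ ≤ Real.exp 1000 * (√(A.T : ℝ) * Z) := mul_le_mul h2 hU (by linarith) (by linarith)
  suffices hs : A.expectedRegret P X j a ≤ 110 * (√(A.T : ℝ) * Z) by
    have := mul_le_mul_of_nonneg_right (show (110 : ℝ) ≤ Real.exp 1000 by linarith)
      (show 0 ≤ √(A.T : ℝ) * Z by linarith)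
    linarith
  -- If the initial phase fills the horizon, `T ≤ initLen` is itself of order `√(K T)`.
  rcases lt_or_ge A.initLen A.T with hI | hI
  · exact Setup.Large.expectedRegret_le ⟨hη_pos, hlog, hKT, hI, hK, hdiv⟩ hη hZ h hj a hR0 hstab hR
  · have h1 : (A.T : ℝ) ≤ A.initLen := by exact_mod_cast hI
    have h2 : (A.initLen : ℝ) ≤ K * (Real.log A.T + 2) := by
      unfold Setup.initLen
      push_cast
      have := Nat.ceil_lt_add_one (show 0 ≤ Real.log A.T by linarith)
      exact mul_le_mul_of_nonneg_left (by linarith) (by linarith)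
    have h3 : (K : ℝ) * Real.log A.T ≤ √(A.T : ℝ) * √(K : ℝ) := by
      rw [← Real.sqrt_mul (by linarith)]
      refine Real.le_sqrt_of_sq_le ?_
      nlinarith
    have h4 : √(A.T : ℝ) * √(K : ℝ) ≤ √(A.T : ℝ) * Z :=
      mul_le_mul_of_nonneg_left hZ (by linarith)
    nlinarith

end Expectation

/-! ### Suprema over the simplex -/

lemma sum_mul_sqrt_le {c w : Fin K → ℝ} (hc : ∀ i, 0 ≤ c i) (hw : w ∈ stdSimplex ℝ (Fin K)) :
    ∑ i, c i * √(w i) ≤ ∑ i, c i := by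
  refine Finset.sum_le_sum fun i _ => mul_le_of_le_one_right (hc i) (Real.sqrt_le_one.2 ?_)
  rw [← hw.2]
  exact Finset.single_le_sum (fun i _ => hw.1 i) (Finset.mem_univ i)

/-- The bound `B` is indispensable: the supremum of an unbounded set of reals is `0` by convention.
-/
lemma le_sSup_image_div {g : (Fin K → ℝ) → ℝ} {B s : ℝ} (hs : 0 < s)
    (hB : ∀ w ∈ stdSimplex ℝ (Fin K), g w ≤ B) {w : Fin K → ℝ} (hw : w ∈ stdSimplex ℝ (Fin K)) :
    g w ≤ sSup ((fun w => s * g w) '' stdSimplex ℝ (Fin K)) / s := by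
  rw [le_div_iff₀' hs]
  refine le_csSup ⟨s * B, ?_⟩ ⟨w, hw, rfl⟩
  rintro _ ⟨v, hv, rfl⟩
  exact mul_le_mul_of_nonneg_left (hB v hv) hs.le

lemma uniform_mem_stdSimplex (hK : 0 < K) :
    (fun _ => 1 / (K : ℝ)) ∈ stdSimplex ℝ (Fin K) := by
  refine ⟨fun _ => by positivity, ?_⟩
  have : (K : ℝ) ≠ 0 := by positivity
  simp [this]

lemma sqrt_card_le_sum {c : Fin K → ℝ} (hc : ∀ i, 1 ≤ c i) :
    √(K : ℝ) ≤ ∑ i, c i * √(1 / (K : ℝ)) := by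
  calc √(K : ℝ) = ∑ _i : Fin K, 1 * √(1 / (K : ℝ)) := by
        rw [Finset.sum_const, Finset.card_univ, Fintype.card_fin, nsmul_eq_mul, one_mul,
          Real.sqrt_div zero_le_one, Real.sqrt_one, mul_one_div, Real.div_sqrt]
    _ ≤ _ := Finset.sum_le_sum fun i _ =>
        mul_le_mul_of_nonneg_right (hc i) (Real.sqrt_nonneg _)

end Corral

/-! ### The choice of `Z` and the two bounds. -/

theorem theorem5 :
    ∃ C : ℝ, 0 < C ∧
      ∀ (K : ℕ) (k : Fin K → ℕ) (A : Corral.Setup K k)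
        (Ω : Type*) (mΩ : MeasurableSpace Ω) (P : Measure Ω) (_ : IsProbabilityMeasure P)
        (ℱ : Filtration ℕ mΩ) (X : Ω → Corral.Path K k)
        (iStar : Fin K) (jStar : Fin (k iStar)) (R Rbar : ℕ → ℝ),
        2 ≤ A.T →
        (K : ℝ) * Real.log A.T ^ 2 ≤ A.T →
        (∀ i, 0 < A.η i) →
        A.η iStar ≤ 1 →
        Corral.IsRun A P ℱ X →
        (∀ t, 0 ≤ R t) →
        (∀ t ∈ Finset.Icc 1 A.T, R t ≤ Rbar t) →
        A.IsStable P X iStar jStar R →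
        (∀ t ∈ Finset.Icc 1 A.T,
          A.η iStar * (50 * Rbar t)
            ≤ (1 - Real.exp (-(1 / Real.log A.T ^ 2))) * Real.sqrt t) →
        A.expectedRegret P X iStar jStar
            ≤ C * (sSup ((fun w : Fin K → ℝ =>
                  Real.sqrt A.T * ∑ i, (A.η i + 1 / A.η i) * Real.sqrt (w i))
                    '' stdSimplex ℝ (Fin K)) + R A.T)
          ∧ ((∀ i, A.η i ≤ 1) →
            A.expectedRegret P X iStar jStar
              ≤ C * (sSup ((fun w : Fin K → ℝ =>
                    Real.sqrt A.T * ∑ i, Real.sqrt (w i) / A.η i)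
                      '' stdSimplex ℝ (Fin K)) + R A.T)) := by
  refine ⟨Real.exp 1000, Real.exp_pos _, ?_⟩
  intro K k A Ω mΩ P _ ℱ X iStar jStar R Rbar hT hKT hη hη1 hrun hR0 hRb hstab hstep
  have hsT : 0 < Real.sqrt A.T := Real.sqrt_pos.2 (by exact_mod_cast (by omega : 0 < A.T))
  have hu := Corral.uniform_mem_stdSimplex iStar.pos
  have hR : ∀ s ∈ Finset.Icc 1 A.T,
      R s ≤ (1 - 1 / Corral.beta A.T) * (Real.sqrt s / (50 * A.η iStar)) := by
    intro s hs
    have h1 := hstep s hs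
    have h2 := hη iStar
    refine (hRb s hs).trans ?_
    rw [← mul_div_assoc, le_div_iff₀ (by positivity), Corral.beta, one_div (Real.exp _),
      ← Real.exp_neg]
    linarith
  have hsum_pos : ∀ i, 1 ≤ A.η i + 1 / A.η i := by
    intro i
    have h1 := hη i
    have h2 : A.η i * (1 / A.η i) = 1 := mul_one_div_cancel h1.ne'
    have h3 : 0 < 1 / A.η i := by positivity
    nlinarith [sq_nonneg (A.η i - 1 / A.η i)]
  refine ⟨?_, fun hle => ?_⟩
  · set S := sSup ((fun w : Fin K → ℝ =>
      Real.sqrt A.T * ∑ i, (A.η i + 1 / A.η i) * Real.sqrt (w i)) '' stdSimplex ℝ (Fin K))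
    have hS : ∀ w ∈ stdSimplex ℝ (Fin K),
        ∑ i, (A.η i + 1 / A.η i) * Real.sqrt (w i) ≤ S / Real.sqrt A.T := fun w hw =>
      Corral.le_sSup_image_div hsT
        (fun v hv => Corral.sum_mul_sqrt_le (fun i => zero_le_one.trans (hsum_pos i)) hv) hw
    -- With `Z` the supremum divided by `√T`, the product `√T * Z` is the supremum itself. The
    -- uniform distribution shows `√K ≤ Z`.
    have h := hrun.expectedRegret_le (Z := S / Real.sqrt A.T) hT hKT hη
      (fun w hw => (Finset.sum_le_sum fun i _ => by
        have h1 := mul_nonneg (hη i).le (Real.sqrt_nonneg (w i))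
        rw [add_mul, one_div_mul_eq_div]
        linarith).trans (hS w hw))
      (fun w hw => (Finset.sum_le_sum fun i _ => by
        have h1 := div_nonneg (Real.sqrt_nonneg (w i)) (hη i).le
        rw [add_mul, one_div_mul_eq_div]
        linarith).trans (hS w hw))
      ((Corral.sqrt_card_le_sum hsum_pos).trans (hS _ hu)) hη1 jStar hR0 hstab hR
    rw [mul_div_cancel₀ _ hsT.ne'] at h
    -- The stability cost has been cancelled entirely, so `R A.T` is merely added.
    exact h.trans (mul_le_mul_of_nonneg_left (le_add_of_nonneg_right (hR0 _)) (Real.exp_pos _).le)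
  · set S := sSup ((fun w : Fin K → ℝ =>
      Real.sqrt A.T * ∑ i, Real.sqrt (w i) / A.η i) '' stdSimplex ℝ (Fin K))
    have hinv : ∀ i, 1 ≤ 1 / A.η i := fun i => (one_le_div (hη i)).2 (hle i)
    have hS : ∀ w ∈ stdSimplex ℝ (Fin K),
        ∑ i, Real.sqrt (w i) / A.η i ≤ S / Real.sqrt A.T := fun w hw =>
      Corral.le_sSup_image_div hsT (B := ∑ i, 1 / A.η i) (fun v hv => by
        have h1 := Corral.sum_mul_sqrt_le (fun i => zero_le_one.trans (hinv i)) hv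
        simpa only [one_div_mul_eq_div] using h1) hw
    have h := hrun.expectedRegret_le (Z := S / Real.sqrt A.T) hT hKT hη hS
      -- As `η ≤ 1 ≤ 1/η`, the single sum with `1/η` dominates both sums required of `Z`.
      (fun w hw => (Finset.sum_le_sum fun i _ => by
        rw [div_eq_mul_one_div, mul_comm]
        exact mul_le_mul_of_nonneg_left ((hle i).trans (hinv i)) (Real.sqrt_nonneg _)).trans
          (hS w hw))
      ((Corral.sqrt_card_le_sum hinv).trans (by
        simpa only [one_div_mul_eq_div] using hS _ hu)) hη1 jStar hR0 hstab hR
    rw [mul_div_cancel₀ _ hsT.ne'] at h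
    exact h.trans (mul_le_mul_of_nonneg_left (le_add_of_nonneg_right (hR0 _)) (Real.exp_pos _).le)
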